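/- Let $G(n,p)$ denote the random graph on the vertex set $\{1,\dots,n\}$ in which each pair of distinct vertices is joined by an edge with probability $p$, independently of all other pairs. First-order (FO) sentences about graphs are built from the relation symbols $\sim$ (adjacency) and $=$, logical connectives, variables ranging over vertices, and the quantifiers $\forall,\exists$; the quantifier depth of a sentence is the number of nested quantifiers in a longest sequence of nested quantifiers. For a function $p=p(n)$, the random graph $G(n,p)$ obeys the FO zero-one $k$-law if for every FO sentence $\varphi$ of quantifier depth at most $k$ the probability that $G(n,p(n))$ satisfies $\varphi$ tends, as $n\to\infty$, either to $1$ or to $0$. **Theorem.** Let $\alpha>0$. The random graph $G(n,n^{-\alpha})$ does not obey the FO zero-one $3$-law if and only if $$\alpha\in\left\{1,\tfrac{7}{6},\tfrac{6}{5},\tfrac{5}{4},\tfrac{4}{3},\tfrac{3}{2},2\right\}.$$ -/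

import Mathlib

open FirstOrder Filter Topology MeasureTheory

/-- The quantifier depth of a first-order formula: the number of nested quantifiers in a longest
sequence of nested quantifiers. In Mathlib the primitive connectives are falsity, implication and
the universal quantifier; the other connectives are built from falsity and implication (and thus
have as depth the maximum of the depths of their parts), and `∃` is `¬ ∀ ¬`. -/
def FirstOrder.Language.BoundedFormula.quantifierDepth {L : Language} {β : Type*} :
    {m : ℕ} → L.BoundedFormula β m → ℕ
  | _, .falsum => 0
  | _, .equal _ _ => 0
  | _, .rel _ _ => 0
  | _, .imp f g => max f.quantifierDepth g.quantifierDepth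
  | _, .all f => f.quantifierDepth + 1

/-- `G ⊨ φ`: the first-order sentence `φ` in the language of graphs is true in the graph `G`. -/
def SimpleGraph.SatisfiesFO {V : Type*} (G : SimpleGraph V) (φ : Language.graph.Sentence) : Prop :=
  @Language.Sentence.Realize Language.graph V G.structure φ

/-- The probability that the binomial random graph `G(n, p)`, with vertex set `Fin n`, satisfies
the first-order sentence `φ`. -/
noncomputable def probSatisfiesFO (n : ℕ) (p : unitInterval) (φ : Language.graph.Sentence) : ℝ :=
  (SimpleGraph.binomialRandom (Fin n) p).real {G | G.SatisfiesFO φ}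

/-- `G(n, p(n))` obeys the FO zero-one `k`-law: every first-order sentence of quantifier depth
at most `k` is either asymptotically almost surely true or asymptotically almost surely false.
(Depth "at most `k`" and "exactly `k`" give the same notion, as the depth of a sentence can be
increased by conjoining a valid sentence of depth `k`.) -/
def ObeysFOZeroOneLaw (p : ℕ → unitInterval) (k : ℕ) : Prop :=
  ∀ φ : Language.graph.Sentence, φ.quantifierDepth ≤ k →
    Tendsto (fun n => probSatisfiesFO n (p n) φ) atTop (𝓝 1) ∨
    Tendsto (fun n => probSatisfiesFO n (p n) φ) atTop (𝓝 0)

/-- The edge probability `n ^ (-α)`, for `α > 0`. It lies in `[0, 1]` for every `n`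
(at `n = 0`, where it is irrelevant, it is `0`). -/
noncomputable def powEdgeProb (α : ℝ) (hα : 0 < α) (n : ℕ) : unitInterval :=
  ⟨(n : ℝ) ^ (-α), Real.rpow_nonneg n.cast_nonneg _, by
    rcases Nat.eq_zero_or_pos n with rfl | hn
    · simp [Real.zero_rpow (neg_ne_zero.mpr hα.ne')]
    · exact Real.rpow_le_one_of_one_le_of_nonpos (by exact_mod_cast hn) (by linarith)⟩

/-! Whether a graph satisfies a sentence of depth three is decided by a three-round
Ehrenfeucht–Fraïssé game. It is therefore decided by the set of vertex types: a pair type records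
adjacency and which of the four adjacency patterns a third vertex can have, and a vertex type is the
set of pair types starting at the vertex (`satisfiesFO_iff_of_graphType_eq`). The law holds once the
random graph lies a.a.s. in a class of graphs sharing one `graphType` (`obeysFOZeroOneLaw_of_aas`).

For α > 1 there are a.a.s. no cycles of length at most six, and a vertex type reduces to five yes/no
features of the tree-like neighbourhood (`SameLocalType`). Every realisable combination of features
forces a tree on some m ≤ 7 vertices, and some tree on m vertices realises it as an isolated
component (`SparseTypical.exists_vertexType_eq`). Trees on m vertices are a.a.s. absent if α >
m/(m-1) and have many isolated copies if α < m/(m-1). Hence away from the values m/(m-1), 2 ≤ m ≤ 7,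
the set of vertex types depends on α alone.

At α = m/(m-1) the expected number of labelled paths on m vertices is about 1. Some sentence of
depth three holds whenever there is an isolated such path and, without short cycles, holds only if
there is such a path. The second moment keeps its probability away from 0; reversing a path shows
that labelled copies come in pairs, so the probability is at most 1/2 + o(1)
(`not_obeysFOZeroOneLaw_of_path`). At α = 1 triangles play the role of the path.

For α < 1 all extensions of a pair by a third vertex exist except possibly a common neighbour
(`Rich`), so only adjacency and common neighbours matter. For α < 1/2 all pairs have common
neighbours. For 1/2 ≤ α < 1 every vertex has both a neighbour and a non-neighbour with which it
shares no neighbour, and the type of a vertex only tells whether it lies in a triangle. All vertices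
do if α < 2/3. If α ≥ 2/3, the number of labelled triangles concentrates around n^(3-3α), which
diverges but is at most n, so some vertices do and some do not. Thus neither 1/2 nor 2/3 is
exceptional. -/

namespace SimpleGraph

/-! ### Ehrenfeucht–Fraïssé games and depth-three types -/

variable {V W : Type*}

/-- Duplicator wins the `k`-round Ehrenfeucht–Fraïssé game on `G` and `H` from the position in
which the vertices `a` and `b` have been chosen. -/
def EFEquiv (G : SimpleGraph V) (H : SimpleGraph W) :
    ℕ → {m : ℕ} → (Fin m → V) → (Fin m → W) → Prop
  | 0, _, a, b => ∀ i j, (a i = a j ↔ b i = b j) ∧ (G.Adj (a i) (a j) ↔ H.Adj (b i) (b j))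
  | k + 1, m, a, b => EFEquiv G H 0 a b ∧
      (∀ x, ∃ y, EFEquiv G H k (Fin.snoc a x : Fin (m + 1) → V) (Fin.snoc b y)) ∧
      (∀ y, ∃ x, EFEquiv G H k (Fin.snoc a x : Fin (m + 1) → V) (Fin.snoc b y))

theorem efEquiv_zero_iff {G : SimpleGraph V} {H : SimpleGraph W} {m : ℕ} {a : Fin m → V}
    {b : Fin m → W} : EFEquiv G H 0 a b ↔
      ∀ i j, (a i = a j ↔ b i = b j) ∧ (G.Adj (a i) (a j) ↔ H.Adj (b i) (b j)) := by
  rw [EFEquiv]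

theorem efEquiv_succ_iff {G : SimpleGraph V} {H : SimpleGraph W} {k m : ℕ} {a : Fin m → V}
    {b : Fin m → W} : EFEquiv G H (k + 1) a b ↔ EFEquiv G H 0 a b ∧
      (∀ x, ∃ y, EFEquiv G H k (Fin.snoc a x : Fin (m + 1) → V) (Fin.snoc b y)) ∧
      (∀ y, ∃ x, EFEquiv G H k (Fin.snoc a x : Fin (m + 1) → V) (Fin.snoc b y)) := by
  rw [efEquiv_zero_iff, EFEquiv, efEquiv_zero_iff]

theorem EFEquiv.zero {G : SimpleGraph V} {H : SimpleGraph W} {k m : ℕ} {a : Fin m → V}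
    {b : Fin m → W} (h : EFEquiv G H k a b) : EFEquiv G H 0 a b := by
  cases k with
  | zero => exact h
  | succ k => exact (efEquiv_succ_iff.1 h).1

/-- Induction on the formula, each universal quantifier using up one round of the game. The language
has no function symbols, so all terms are variables. -/
theorem EFEquiv.realize_iff {G : SimpleGraph V} {H : SimpleGraph W} {m : ℕ}
    (φ : Language.graph.BoundedFormula Empty m) {k : ℕ} (hk : φ.quantifierDepth ≤ k)
    {a : Fin m → V} {b : Fin m → W} (h : EFEquiv G H k a b) :
    (@Language.BoundedFormula.Realize _ V G.structure _ _ φ default a ↔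
      @Language.BoundedFormula.Realize _ W H.structure _ _ φ default b) := by
  have term_var : ∀ {m : ℕ} (t : Language.graph.Term (Empty ⊕ Fin m)),
      ∃ i, t = Language.Term.var (Sum.inr i) := by
    intro m t
    cases t with
    | var v =>
      cases v with
      | inl e => exact e.elim
      | inr i => exact ⟨i, rfl⟩
    | func f _ => exact Empty.elim f
  let := G.structure
  let := H.structure
  induction φ generalizing k with
  | falsum => exact Iff.rfl
  | equal t₁ t₂ =>
    obtain ⟨i, rfl⟩ := term_var t₁
    obtain ⟨j, rfl⟩ := term_var t₂
    exact (efEquiv_zero_iff.1 h.zero i j).1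
  | @rel n l R ts =>
    cases R
    obtain ⟨i, hi⟩ := term_var (ts 0)
    obtain ⟨j, hj⟩ := term_var (ts 1)
    have := (efEquiv_zero_iff.1 h.zero i j).2
    change G.Adj ((ts 0).realize _) ((ts 1).realize _) ↔
      H.Adj ((ts 0).realize _) ((ts 1).realize _)
    rw [hi, hj]
    exact this
  | imp f g ihf ihg =>
    have hk' := max_le_iff.1 hk
    exact imp_congr (ihf hk'.1 h) (ihg hk'.2 h)
  | all f ih =>
    obtain ⟨k, rfl⟩ : ∃ k', k = k' + 1 := ⟨k - 1, by
      have : f.quantifierDepth + 1 ≤ k := hk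
      omega⟩
    have hk' : f.quantifierDepth ≤ k := Nat.le_of_succ_le_succ hk
    constructor
    · intro hG y
      obtain ⟨x, hx⟩ := (efEquiv_succ_iff.1 h).2.2 y
      exact (ih hk' hx).1 (hG x)
    · intro hH x
      obtain ⟨y, hy⟩ := (efEquiv_succ_iff.1 h).2.1 x
      exact (ih hk' hy).2 (hH y)

theorem EFEquiv.satisfiesFO_iff {G : SimpleGraph V} {H : SimpleGraph W} {k : ℕ}
    (h : EFEquiv G H k (default : Fin 0 → V) (default : Fin 0 → W))
    {φ : Language.graph.Sentence} (hφ : φ.quantifierDepth ≤ k) :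
    G.SatisfiesFO φ ↔ H.SatisfiesFO φ := by
  have := h.realize_iff φ hφ
  unfold SatisfiesFO Language.Sentence.Realize Language.Formula.Realize
  exact this

theorem efEquiv_zero_snoc {G : SimpleGraph V} {H : SimpleGraph W} {m : ℕ} {a : Fin m → V}
    {b : Fin m → W} {x : V} {y : W} (h : EFEquiv G H 0 a b)
    (hxy : ∀ i, (a i = x ↔ b i = y) ∧ (G.Adj (a i) x ↔ H.Adj (b i) y)) :
    EFEquiv G H 0 (Fin.snoc a x : Fin (m + 1) → V) (Fin.snoc b y : Fin (m + 1) → W) := by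
  rw [efEquiv_zero_iff] at h ⊢
  intro i j
  refine Fin.lastCases ?_ (fun i => ?_) i <;> refine Fin.lastCases ?_ (fun j => ?_) j
  · simp
  · simpa [eq_comm, adj_comm] using hxy j
  · simpa using hxy i
  · simpa using h i j

/-- `x` and `y` have a common neighbour. -/
def HasCommonNbr (G : SimpleGraph V) (x y : V) : Prop := ∃ z, G.Adj x z ∧ G.Adj y z

/-- `x` has a neighbour other than `y` which is not adjacent to `y`. -/
def HasPrivateNbr (G : SimpleGraph V) (x y : V) : Prop := ∃ z, G.Adj x z ∧ ¬ G.Adj y z ∧ z ≠ y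

/-- There is a vertex other than `x` and `y` which is adjacent to neither of them. -/
def HasCommonNonNbr (G : SimpleGraph V) (x y : V) : Prop :=
  ∃ z, ¬ G.Adj x z ∧ ¬ G.Adj y z ∧ z ≠ x ∧ z ≠ y

/-- The depth-one type of a pair of distinct vertices. -/
def pairType (G : SimpleGraph V) (x y : V) : Prop × Prop × Prop × Prop × Prop :=
  (G.Adj x y, G.HasCommonNbr x y, G.HasPrivateNbr x y, G.HasPrivateNbr y x, G.HasCommonNonNbr x y)

/-- The depth-two type of a vertex: the set of the types of the pairs in which it occurs first. -/
def vertexType (G : SimpleGraph V) (x : V) : Set (Prop × Prop × Prop × Prop × Prop) :=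
  {t | ∃ y, y ≠ x ∧ G.pairType x y = t}

/-- The depth-three type of a graph: the set of the types of its vertices. -/
def graphType (G : SimpleGraph V) : Set (Set (Prop × Prop × Prop × Prop × Prop)) :=
  Set.range G.vertexType

/-- The vertex `z` repeats one of the pair or has one of four adjacency patterns to it, and the last
four entries of the pair type say which patterns occur. -/
theorem exists_matching_third_vertex {G : SimpleGraph V} {H : SimpleGraph W} {x x' : V} {y y' : W}
    (h : G.pairType x x' = H.pairType y y') (hx : x ≠ x') (hy : y ≠ y') (z : V) :
    ∃ w, ((x = z ↔ y = w) ∧ (G.Adj x z ↔ H.Adj y w)) ∧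
      ((x' = z ↔ y' = w) ∧ (G.Adj x' z ↔ H.Adj y' w)) := by
  simp only [pairType, Prod.mk.injEq, eq_iff_iff] at h
  obtain ⟨h1, h2, h3, h4, h5⟩ := h
  by_cases hzx : x = z
  · subst hzx
    exact ⟨y, by simp, by simp [hx.symm, hy.symm], by rw [adj_comm, h1, adj_comm]⟩
  by_cases hzx' : x' = z
  · subst hzx'
    exact ⟨y', by simp [hx, hy, h1], by simp⟩
  by_cases ha : G.Adj x z <;> by_cases hb : G.Adj x' z
  · obtain ⟨w, hw, hw'⟩ := h2.1 ⟨z, ha, hb⟩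
    exact ⟨w, by simp [hzx, hw.ne, ha, hw], by simp [hzx', hw'.ne, hb, hw']⟩
  · obtain ⟨w, hw, hw', hne⟩ := h3.1 ⟨z, ha, hb, Ne.symm hzx'⟩
    exact ⟨w, by simp [hzx, hw.ne, ha, hw], by simp [hzx', hne.symm, hb, hw']⟩
  · obtain ⟨w, hw, hw', hne⟩ := h4.1 ⟨z, hb, ha, Ne.symm hzx⟩
    exact ⟨w, by simp [hzx, hne.symm, ha, hw'], by simp [hzx', hw.ne, hb, hw]⟩
  · obtain ⟨w, hw, hw', hne, hne'⟩ := h5.1 ⟨z, ha, hb, Ne.symm hzx, Ne.symm hzx'⟩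
    exact ⟨w, by simp [hzx, hne.symm, ha, hw], by simp [hzx', hne'.symm, hb, hw']⟩

theorem exists_matching_second_vertex {G : SimpleGraph V} {H : SimpleGraph W} {x : V} {y : W}
    (h : G.vertexType x = H.vertexType y) (z : V) (hz : z ≠ x) :
    ∃ w, w ≠ y ∧ G.pairType x z = H.pairType y w := by
  have : G.pairType x z ∈ H.vertexType y := h ▸ ⟨z, hz, rfl⟩
  obtain ⟨w, hw, hw'⟩ := this
  exact ⟨w, hw, hw'.symm⟩

theorem exists_matching_second_vertex_adj {G : SimpleGraph V} {H : SimpleGraph W} {x : V} {y : W}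
    (h : G.vertexType x = H.vertexType y) (z : V) :
    ∃ w, (x = z ↔ y = w) ∧ (G.Adj x z ↔ H.Adj y w) := by
  by_cases hz : z = x
  · exact ⟨y, by simp [hz], by simp [hz]⟩
  · obtain ⟨w, hw, hw'⟩ := exists_matching_second_vertex h z hz
    simp only [pairType, Prod.mk.injEq, eq_iff_iff] at hw'
    exact ⟨w, by simp [hw.symm, Ne.symm hz], hw'.1⟩

theorem efEquiv_one_of_pairType_eq {G : SimpleGraph V} {H : SimpleGraph W} {x x' : V} {y y' : W}
    (h : G.pairType x x' = H.pairType y y') (hx : x ≠ x') (hy : y ≠ y') {a : Fin 2 → V}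
    {b : Fin 2 → W} (ha : a = ![x, x']) (hb : b = ![y, y']) : EFEquiv G H 1 a b := by
  subst ha hb
  have h0 : EFEquiv G H 0 ![x, x'] ![y, y'] := by
    have h1 : G.Adj x x' ↔ H.Adj y y' := by
      simp only [pairType, Prod.mk.injEq, eq_iff_iff] at h
      exact h.1
    refine efEquiv_zero_iff.2 fun i j => ?_
    fin_cases i <;> fin_cases j <;>
      simp [hx, hy, hx.symm, hy.symm, h1, G.adj_comm x' x, H.adj_comm y' y]
  refine efEquiv_succ_iff.2 ⟨h0, fun z => ?_, fun w => ?_⟩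
  · obtain ⟨w, h1, h2⟩ := exists_matching_third_vertex h hx hy z
    exact ⟨w, efEquiv_zero_snoc h0 (Fin.forall_fin_two.2 ⟨h1, h2⟩)⟩
  · obtain ⟨z, h1, h2⟩ := exists_matching_third_vertex h.symm hy hx w
    exact ⟨z, efEquiv_zero_snoc h0 (Fin.forall_fin_two.2
      ⟨⟨h1.1.symm, h1.2.symm⟩, ⟨h2.1.symm, h2.2.symm⟩⟩)⟩

/-- The degenerate position in which Spoiler chose the same vertex twice; pair types cover distinct
vertices only. -/
theorem efEquiv_one_of_vertexType_eq {G : SimpleGraph V} {H : SimpleGraph W} {x : V} {y : W}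
    (h : G.vertexType x = H.vertexType y) {a : Fin 2 → V}
    {b : Fin 2 → W} (ha : a = ![x, x]) (hb : b = ![y, y]) : EFEquiv G H 1 a b := by
  subst ha hb
  have h0 : EFEquiv G H 0 ![x, x] ![y, y] := by
    refine efEquiv_zero_iff.2 fun i j => ?_
    fin_cases i <;> fin_cases j <;> simp
  refine efEquiv_succ_iff.2 ⟨h0, fun z => ?_, fun w => ?_⟩
  · obtain ⟨w, h1⟩ := exists_matching_second_vertex_adj h z
    exact ⟨w, efEquiv_zero_snoc h0 (Fin.forall_fin_two.2 ⟨h1, h1⟩)⟩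
  · obtain ⟨z, h1⟩ := exists_matching_second_vertex_adj h.symm w
    exact ⟨z, efEquiv_zero_snoc h0 (Fin.forall_fin_two.2
      ⟨⟨h1.1.symm, h1.2.symm⟩, ⟨h1.1.symm, h1.2.symm⟩⟩)⟩

theorem efEquiv_two_of_vertexType_eq {G : SimpleGraph V} {H : SimpleGraph W} {x : V} {y : W}
    (h : G.vertexType x = H.vertexType y) {a : Fin 1 → V}
    {b : Fin 1 → W} (ha : a = ![x]) (hb : b = ![y]) : EFEquiv G H 2 a b := by
  have snoc_eq : ∀ {U : Type _} (u v : U), (Fin.snoc ![u] v : Fin 2 → U) = ![u, v] := by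
    intro U u v
    funext i
    fin_cases i <;> rfl
  -- A second copy of `snoc_eq`: a local statement is fixed to one universe, while `V` and `W` may
  -- live in different ones.
  have snoc_eq' : ∀ {U : Type _} (u v : U), (Fin.snoc ![u] v : Fin 2 → U) = ![u, v] := by
    intro U u v
    funext i
    fin_cases i <;> rfl
  subst ha hb
  refine efEquiv_succ_iff.2 ⟨efEquiv_zero_iff.2 fun i j => by fin_cases i; fin_cases j; simp,
    fun z => ?_, fun w => ?_⟩
  · by_cases hz : z = x
    · exact ⟨y, efEquiv_one_of_vertexType_eq h (by rw [snoc_eq, hz]) (by rw [snoc_eq'])⟩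
    · obtain ⟨w, hw, hp⟩ := exists_matching_second_vertex h z hz
      exact ⟨w, efEquiv_one_of_pairType_eq hp (Ne.symm hz) hw.symm (snoc_eq _ _) (snoc_eq' _ _)⟩
  · by_cases hw : w = y
    · exact ⟨x, efEquiv_one_of_vertexType_eq h (by rw [snoc_eq]) (by rw [snoc_eq', hw])⟩
    · obtain ⟨z, hz, hp⟩ := exists_matching_second_vertex h.symm w hw
      exact ⟨z, efEquiv_one_of_pairType_eq hp.symm hz.symm (Ne.symm hw) (snoc_eq _ _)
        (snoc_eq' _ _)⟩

theorem efEquiv_three_of_graphType_eq {G : SimpleGraph V} {H : SimpleGraph W}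
    (h : G.graphType = H.graphType) :
    EFEquiv G H 3 (default : Fin 0 → V) (default : Fin 0 → W) := by
  refine efEquiv_succ_iff.2 ⟨efEquiv_zero_iff.2 fun i => i.elim0, fun x => ?_, fun y => ?_⟩
  · obtain ⟨y, hy⟩ : G.vertexType x ∈ H.graphType := h ▸ ⟨x, rfl⟩
    refine ⟨y, efEquiv_two_of_vertexType_eq hy.symm ?_ ?_⟩ <;> funext i <;> fin_cases i <;> rfl
  · obtain ⟨x, hx⟩ : H.vertexType y ∈ G.graphType := h ▸ ⟨y, rfl⟩
    refine ⟨x, efEquiv_two_of_vertexType_eq hx ?_ ?_⟩ <;> funext i <;> fin_cases i <;> rfl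

theorem satisfiesFO_iff_of_graphType_eq {G : SimpleGraph V} {H : SimpleGraph W}
    (h : G.graphType = H.graphType) {φ : Language.graph.Sentence} (hφ : φ.quantifierDepth ≤ 3) :
    G.SatisfiesFO φ ↔ H.SatisfiesFO φ :=
  (efEquiv_three_of_graphType_eq h).satisfiesFO_iff hφ

end SimpleGraph

/-! ### Expectation over a random subset -/

section RandomSubset

variable {ι : Type*}

/-- The expectation of `f S`, where the random subset `S` of `U` contains each element of `U`
with probability `p`, independently. -/
noncomputable def subsetExp (p : ℝ) (U : Finset ι) (f : Finset ι → ℝ) : ℝ :=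
  ∑ S ∈ U.powerset, p ^ S.card * (1 - p) ^ (U.card - S.card) * f S

theorem subsetExp_empty (p : ℝ) (f : Finset ι → ℝ) : subsetExp p ∅ f = f ∅ := by
  simp [subsetExp]

theorem subsetExp_insert [DecidableEq ι] (p : ℝ) {U : Finset ι} {a : ι} (ha : a ∉ U)
    (f : Finset ι → ℝ) :
    subsetExp p (insert a U) f =
      (1 - p) * subsetExp p U f + p * subsetExp p U (fun S => f (insert a S)) := by
  unfold subsetExp
  rw [Finset.sum_powerset_insert ha, Finset.mul_sum, Finset.mul_sum]
  congr 1
  · refine Finset.sum_congr rfl fun S hS => ?_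
    have hc := Finset.card_le_card (Finset.mem_powerset.1 hS)
    rw [Finset.card_insert_of_notMem ha, Nat.succ_sub hc, pow_succ]
    ring
  · refine Finset.sum_congr rfl fun S hS => ?_
    have haS : a ∉ S := fun h => ha (Finset.mem_powerset.1 hS h)
    rw [Finset.card_insert_of_notMem ha, Finset.card_insert_of_notMem haS, Nat.add_sub_add_right,
      pow_succ]
    ring

theorem subsetExp_congr (p : ℝ) {U : Finset ι} {f g : Finset ι → ℝ} (h : ∀ S ⊆ U, f S = g S) :
    subsetExp p U f = subsetExp p U g :=
  Finset.sum_congr rfl fun S hS => by rw [h S (Finset.mem_powerset.1 hS)]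

theorem subsetExp_union [DecidableEq ι] (p : ℝ) {A B : Finset ι} (h : Disjoint A B)
    (f : Finset ι → ℝ) :
    subsetExp p (A ∪ B) f = subsetExp p A (fun S => subsetExp p B (fun T => f (S ∪ T))) := by
  induction A using Finset.induction_on generalizing f with
  | empty => simp [subsetExp_empty]
  | insert a A ha ih =>
    have h' := Finset.disjoint_insert_left.1 h
    have haAB : a ∉ A ∪ B := by simp [ha, h'.1]
    rw [Finset.insert_union, subsetExp_insert p haAB, subsetExp_insert p ha, ih h'.2, ih h'.2]
    simp [Finset.insert_union]

theorem subsetExp_const (p : ℝ) (U : Finset ι) (c : ℝ) : subsetExp p U (fun _ => c) = c := by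
  classical
  induction U using Finset.induction_on with
  | empty => simp [subsetExp_empty]
  | insert a U ha ih => rw [subsetExp_insert p ha, ih]; ring

theorem subsetExp_mul_left (p : ℝ) (U : Finset ι) (c : ℝ) (f : Finset ι → ℝ) :
    subsetExp p U (fun S => c * f S) = c * subsetExp p U f := by
  unfold subsetExp
  rw [Finset.mul_sum]
  exact Finset.sum_congr rfl fun S _ => by ring

theorem subsetExp_add (p : ℝ) (U : Finset ι) (f g : Finset ι → ℝ) :
    subsetExp p U (fun S => f S + g S) = subsetExp p U f + subsetExp p U g := by
  unfold subsetExp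
  rw [← Finset.sum_add_distrib]
  exact Finset.sum_congr rfl fun S _ => by ring

theorem subsetExp_mono {p : ℝ} (hp0 : 0 ≤ p) (hp1 : p ≤ 1) (U : Finset ι) {f g : Finset ι → ℝ}
    (h : ∀ S, f S ≤ g S) : subsetExp p U f ≤ subsetExp p U g := by
  refine Finset.sum_le_sum fun S _ => mul_le_mul_of_nonneg_left (h S) ?_
  have : 0 ≤ 1 - p := by linarith
  positivity

/-- Independence of functions of disjoint sets of coordinates. Splitting `U` into its parts inside
and outside `A` makes the expectation an iterated one, in which `f` sees only the first part and `g`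
only the second. -/
theorem subsetExp_mul_of_disjoint (p : ℝ) (U : Finset ι) {A B : Set ι} (hAB : Disjoint A B)
    {f g : Finset ι → ℝ}
    (hf : ∀ S T : Finset ι, (∀ a ∈ A, a ∈ S ↔ a ∈ T) → f S = f T)
    (hg : ∀ S T : Finset ι, (∀ a ∈ B, a ∈ S ↔ a ∈ T) → g S = g T) :
    subsetExp p U (fun S => f S * g S) = subsetExp p U f * subsetExp p U g := by
  classical
  obtain ⟨U₁, U₂, hU, hU₁, hU₂, hd⟩ : ∃ U₁ U₂ : Finset ι, U = U₁ ∪ U₂ ∧ (∀ a ∈ U₁, a ∈ A) ∧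
      (∀ a ∈ U₂, a ∉ A) ∧ Disjoint U₁ U₂ :=
    ⟨U.filter (· ∈ A), U.filter (· ∉ A), (Finset.filter_union_filter_not_eq _ _).symm,
      fun a ha => (Finset.mem_filter.1 ha).2, fun a ha => (Finset.mem_filter.1 ha).2,
      Finset.disjoint_filter_filter_not _ _ _⟩
  have key : ∀ u v : Finset ι → ℝ,
      (∀ S T : Finset ι, (∀ a ∈ A, a ∈ S ↔ a ∈ T) → u S = u T) →
      (∀ S T : Finset ι, (∀ a ∈ B, a ∈ S ↔ a ∈ T) → v S = v T) →
      subsetExp p U (fun S => u S * v S) = subsetExp p U₁ u * subsetExp p U₂ v := by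
    intro u v hu hv
    rw [hU, subsetExp_union p hd]
    have : ∀ S ⊆ U₁, subsetExp p U₂ (fun T => u (S ∪ T) * v (S ∪ T)) =
        subsetExp p U₂ v * u S := by
      intro S hS
      rw [mul_comm, ← subsetExp_mul_left]
      refine subsetExp_congr p fun T hT => ?_
      congr 1
      · refine hu _ _ fun a ha => ?_
        simp only [Finset.mem_union, or_iff_left_iff_imp]
        exact fun h => absurd ha (hU₂ a (hT h))
      · refine hv _ _ fun a ha => ?_
        simp only [Finset.mem_union, or_iff_right_iff_imp]
        exact fun h => absurd ha (Set.disjoint_left.1 hAB (hU₁ a (hS h)))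
    rw [subsetExp_congr p this, subsetExp_mul_left, mul_comm]
  -- With one factor constant, `key` identifies the expectations over the two parts with
  -- expectations over all of `U`.
  have h1 := key f (fun _ => 1) hf (fun _ _ _ => rfl)
  have h2 := key (fun _ => 1) g (fun _ _ _ => rfl) hg
  simp only [mul_one, one_mul, subsetExp_const] at h1 h2
  rw [key f g hf hg, h1, h2]

end RandomSubset

/-! ### Expectation over the binomial random graph -/

namespace SimpleGraph

variable {n : ℕ}

open Classical in
/-- The set of potential edges of a graph on `Fin n`. -/
noncomputable def potentialEdges (n : ℕ) : Finset (Sym2 (Fin n)) :=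
  Finset.univ.filter fun e => ¬ e.IsDiag

/-- The expectation of `f G` for the binomial random graph `G` on `Fin n`. -/
noncomputable def graphExp (p : ℝ) (f : SimpleGraph (Fin n) → ℝ) : ℝ :=
  subsetExp p (potentialEdges n) fun S => f (fromEdgeSet (S : Set (Sym2 (Fin n))))

open Classical in
/-- The probability of an event for the binomial random graph on `Fin n`. -/
noncomputable def graphProb (p : ℝ) (A : SimpleGraph (Fin n) → Prop) : ℝ :=
  graphExp p fun G => if A G then 1 else 0

/-- Sets of potential edges correspond bijectively to graphs, and the weight of a set is the measure
of the corresponding singleton. Through this bridge all probabilities become finite weighted sums.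
-/
theorem graphExp_eq_sum (p : unitInterval) (f : SimpleGraph (Fin n) → ℝ) :
    graphExp p f = ∑ G : SimpleGraph (Fin n), (binomialRandom (Fin n) p).real {G} * f G := by
  classical
  unfold graphExp subsetExp
  refine Finset.sum_bij' (fun S _ => fromEdgeSet (S : Set (Sym2 (Fin n))))
    (fun G _ => G.edgeSet.toFinite.toFinset) (fun _ _ => Finset.mem_univ _) ?_ ?_ ?_ ?_
  · intro G _
    rw [Finset.mem_powerset]
    intro e he
    rw [potentialEdges, Finset.mem_filter]
    exact ⟨Finset.mem_univ _, G.not_isDiag_of_mem_edgeSet ((Set.Finite.mem_toFinset _).1 he)⟩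
  · intro S hS
    ext e
    rw [Set.Finite.mem_toFinset, edgeSet_fromEdgeSet]
    simp only [Set.mem_sdiff, Finset.mem_coe, and_iff_left_iff_imp]
    intro he
    have := Finset.mem_powerset.1 hS he
    rw [potentialEdges, Finset.mem_filter] at this
    exact this.2
  · intro G _
    simp
  · intro S hS
    have hS' : (S : Set (Sym2 (Fin n))) \ Sym2.diagSet = S := by
      ext e
      simp only [Set.mem_sdiff, Finset.mem_coe, and_iff_left_iff_imp]
      intro he
      have := Finset.mem_powerset.1 hS he
      rw [potentialEdges, Finset.mem_filter] at this
      exact this.2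
    congr 1
    rw [measureReal_def, binomialRandom_singleton, edgeSet_fromEdgeSet]
    have hc : (potentialEdges n).card = n.choose 2 := by
      have := Sym2.card_diagSet_compl (α := Fin n)
      rw [Fintype.card_fin] at this
      rw [← this, potentialEdges, ← Set.toFinset_card]
      congr 1
      ext e
      simp
    rw [hS', Set.ncard_coe_finset, hc]
    simp [ENNReal.toReal_mul]

theorem graphProb_eq_measure (p : unitInterval) (A : SimpleGraph (Fin n) → Prop) :
    graphProb (p : ℝ) A = (binomialRandom (Fin n) p).real {G | A G} := by
  classical
  have : MeasurableSingletonClass (SimpleGraph (Fin n)) := by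
    refine ⟨fun G => ?_⟩
    have h : ({G} : Set (SimpleGraph (Fin n))) = edgeSet ⁻¹' {G.edgeSet} := by
      ext H
      simp
    rw [h]
    exact measurable_edgeSet (measurableSet_singleton _)
  rw [graphProb, graphExp_eq_sum]
  simp only [mul_ite, mul_one, mul_zero]
  rw [← Finset.sum_filter, sum_measureReal_singleton, Finset.coe_filter_univ]

end SimpleGraph

/-! ### Linearity, moment inequalities and independence for the random graph -/

namespace SimpleGraph

variable {n : ℕ} {p : ℝ}

theorem graphExp_const (p : ℝ) (c : ℝ) : graphExp p (fun _ : SimpleGraph (Fin n) => c) = c :=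
  subsetExp_const _ _ _

theorem graphExp_add (p : ℝ) (f g : SimpleGraph (Fin n) → ℝ) :
    graphExp p (fun G => f G + g G) = graphExp p f + graphExp p g :=
  subsetExp_add _ _ _ _

theorem graphExp_mul_left (p : ℝ) (c : ℝ) (f : SimpleGraph (Fin n) → ℝ) :
    graphExp p (fun G => c * f G) = c * graphExp p f :=
  subsetExp_mul_left _ _ _ _

theorem graphExp_sub (p : ℝ) (f g : SimpleGraph (Fin n) → ℝ) :
    graphExp p (fun G => f G - g G) = graphExp p f - graphExp p g := by
  have := graphExp_add p f (fun G => (-1) * g G)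
  rw [graphExp_mul_left] at this
  simpa [sub_eq_add_neg] using this

theorem graphExp_sum {κ : Type*} (p : ℝ) (J : Finset κ) (f : κ → SimpleGraph (Fin n) → ℝ) :
    graphExp p (fun G => ∑ j ∈ J, f j G) = ∑ j ∈ J, graphExp p (f j) := by
  classical
  induction J using Finset.induction_on with
  | empty => simp [graphExp_const]
  | insert a J ha ih => simp only [Finset.sum_insert ha, graphExp_add, ih]

theorem graphExp_mono (hp : p ∈ Set.Icc (0 : ℝ) 1) {f g : SimpleGraph (Fin n) → ℝ}
    (h : ∀ G, f G ≤ g G) : graphExp p f ≤ graphExp p g :=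
  subsetExp_mono hp.1 hp.2 _ fun _ => h _

theorem graphProb_mono (hp : p ∈ Set.Icc (0 : ℝ) 1) {A B : SimpleGraph (Fin n) → Prop}
    (h : ∀ G, A G → B G) : graphProb p A ≤ graphProb p B := by
  refine graphExp_mono hp fun G => ?_
  by_cases hA : A G
  · simp [hA, h G hA]
  · simp only [hA, if_false]
    split_ifs <;> norm_num

theorem graphProb_congr {A B : SimpleGraph (Fin n) → Prop} (h : ∀ G, A G ↔ B G) :
    graphProb p A = graphProb p B := by
  rw [show A = B from funext fun G => propext (h G)]

theorem graphProb_false (p : ℝ) : graphProb p (fun _ : SimpleGraph (Fin n) => False) = 0 := by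
  simp [graphProb, graphExp_const]

theorem graphProb_nonneg (hp : p ∈ Set.Icc (0 : ℝ) 1) (A : SimpleGraph (Fin n) → Prop) :
    0 ≤ graphProb p A :=
  graphProb_false (n := n) p ▸ graphProb_mono hp (by simp)

theorem graphProb_not (p : ℝ) (A : SimpleGraph (Fin n) → Prop) :
    graphProb p (fun G => ¬ A G) = 1 - graphProb p A := by
  rw [eq_sub_iff_add_eq]
  unfold graphProb
  rw [← graphExp_add]
  refine Eq.trans ?_ (graphExp_const (n := n) p 1)
  congr 1
  funext G
  by_cases hA : A G <;> simp [hA]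

theorem graphProb_or_le (hp : p ∈ Set.Icc (0 : ℝ) 1) (A B : SimpleGraph (Fin n) → Prop) :
    graphProb p (fun G => A G ∨ B G) ≤ graphProb p A + graphProb p B := by
  unfold graphProb
  rw [← graphExp_add]
  refine graphExp_mono hp fun G => ?_
  by_cases hA : A G <;> by_cases hB : B G <;> simp [hA, hB]

theorem graphProb_exists_mem_le {κ : Type*} (hp : p ∈ Set.Icc (0 : ℝ) 1) (J : Finset κ)
    (A : κ → SimpleGraph (Fin n) → Prop) :
    graphProb p (fun G => ∃ j ∈ J, A j G) ≤ ∑ j ∈ J, graphProb p (A j) := by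
  unfold graphProb
  rw [← graphExp_sum]
  refine graphExp_mono hp fun G => ?_
  have h0 : ∀ j ∈ J, (0 : ℝ) ≤ @ite ℝ (A j G) (Classical.propDecidable _) 1 0 := fun j _ => by
    split_ifs <;> norm_num
  by_cases h : ∃ j ∈ J, A j G
  · obtain ⟨j, hj, hA⟩ := h
    have := Finset.single_le_sum h0 hj
    rw [if_pos ⟨j, hj, hA⟩]
    rwa [if_pos hA] at this
  · rw [if_neg h]
    exact Finset.sum_nonneg h0

theorem graphProb_exists_le {κ : Type*} [Fintype κ] (hp : p ∈ Set.Icc (0 : ℝ) 1)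
    (A : κ → SimpleGraph (Fin n) → Prop) {b : ℝ} (hA : ∀ j, graphProb p (A j) ≤ b) :
    graphProb p (fun G => ∃ j, A j G) ≤ Fintype.card κ * b := by
  have := graphProb_exists_mem_le hp Finset.univ A
  simp only [Finset.mem_univ, true_and] at this
  refine this.trans ((Finset.sum_le_sum fun j _ => hA j).trans ?_)
  simp

/-- Markov's inequality. -/
theorem mul_graphProb_le_graphExp (hp : p ∈ Set.Icc (0 : ℝ) 1) {A : SimpleGraph (Fin n) → Prop}
    {f : SimpleGraph (Fin n) → ℝ} {c : ℝ} (h0 : ∀ G, 0 ≤ f G) (h : ∀ G, A G → c ≤ f G) :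
    c * graphProb p A ≤ graphExp p f := by
  unfold graphProb
  rw [← graphExp_mul_left]
  refine graphExp_mono hp fun G => ?_
  by_cases hA : A G
  · simpa [hA] using h G hA
  · simpa [hA] using h0 G

/-- A form of the Paley–Zygmund inequality. -/
theorem two_mul_graphExp_sub_le (hp : p ∈ Set.Icc (0 : ℝ) 1) {A : SimpleGraph (Fin n) → Prop}
    {f : SimpleGraph (Fin n) → ℝ} (h : ∀ G, ¬ A G → f G = 0) (t : ℝ) :
    2 * t * graphExp p f - graphExp p (fun G => f G ^ 2) ≤ t ^ 2 * graphProb p A := by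
  unfold graphProb
  rw [← graphExp_mul_left, ← graphExp_mul_left, ← graphExp_sub]
  refine graphExp_mono hp fun G => ?_
  by_cases hA : A G
  · simp only [hA, if_true]
    -- Pointwise `2 t f - f² ≤ t²`, because `(f - t)² ≥ 0`.
    nlinarith [sq_nonneg (f G - t)]
  · simp [hA, h G hA]

/-- The function `f` of a graph depends only on the presence of the edges in `D`. -/
def DependsOnEdges {V β : Type*} (f : SimpleGraph V → β) (D : Set (Sym2 V)) : Prop :=
  ∀ G H : SimpleGraph V, (∀ e ∈ D, e ∈ G.edgeSet ↔ e ∈ H.edgeSet) → f G = f H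

theorem graphExp_mul_of_disjoint (p : ℝ) {f g : SimpleGraph (Fin n) → ℝ}
    {A B : Set (Sym2 (Fin n))} (hf : DependsOnEdges f A) (hg : DependsOnEdges g B)
    (hAB : Disjoint A B) :
    graphExp p (fun G => f G * g G) = graphExp p f * graphExp p g := by
  refine subsetExp_mul_of_disjoint p _ hAB (fun S T h => hf _ _ fun e he => ?_)
    (fun S T h => hg _ _ fun e he => ?_) <;>
  simp [edgeSet_fromEdgeSet, h e he]

theorem graphProb_and_of_disjoint (p : ℝ) {P Q : SimpleGraph (Fin n) → Prop}
    {A B : Set (Sym2 (Fin n))} (hf : DependsOnEdges P A) (hg : DependsOnEdges Q B)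
    (hAB : Disjoint A B) :
    graphProb p (fun G => P G ∧ Q G) = graphProb p P * graphProb p Q := by
  unfold graphProb
  rw [← graphExp_mul_of_disjoint p (A := A) (B := B) _ _ hAB]
  · congr 1
    funext G
    by_cases h1 : P G <;> by_cases h2 : Q G <;> simp [h1, h2]
  · intro G H h
    have e := Iff.of_eq (hf G H h)
    by_cases hH : P H
    · simp [hH, e.2 hH]
    · simp [hH, mt e.1 hH]
  · intro G H h
    have e := Iff.of_eq (hg G H h)
    by_cases hH : Q H
    · simp [hH, e.2 hH]
    · simp [hH, mt e.1 hH]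

theorem DependsOnEdges.prod {V κ : Type*} {J : Finset κ} {f : κ → SimpleGraph V → ℝ}
    {D : κ → Set (Sym2 V)} (h : ∀ j ∈ J, DependsOnEdges (f j) (D j)) :
    DependsOnEdges (fun G => ∏ j ∈ J, f j G) (⋃ j ∈ J, D j) := by
  intro G H hGH
  refine Finset.prod_congr rfl fun j hj => h j hj G H fun e he => hGH e ?_
  simp only [Set.mem_iUnion]
  exact ⟨j, hj, he⟩

theorem graphExp_prod_of_pairwiseDisjoint {κ : Type*} (p : ℝ) {J : Finset κ}
    {f : κ → SimpleGraph (Fin n) → ℝ} {D : κ → Set (Sym2 (Fin n))}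
    (h : ∀ j ∈ J, DependsOnEdges (f j) (D j)) (hD : (J : Set κ).PairwiseDisjoint D) :
    graphExp p (fun G => ∏ j ∈ J, f j G) = ∏ j ∈ J, graphExp p (f j) := by
  classical
  induction J using Finset.induction_on with
  | empty => simp [graphExp_const]
  | insert a J ha ih =>
    have h' : ∀ j ∈ J, DependsOnEdges (f j) (D j) := fun j hj => h j (Finset.mem_insert_of_mem hj)
    simp only [Finset.prod_insert ha]
    rw [graphExp_mul_of_disjoint p (h a (Finset.mem_insert_self _ _)) (DependsOnEdges.prod h'),
      ih h' (hD.subset (by simp))]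
    simp only [Set.disjoint_iUnion_right]
    intro j hj
    exact hD (by simp) (by simp [hj]) (fun h => ha (h ▸ hj))

theorem dependsOnEdges_singleton {V β : Type*} (e : Sym2 V) (F : Prop → β) :
    DependsOnEdges (fun G => F (e ∈ G.edgeSet)) {e} := by
  intro G H h
  have := h e rfl
  simp only [this]

/-- Splitting off the coordinate `e` leaves expectations of constants. -/
theorem graphExp_edge (p : ℝ) {e : Sym2 (Fin n)} (he : ¬ e.IsDiag) (F : Prop → ℝ) :
    graphExp p (fun G => F (e ∈ G.edgeSet)) = p * F True + (1 - p) * F False := by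
  classical
  have h1 : potentialEdges n = insert e ((potentialEdges n).erase e) :=
    (Finset.insert_erase (by simp [potentialEdges, he])).symm
  have h2 : subsetExp p ((potentialEdges n).erase e)
      (fun S => F (e ∈ (fromEdgeSet (S : Set (Sym2 (Fin n)))).edgeSet)) = F False := by
    rw [← subsetExp_const p ((potentialEdges n).erase e) (F False)]
    refine subsetExp_congr p fun S hS => ?_
    have : e ∉ S := fun h => Finset.notMem_erase e _ (hS h)
    simp [edgeSet_fromEdgeSet, this]
  have h3 : subsetExp p ((potentialEdges n).erase e)
      (fun S => F (e ∈ (fromEdgeSet ((insert e S : Finset _) : Set (Sym2 (Fin n)))).edgeSet)) =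
      F True := by
    rw [← subsetExp_const p ((potentialEdges n).erase e) (F True)]
    refine subsetExp_congr p fun S hS => ?_
    simp [edgeSet_fromEdgeSet, he]
  unfold graphExp
  rw [h1, subsetExp_insert p (Finset.notMem_erase _ _), h2, h3]
  ring

/-- The probability that all edges in `F₁` are present and all edges in `F₂` are absent. -/
theorem graphProb_edges (p : ℝ) {F₁ F₂ : Finset (Sym2 (Fin n))} (h₁ : ∀ e ∈ F₁, ¬ e.IsDiag)
    (h₂ : ∀ e ∈ F₂, ¬ e.IsDiag) (hd : Disjoint F₁ F₂) :
    graphProb p (fun G => (∀ e ∈ F₁, e ∈ G.edgeSet) ∧ ∀ e ∈ F₂, e ∉ G.edgeSet) =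
      p ^ F₁.card * (1 - p) ^ F₂.card := by
  classical
  -- The indicator that `e` has its prescribed status; the event's indicator is the product of these
  -- independent factors.
  obtain ⟨f, hf⟩ : ∃ f : Sym2 (Fin n) → Prop → ℝ, ∀ e P, f e P = if (P ↔ e ∈ F₁) then 1 else 0 :=
    ⟨_, fun _ _ => rfl⟩
  have h3 : graphProb p (fun G => (∀ e ∈ F₁, e ∈ G.edgeSet) ∧ ∀ e ∈ F₂, e ∉ G.edgeSet) =
      graphExp p (fun G => ∏ e ∈ F₁ ∪ F₂, f e (e ∈ G.edgeSet)) := by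
    unfold graphProb
    congr 1
    funext G
    by_cases h : (∀ e ∈ F₁, e ∈ G.edgeSet) ∧ ∀ e ∈ F₂, e ∉ G.edgeSet
    · rw [if_pos h, Finset.prod_eq_one]
      intro e he
      by_cases he1 : e ∈ F₁
      · simp [hf, he1, h.1 e he1]
      · have he2 : e ∈ F₂ := (Finset.mem_union.1 he).resolve_left he1
        simp [hf, he1, h.2 e he2]
    · rw [if_neg h, eq_comm, Finset.prod_eq_zero_iff]
      rw [not_and_or] at h
      push Not at h
      rcases h with ⟨e, he, heG⟩ | ⟨e, he, heG⟩
      · exact ⟨e, Finset.mem_union_left _ he, by simp [hf, he, heG]⟩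
      · exact ⟨e, Finset.mem_union_right _ he, by simp [hf, heG, Finset.disjoint_right.1 hd he]⟩
  rw [h3, graphExp_prod_of_pairwiseDisjoint p (D := fun e => {e})
    (fun e _ => dependsOnEdges_singleton e (f e)), Finset.prod_union hd]
  · congr 1
    · refine Finset.prod_eq_pow_card fun e he => ?_
      rw [graphExp_edge p (h₁ e he)]
      simp [hf, he]
    · refine Finset.prod_eq_pow_card fun e he => ?_
      rw [graphExp_edge p (h₂ e he)]
      simp [hf, Finset.disjoint_right.1 hd he]
  · intro a _ b _ hab
    simpa using hab

theorem graphProb_forall_mem_edges (p : ℝ) {F : Finset (Sym2 (Fin n))}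
    (h : ∀ e ∈ F, ¬ e.IsDiag) :
    graphProb p (fun G => ∀ e ∈ F, e ∈ G.edgeSet) = p ^ F.card := by
  have := graphProb_edges p h (F₂ := ∅) (by simp) (by simp)
  simpa using this

/-- The probability that none of several events depending on disjoint sets of edges occurs. -/
theorem graphProb_forall_mem_not {κ : Type*} (p : ℝ) {J : Finset κ}
    {A : κ → SimpleGraph (Fin n) → Prop} {D : κ → Set (Sym2 (Fin n))}
    (h : ∀ j ∈ J, DependsOnEdges (A j) (D j)) (hD : (J : Set κ).PairwiseDisjoint D) :
    graphProb p (fun G => ∀ j ∈ J, ¬ A j G) = ∏ j ∈ J, (1 - graphProb p (A j)) := by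
  classical
  have h1 : ∀ j ∈ J, (1 - graphProb p (A j)) = graphExp p (fun G => if A j G then 0 else 1) := by
    intro j _
    rw [← graphProb_not]
    unfold graphProb
    congr 1
    funext G
    by_cases hA : A j G <;> simp [hA]
  rw [Finset.prod_congr rfl h1, ← graphExp_prod_of_pairwiseDisjoint p (D := D) _ hD]
  · unfold graphProb
    congr 1
    funext G
    by_cases hG : ∀ j ∈ J, ¬ A j G
    · rw [if_pos hG, Finset.prod_eq_one]
      intro j hj
      simp [hG j hj]
    · rw [if_neg hG, eq_comm, Finset.prod_eq_zero_iff]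
      push Not at hG
      obtain ⟨j, hj, hA⟩ := hG
      exact ⟨j, hj, by simp [hA]⟩
  · intro j hj G H hGH
    simp [h j hj G H hGH]

end SimpleGraph

namespace SimpleGraph

variable {n m : ℕ} {p : ℝ}

/-! ### Counting events -/

open Classical in
/-- The number of events in a finite family which occur. -/
noncomputable def eventCount {V κ : Type*} [Fintype κ] (A : κ → SimpleGraph V → Prop)
    (G : SimpleGraph V) : ℝ := ∑ k, if A k G then 1 else 0

theorem graphExp_eventCount {κ : Type*} [Fintype κ] (A : κ → SimpleGraph (Fin n) → Prop) :
    graphExp p (eventCount A) = ∑ k, graphProb p (A k) := by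
  unfold eventCount graphProb
  exact graphExp_sum _ _ _

theorem graphExp_eventCount_sq {κ : Type*} [Fintype κ] (A : κ → SimpleGraph (Fin n) → Prop) :
    graphExp p (fun G => eventCount A G ^ 2) =
      ∑ k, ∑ l, graphProb p (fun G => A k G ∧ A l G) := by
  unfold graphProb
  simp only [← graphExp_sum]
  congr 1
  funext G
  rw [eventCount, sq, Finset.sum_mul_sum]
  refine Finset.sum_congr rfl fun k _ => Finset.sum_congr rfl fun l _ => ?_
  by_cases h1 : A k G <;> by_cases h2 : A l G <;> simp [h1, h2]

theorem eventCount_eq_card {V κ : Type*} [Fintype κ] (A : κ → SimpleGraph V → Prop)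
    (G : SimpleGraph V) : eventCount A G = Nat.card {k // A k G} := by
  classical
  rw [eventCount, Finset.sum_boole, Nat.card_eq_fintype_card, Fintype.card_subtype]

theorem eventCount_nonneg {V κ : Type*} [Fintype κ] (A : κ → SimpleGraph V → Prop)
    (G : SimpleGraph V) : 0 ≤ eventCount A G := by
  rw [eventCount_eq_card]
  positivity

theorem eventCount_eq_zero {V κ : Type*} [Fintype κ] {A : κ → SimpleGraph V → Prop}
    {G : SimpleGraph V} (h : ¬ ∃ k, A k G) : eventCount A G = 0 := by
  push Not at h
  simp [eventCount, h]

theorem two_le_eventCount {V κ : Type*} [Fintype κ] {A : κ → SimpleGraph V → Prop}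
    {G : SimpleGraph V} {k l : κ} (hk : A k G) (hl : A l G) (hkl : k ≠ l) :
    2 ≤ eventCount A G := by
  rw [eventCount_eq_card]
  have : Nontrivial {k // A k G} := ⟨⟨k, hk⟩, ⟨l, hl⟩, by simpa using hkl⟩
  exact_mod_cast Finite.one_lt_card

/-- Chebyshev's inequality, for a random variable whose first two moments are close to those
of a constant. -/
theorem graphProb_le_of_second_moment (hp : p ∈ Set.Icc (0 : ℝ) 1) {X : SimpleGraph (Fin n) → ℝ}
    {M r δ : ℝ} (hM : 0 < M) (h1 : r * M ≤ graphExp p X)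
    (h2 : graphExp p (fun G => X G ^ 2) ≤ (1 + δ) * M ^ 2) {A : SimpleGraph (Fin n) → Prop}
    (hA : ∀ G, A G → M / 2 ≤ |X G - M|) : graphProb p A ≤ 4 * (δ + 2 * (1 - r)) := by
  have h3 : graphExp p (fun G => (X G - M) ^ 2) =
      graphExp p (fun G => X G ^ 2) - 2 * M * graphExp p X + M ^ 2 := by
    have : (fun G => (X G - M) ^ 2) = fun G => (X G ^ 2 - 2 * M * X G) + M ^ 2 := by
      funext G; ring
    rw [this, graphExp_add, graphExp_sub, graphExp_mul_left, graphExp_const]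
  have h4 := mul_graphProb_le_graphExp (A := A) (f := fun G => (X G - M) ^ 2) (c := (M / 2) ^ 2) hp
    (fun G => sq_nonneg _) (fun G hG => by
      rw [← sq_abs (X G - M)]
      exact pow_le_pow_left₀ (by positivity) (hA G hG) 2)
  rw [h3] at h4
  have h5 : M ^ 2 * graphProb p A ≤ M ^ 2 * (4 * (δ + 2 * (1 - r))) := by
    nlinarith [mul_le_mul_of_nonneg_left h1 hM.le]
  exact le_of_mul_le_mul_left h5 (by positivity)

/-- The choice `t = (1 + δ) M` in `two_mul_graphExp_sub_le`. The bound stays useful when `δ` is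
bounded but not small, which is the situation at the thresholds. -/
theorem le_graphProb_of_second_moment (hp : p ∈ Set.Icc (0 : ℝ) 1) {X : SimpleGraph (Fin n) → ℝ}
    {M r δ : ℝ} (hM : 0 < M) (hδ : 0 ≤ δ) (h1 : r * M ≤ graphExp p X)
    (h2 : graphExp p (fun G => X G ^ 2) ≤ (1 + δ) * M ^ 2) {A : SimpleGraph (Fin n) → Prop}
    (hA : ∀ G, ¬ A G → X G = 0) : (2 * r - 1) / (1 + δ) ≤ graphProb p A := by
  have h3 := two_mul_graphExp_sub_le (A := A) (f := X) hp hA ((1 + δ) * M)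
  rw [div_le_iff₀ (by positivity)]
  have h4 : (1 + δ) * M ^ 2 * (2 * r - 1) ≤ (1 + δ) * M ^ 2 * (graphProb p A * (1 + δ)) := by
    nlinarith [mul_le_mul_of_nonneg_left h1 (by positivity : 0 ≤ 2 * ((1 + δ) * M))]
  exact le_of_mul_le_mul_left h4 (by positivity)

/-! ### Copies of a pattern -/

/-- `f` embeds the pattern `H` into `G` as a subgraph. -/
def IsCopy {U V : Type*} (H : SimpleGraph U) (f : U → V) (G : SimpleGraph V) : Prop :=
  Function.Injective f ∧ ∀ i j, H.Adj i j → G.Adj (f i) (f j)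

/-- `f` embeds the pattern `H` into `G` as a union of connected components. -/
def IsIsolatedCopy {U V : Type*} (H : SimpleGraph U) (f : U → V) (G : SimpleGraph V) : Prop :=
  IsCopy H f G ∧ ∀ i v, G.Adj (f i) v → ∃ j, H.Adj i j ∧ v = f j

section

variable (H : SimpleGraph (Fin m)) [DecidableRel H.Adj]

/-- The image of the edge set of the pattern `H` under `f`. -/
def imageEdges {V : Type*} [DecidableEq V] (f : Fin m → V) : Finset (Sym2 V) :=
  H.edgeFinset.image (Sym2.map f)

variable {H}

theorem isCopy_iff_forall_imageEdges {V : Type*} [DecidableEq V] {f : Fin m → V}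
    (hf : Function.Injective f) {G : SimpleGraph V} :
    IsCopy H f G ↔ ∀ e ∈ H.imageEdges f, e ∈ G.edgeSet := by
  simp only [IsCopy, hf, true_and, imageEdges, Finset.forall_mem_image, mem_edgeFinset]
  constructor
  · intro h e
    induction e with
    | _ i j => exact fun he => h i j he
  · intro h i j hij
    exact h (x := s(i, j)) hij

theorem card_imageEdges {V : Type*} [DecidableEq V] {f : Fin m → V} (hf : Function.Injective f) :
    (H.imageEdges f).card = H.edgeFinset.card :=
  Finset.card_image_of_injective _ (Sym2.map.injective hf)

theorem not_isDiag_of_mem_imageEdges {V : Type*} [DecidableEq V] {f : Fin m → V}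
    (hf : Function.Injective f) {e : Sym2 V} (he : e ∈ H.imageEdges f) : ¬ e.IsDiag := by
  obtain ⟨e', he', rfl⟩ := Finset.mem_image.1 he
  rw [Sym2.isDiag_map hf]
  exact H.not_isDiag_of_mem_edgeSet (mem_edgeFinset.1 he')

theorem graphProb_isCopy {f : Fin m → Fin n} (hf : Function.Injective f) :
    graphProb p (IsCopy H f) = p ^ H.edgeFinset.card := by
  rw [graphProb_congr (fun G => isCopy_iff_forall_imageEdges hf),
    graphProb_forall_mem_edges p (fun e he => not_isDiag_of_mem_imageEdges hf he),
    card_imageEdges hf]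

theorem graphProb_isCopy_le (hp : p ∈ Set.Icc (0 : ℝ) 1) (f : Fin m → Fin n) :
    graphProb p (IsCopy H f) ≤ p ^ H.edgeFinset.card := by
  by_cases hf : Function.Injective f
  · exact (graphProb_isCopy hf).le
  · rw [graphProb_congr (B := fun _ => False) (fun G => ⟨fun h => hf h.1, False.elim⟩),
      graphProb_false]
    exact pow_nonneg hp.1 _

theorem graphExp_eventCount_isCopy_le (hp : p ∈ Set.Icc (0 : ℝ) 1) :
    graphExp p (eventCount fun f : Fin m → Fin n => IsCopy H f) ≤
      (n : ℝ) ^ m * p ^ H.edgeFinset.card := by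
  rw [graphExp_eventCount]
  refine (Finset.sum_le_sum fun f _ => graphProb_isCopy_le hp f).trans ?_
  simp

theorem graphProb_exists_isCopy_le (hp : p ∈ Set.Icc (0 : ℝ) 1) :
    graphProb p (fun G => ∃ f : Fin m → Fin n, IsCopy H f G) ≤
      (n : ℝ) ^ m * p ^ H.edgeFinset.card := by
  have := graphProb_exists_le hp (fun f : Fin m → Fin n => IsCopy H f) (graphProb_isCopy_le hp)
  simpa using this

/-- The first moment bound for a pattern with a non-trivial symmetry. -/
theorem two_mul_graphProb_exists_isCopy_le (hp : p ∈ Set.Icc (0 : ℝ) 1) {σ : Fin m → Fin m}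
    (hσ : Function.Injective σ) (hσH : ∀ i j, H.Adj i j → H.Adj (σ i) (σ j)) {i₀ : Fin m}
    (hi₀ : σ i₀ ≠ i₀) :
    2 * graphProb p (fun G => ∃ f : Fin m → Fin n, IsCopy H f G) ≤
      (n : ℝ) ^ m * p ^ H.edgeFinset.card := by
  refine le_trans ?_ (graphExp_eventCount_isCopy_le hp)
  refine mul_graphProb_le_graphExp hp (eventCount_nonneg _) ?_
  rintro G ⟨f, hf⟩
  -- Composing with the symmetry turns one labelled copy into a second, different one, so Markov's
  -- inequality gains a factor 2.
  refine two_le_eventCount (k := f) (l := f ∘ σ) hf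
    ⟨hf.1.comp hσ, fun i j hij => hf.2 _ _ (hσH i j hij)⟩ fun h => hi₀ ?_
  exact hf.1 (congrFun h i₀).symm

/-! ### The second moment of the number of isolated copies of a tree -/

/-- Isolation only requires the pairs that meet the image of `f` and are not pattern edges to be
absent, and there are at most `m * n` of them. -/
theorem le_graphProb_isIsolatedCopy (hp : p ∈ Set.Icc (0 : ℝ) 1) {f : Fin m → Fin n}
    (hf : Function.Injective f) :
    p ^ H.edgeFinset.card * (1 - p) ^ (m * n) ≤ graphProb p (IsIsolatedCopy H f) := by
  classical
  set F₂ : Finset (Sym2 (Fin n)) :=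
    (Finset.univ.image fun x : Fin m × Fin n => s(f x.1, x.2)).filter
      fun e => ¬ e.IsDiag ∧ e ∉ H.imageEdges f with hF₂
  have hcard : F₂.card ≤ m * n := by
    refine (Finset.card_filter_le _ _).trans (Finset.card_image_le.trans ?_)
    simp
  have h1 : p ^ H.edgeFinset.card * (1 - p) ^ (m * n) ≤
      p ^ (H.imageEdges f).card * (1 - p) ^ F₂.card := by
    rw [card_imageEdges hf]
    refine mul_le_mul_of_nonneg_left ?_ (pow_nonneg hp.1 _)
    exact pow_le_pow_of_le_one (by linarith [hp.2]) (by linarith [hp.1]) hcard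
  refine h1.trans ?_
  rw [← graphProb_edges p (fun e he => not_isDiag_of_mem_imageEdges hf he)
    (fun e he => (Finset.mem_filter.1 he).2.1)
    (Finset.disjoint_left.2 fun e he he' => (Finset.mem_filter.1 he').2.2 he)]
  refine graphProb_mono hp fun G hG => ⟨(isCopy_iff_forall_imageEdges hf).2 hG.1, fun i v hv => ?_⟩
  by_contra hcon
  refine hG.2 s(f i, v) (Finset.mem_filter.2 ⟨Finset.mem_image.2 ⟨(i, v), by simp, rfl⟩,
    by simpa using hv.ne, fun hmem => hcon ?_⟩) hv
  obtain ⟨e, he, hev⟩ := Finset.mem_image.1 hmem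
  induction e with
  | _ a b =>
    rw [mem_edgeFinset, mem_edgeSet] at he
    rw [Sym2.map_mk, Sym2.eq_iff] at hev
    rcases hev with ⟨h1, h2⟩ | ⟨h1, h2⟩
    · exact ⟨b, hf h1 ▸ he, h2.symm⟩
    · exact ⟨a, hf h2 ▸ he.symm, h1.symm⟩

theorem le_graphExp_eventCount_of_injective {A : (Fin m → Fin n) → SimpleGraph (Fin n) → Prop}
    {b : ℝ} (hp : p ∈ Set.Icc (0 : ℝ) 1) (hA : ∀ f, Function.Injective f → b ≤ graphProb p (A f)) :
    (n.descFactorial m : ℝ) * b ≤ graphExp p (eventCount A) := by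
  classical
  rw [graphExp_eventCount]
  have h1 : ((Finset.univ : Finset (Fin m → Fin n)).filter Function.Injective).card =
      n.descFactorial m := by
    rw [← Fintype.card_subtype, Fintype.card_congr (Equiv.subtypeInjectiveEquivEmbedding _ _),
      Fintype.card_embedding_eq]
    simp
  calc (n.descFactorial m : ℝ) * b
      = ∑ f ∈ (Finset.univ : Finset (Fin m → Fin n)).filter Function.Injective, b := by
        simp [h1]
    _ ≤ ∑ f ∈ (Finset.univ : Finset (Fin m → Fin n)).filter Function.Injective,
          graphProb p (A f) :=
        Finset.sum_le_sum fun f hf => hA f (Finset.mem_filter.1 hf).2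
    _ ≤ ∑ f, graphProb p (A f) :=
        Finset.sum_le_sum_of_subset_of_nonneg (Finset.filter_subset _ _)
          fun f _ _ => graphProb_nonneg hp _

omit [DecidableRel H.Adj] in
-- The hypothesis `hH` encodes connectedness: every vertex but 0 has an earlier neighbour.
-- Membership in the range of `f`, a union of components, is carried along edges from the meeting
-- point down to vertex 0 and from there up to all vertices.
theorem IsIsolatedCopy.mem_range_of_meet {V : Type*}
    (hH : ∀ k : Fin m, (k : ℕ) ≠ 0 → ∃ j < k, H.Adj j k) {f g : Fin m → V} {G : SimpleGraph V}
    (hf : IsIsolatedCopy H f G) (hg : IsIsolatedCopy H g G) {j : Fin m}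
    (hj : g j ∈ Set.range f) (k : Fin m) : g k ∈ Set.range f := by
  have step : ∀ a b, H.Adj a b → g a ∈ Set.range f → g b ∈ Set.range f := by
    rintro a b hab ⟨i, hi⟩
    obtain ⟨l, -, hl⟩ := hf.2 i (g b) (hi ▸ hg.1.2 a b hab)
    exact ⟨l, hl.symm⟩
  have down : ∀ N : ℕ, ∀ a : Fin m, (a : ℕ) = N → g a ∈ Set.range f →
      ∃ z : Fin m, (z : ℕ) = 0 ∧ g z ∈ Set.range f := by
    intro N
    induction N using Nat.strong_induction_on with
    | _ N ih =>
      intro a ha hga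
      by_cases h0 : (a : ℕ) = 0
      · exact ⟨a, h0, hga⟩
      · obtain ⟨b, hb, hab⟩ := hH a h0
        exact ih b (ha ▸ hb) b rfl (step a b hab.symm hga)
  obtain ⟨z, hz, hgz⟩ := down j j rfl hj
  have up : ∀ N : ℕ, ∀ a : Fin m, (a : ℕ) = N → g a ∈ Set.range f := by
    intro N
    induction N using Nat.strong_induction_on with
    | _ N ih =>
      intro a ha
      by_cases h0 : (a : ℕ) = 0
      · rwa [show a = z from Fin.ext (h0.trans hz.symm)]
      · obtain ⟨b, hb, hab⟩ := hH a h0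
        exact step b a hab (ih b (ha ▸ hb) b rfl)
  exact up k k rfl

/-- Two isolated copies of a connected pattern that meet have the same vertex set, so `g = f ∘ τ`;
each `f` has at most `m ^ m` such partners. Copies that do not meet have disjoint edge sets, which
bounds the joint probability by `q ^ 2`. -/
theorem graphExp_eventCount_isIsolatedCopy_sq_le (hp : p ∈ Set.Icc (0 : ℝ) 1)
    (hH : ∀ k : Fin m, (k : ℕ) ≠ 0 → ∃ j < k, H.Adj j k) :
    graphExp p (fun G => eventCount (fun f : Fin m → Fin n => IsIsolatedCopy H f) G ^ 2) ≤
      ((n : ℝ) ^ m * p ^ H.edgeFinset.card) ^ 2 +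
        m ^ m * ((n : ℝ) ^ m * p ^ H.edgeFinset.card) := by
  classical
  set q := p ^ H.edgeFinset.card with hq
  have hq0 : 0 ≤ q := pow_nonneg hp.1 _
  have hle : ∀ f : Fin m → Fin n, graphProb p (IsIsolatedCopy H f) ≤ q := fun f =>
    (graphProb_mono hp fun G h => h.1).trans (graphProb_isCopy_le hp f)
  have key : ∀ f g : Fin m → Fin n,
      graphProb p (fun G => IsIsolatedCopy H f G ∧ IsIsolatedCopy H g G) ≤
        q ^ 2 + if ∃ τ : Fin m → Fin m, f ∘ τ = g then q else 0 := by
    intro f g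
    by_cases hτ : ∃ τ : Fin m → Fin m, f ∘ τ = g
    · rw [if_pos hτ]
      exact ((graphProb_mono hp fun G h => h.1).trans (hle f)).trans
        (le_add_of_nonneg_left (by positivity))
    rw [if_neg hτ, add_zero]
    by_cases hinj : Function.Injective f ∧ Function.Injective g
    swap
    · rw [graphProb_congr (B := fun _ => False)
        (fun G => ⟨fun h => hinj ⟨h.1.1.1, h.2.1.1⟩, False.elim⟩), graphProb_false]
      positivity
    by_cases hmeet : ∃ j, g j ∈ Set.range f
    · obtain ⟨j, hj⟩ := hmeet
      rw [graphProb_congr (B := fun _ => False) (fun G => ⟨fun h => hτ ?_, False.elim⟩),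
        graphProb_false]
      · positivity
      · choose τ hτ using h.1.mem_range_of_meet hH h.2 hj
        exact ⟨τ, funext hτ⟩
    · push Not at hmeet
      have hd : Disjoint (H.imageEdges f) (H.imageEdges g) := by
        rw [Finset.disjoint_left]
        intro e he he'
        obtain ⟨a, ha, rfl⟩ := Finset.mem_image.1 he
        obtain ⟨b, hb, hab⟩ := Finset.mem_image.1 he'
        induction b with
        | _ i j =>
          have : g i ∈ Sym2.map f a := by rw [← hab, Sym2.map_mk]; simp
          obtain ⟨x, -, hx⟩ := Sym2.mem_map.1 this
          exact hmeet i ⟨x, hx⟩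
      have h1 := graphProb_forall_mem_edges p (F := H.imageEdges f ∪ H.imageEdges g)
        (fun e he => (Finset.mem_union.1 he).elim (not_isDiag_of_mem_imageEdges hinj.1)
          (not_isDiag_of_mem_imageEdges hinj.2))
      rw [Finset.card_union_of_disjoint hd, card_imageEdges hinj.1, card_imageEdges hinj.2,
        pow_add, ← sq] at h1
      rw [← h1]
      refine graphProb_mono hp fun G h e he => ?_
      rcases Finset.mem_union.1 he with he | he
      · exact (isCopy_iff_forall_imageEdges hinj.1).1 h.1.1 e he
      · exact (isCopy_iff_forall_imageEdges hinj.2).1 h.2.1 e he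
  have hcount : ∀ f : Fin m → Fin n, (∑ g : Fin m → Fin n,
      if ∃ τ : Fin m → Fin m, f ∘ τ = g then q else 0) ≤ m ^ m * q := by
    intro f
    rw [← Finset.sum_filter, Finset.sum_const, nsmul_eq_mul]
    refine mul_le_mul_of_nonneg_right ?_ hq0
    have h1 : (Finset.univ.filter fun g : Fin m → Fin n => ∃ τ : Fin m → Fin m, f ∘ τ = g).card ≤
        (Finset.univ.image fun τ : Fin m → Fin m => f ∘ τ).card := by
      refine Finset.card_le_card fun g hg => ?_
      obtain ⟨τ, hτ⟩ := (Finset.mem_filter.1 hg).2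
      exact Finset.mem_image.2 ⟨τ, Finset.mem_univ _, hτ⟩
    have h2 := h1.trans Finset.card_image_le
    simp only [Finset.card_univ, Fintype.card_fun, Fintype.card_fin] at h2
    exact_mod_cast h2
  rw [graphExp_eventCount_sq]
  calc _ ≤ ∑ f : Fin m → Fin n, ∑ g : Fin m → Fin n,
        (q ^ 2 + if ∃ τ : Fin m → Fin m, f ∘ τ = g then q else 0) :=
        Finset.sum_le_sum fun f _ => Finset.sum_le_sum fun g _ => key f g
    _ ≤ ∑ f : Fin m → Fin n, ((n : ℝ) ^ m * q ^ 2 + m ^ m * q) := by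
        refine Finset.sum_le_sum fun f _ => ?_
        rw [Finset.sum_add_distrib]
        refine add_le_add (by simp) (hcount f)
    _ = _ := by
        simp
        ring

end

end SimpleGraph

namespace SimpleGraph

variable {n : ℕ} {p : ℝ}

/-! ### The second moment of the number of triangles -/

theorem card_edgeFinset_top_three : (⊤ : SimpleGraph (Fin 3)).edgeFinset.card = 3 := by
  decide

theorem pow_card_union_imageEdges_le (hp : p ∈ Set.Icc (0 : ℝ) 1) {f g : Fin 3 → Fin n} {k : ℕ}
    (hf : Function.Injective f) (hg : Function.Injective g)
    (hk : k ≤ ((⊤ : SimpleGraph (Fin 3)).imageEdges f ∪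
      (⊤ : SimpleGraph (Fin 3)).imageEdges g).card) :
    graphProb p (fun G => IsCopy (⊤ : SimpleGraph (Fin 3)) f G ∧
      IsCopy (⊤ : SimpleGraph (Fin 3)) g G) ≤ p ^ k := by
  classical
  refine le_trans ?_ (pow_le_pow_of_le_one hp.1 hp.2 hk)
  rw [← graphProb_forall_mem_edges p (fun e he => (Finset.mem_union.1 he).elim
    (not_isDiag_of_mem_imageEdges hf) (not_isDiag_of_mem_imageEdges hg))]
  refine graphProb_mono hp fun G h e he => ?_
  rcases Finset.mem_union.1 he with he | he
  · exact (isCopy_iff_forall_imageEdges hf).1 h.1 e he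
  · exact (isCopy_iff_forall_imageEdges hg).1 h.2 e he

theorem mem_range_of_mem_imageEdges {m : ℕ} {H : SimpleGraph (Fin m)} [DecidableRel H.Adj]
    {V : Type*} [DecidableEq V] {f : Fin m → V} {a b : V} (h : s(a, b) ∈ H.imageEdges f) :
    a ∈ Set.range f ∧ b ∈ Set.range f := by
  obtain ⟨e, -, he⟩ := Finset.mem_image.1 h
  have h1 : a ∈ Sym2.map f e := by rw [he]; simp
  have h2 : b ∈ Sym2.map f e := by rw [he]; simp
  obtain ⟨x, -, hx⟩ := Sym2.mem_map.1 h1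
  obtain ⟨y, -, hy⟩ := Sym2.mem_map.1 h2
  exact ⟨⟨x, hx⟩, ⟨y, hy⟩⟩

theorem mem_imageEdges_top {V : Type*} [DecidableEq V] {f : Fin 3 → V} {i j : Fin 3}
    (hij : i ≠ j) : s(f i, f j) ∈ (⊤ : SimpleGraph (Fin 3)).imageEdges f :=
  Finset.mem_image.2 ⟨s(i, j), by simpa using hij, rfl⟩

/-- Pairs of triangles are sorted by how many vertices of the second lie outside the first. With
none, there are at most 27 second triangles and 3 edges in the union. With exactly one, there are at
most `3 * n * 27 = 81 * n` and 5 edges. With at least two, the triangles share no edge and the union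
has 6. -/
theorem graphExp_eventCount_triangle_sq_le (hp : p ∈ Set.Icc (0 : ℝ) 1) :
    graphExp p (fun G =>
      eventCount (fun f : Fin 3 → Fin n => IsCopy (⊤ : SimpleGraph (Fin 3)) f) G ^ 2) ≤
      ((n : ℝ) ^ 3 * p ^ 3) ^ 2 + 81 * ((n : ℝ) ^ 4 * p ^ 5) + 27 * ((n : ℝ) ^ 3 * p ^ 3) := by
  classical
  have hp3 : 0 ≤ p ^ 3 := pow_nonneg hp.1 _
  have hp5 : 0 ≤ p ^ 5 := pow_nonneg hp.1 _
  have hp6 : 0 ≤ p ^ 6 := pow_nonneg hp.1 _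
  set T : (Fin 3 → Fin n) → SimpleGraph (Fin n) → Prop :=
    fun f => IsCopy (⊤ : SimpleGraph (Fin 3)) f with hT
  -- `Q₁` covers the case of one new vertex: `g` is a relabelling of vertices of `f` with one
  -- coordinate overwritten. `Q₂` covers the case of no new vertex.
  obtain ⟨Q₁, hQ₁⟩ : ∃ Q : (Fin 3 → Fin n) → (Fin 3 → Fin n) → Prop, ∀ f g, Q f g ↔
      ∃ x : Fin 3 × Fin n × (Fin 3 → Fin 3), Function.update (f ∘ x.2.2) x.1 x.2.1 = g :=
    ⟨_, fun _ _ => Iff.rfl⟩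
  obtain ⟨Q₂, hQ₂⟩ : ∃ Q : (Fin 3 → Fin n) → (Fin 3 → Fin n) → Prop, ∀ f g, Q f g ↔
      ∃ τ : Fin 3 → Fin 3, f ∘ τ = g := ⟨_, fun _ _ => Iff.rfl⟩
  have key : ∀ f g : Fin 3 → Fin n, graphProb p (fun G => T f G ∧ T g G) ≤
      p ^ 6 + (if Q₁ f g then p ^ 5 else 0) +
      (if Q₂ f g then p ^ 3 else 0) := by
    intro f g
    have hn5 : 0 ≤ (if Q₁ f g then p ^ 5 else 0) := by
      split_ifs <;> first | exact hp5 | exact le_rfl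
    by_cases hinj : Function.Injective f ∧ Function.Injective g
    swap
    · rw [graphProb_congr (B := fun _ => False)
        (fun G => ⟨fun h => hinj ⟨h.1.1, h.2.1⟩, False.elim⟩), graphProb_false]
      have : 0 ≤ (if Q₂ f g then p ^ 3 else 0) := by
        split_ifs <;> first | exact hp3 | exact le_rfl
      linarith
    obtain ⟨hf, hg⟩ := hinj
    have hcf := card_imageEdges (H := (⊤ : SimpleGraph (Fin 3))) hf
    have hcg := card_imageEdges (H := (⊤ : SimpleGraph (Fin 3))) hg
    rw [card_edgeFinset_top_three] at hcf hcg
    by_cases hτ : Q₂ f g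
    · rw [if_pos hτ]
      have := pow_card_union_imageEdges_le (k := 3) hp hf hg
        (hcf.symm.le.trans (Finset.card_le_card Finset.subset_union_left))
      linarith
    rw [if_neg hτ, add_zero]
    obtain ⟨j, hj⟩ : ∃ j, g j ∉ Set.range f := by
      by_contra! hcon
      choose τ h using hcon
      exact hτ ((hQ₂ f g).2 ⟨τ, funext h⟩)
    by_cases hj' : ∃ j', j' ≠ j ∧ g j' ∉ Set.range f
    · obtain ⟨j', hjj', hj'⟩ := hj'
      have hd : Disjoint ((⊤ : SimpleGraph (Fin 3)).imageEdges f)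
          ((⊤ : SimpleGraph (Fin 3)).imageEdges g) := by
        rw [Finset.disjoint_left]
        intro e he he'
        obtain ⟨b, hb, rfl⟩ := Finset.mem_image.1 he'
        induction b with
        | _ i i' =>
          rw [Sym2.map_mk] at he
          have h1 := mem_range_of_mem_imageEdges he
          have hii' : i ≠ i' := by simpa using hb
          -- Any edge of a triangle contains one of any two given vertices, so each edge of the
          -- second triangle has an end outside the first.
          have : ∀ a b c d : Fin 3, a ≠ b → c ≠ d → c = a ∨ c = b ∨ d = a ∨ d = b := by decide
          rcases this i i' j' j hii' hjj' with h | h | h | h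
          · exact hj' (h ▸ h1.1)
          · exact hj' (h ▸ h1.2)
          · exact hj (h ▸ h1.1)
          · exact hj (h ▸ h1.2)
      have := pow_card_union_imageEdges_le (k := 6) hp hf hg
        (by rw [Finset.card_union_of_disjoint hd, hcf, hcg])
      linarith
    · push Not at hj'
      have hτ' : ∀ i, ∃ k, i ≠ j → f k = g i := by
        intro i
        by_cases hi : i = j
        · exact ⟨0, fun h => absurd hi h⟩
        · obtain ⟨k, hk⟩ := hj' i hi
          exact ⟨k, fun _ => hk⟩
      choose τ hτ' using hτ'
      have hupd : Q₁ f g := by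
        refine (hQ₁ f g).2 ⟨(j, g j, τ), ?_⟩
        funext i
        by_cases hi : i = j
        · subst hi; simp
        · simp [hi, hτ' i hi]
      rw [if_pos hupd]
      obtain ⟨a, b, haj, hbj, hab⟩ : ∃ a b : Fin 3, a ≠ j ∧ b ≠ j ∧ a ≠ b := by
        have : ∀ j : Fin 3, ∃ a b : Fin 3, a ≠ j ∧ b ≠ j ∧ a ≠ b := by decide
        exact this j
      have h5 : 5 ≤ ((⊤ : SimpleGraph (Fin 3)).imageEdges f ∪
          (⊤ : SimpleGraph (Fin 3)).imageEdges g).card := by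
        have hsub : (⊤ : SimpleGraph (Fin 3)).imageEdges f ∪ {s(g j, g a), s(g j, g b)} ⊆
            (⊤ : SimpleGraph (Fin 3)).imageEdges f ∪
              (⊤ : SimpleGraph (Fin 3)).imageEdges g := by
          refine Finset.union_subset_union_right ?_
          intro e he
          rcases Finset.mem_insert.1 he with rfl | he
          · exact mem_imageEdges_top haj.symm
          · rw [Finset.mem_singleton.1 he]
            exact mem_imageEdges_top hbj.symm
        have hd : Disjoint ((⊤ : SimpleGraph (Fin 3)).imageEdges f)
            {s(g j, g a), s(g j, g b)} := by
          rw [Finset.disjoint_right]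
          intro e he he'
          rcases Finset.mem_insert.1 he with rfl | he
          · exact hj (mem_range_of_mem_imageEdges he').1
          · rw [Finset.mem_singleton.1 he] at he'
            exact hj (mem_range_of_mem_imageEdges he').1
        have hne : s(g j, g a) ≠ s(g j, g b) := by
          intro h
          rw [Sym2.congr_right] at h
          exact hab (hg h)
        have := Finset.card_le_card hsub
        rwa [Finset.card_union_of_disjoint hd, hcf, Finset.card_pair hne] at this
      have := pow_card_union_imageEdges_le (k := 5) hp hf hg h5
      linarith
  have hcount3 : ∀ f : Fin 3 → Fin n, (∑ g : Fin 3 → Fin n,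
      if Q₂ f g then p ^ 3 else 0) ≤ 27 * p ^ 3 := by
    intro f
    rw [← Finset.sum_filter, Finset.sum_const, nsmul_eq_mul]
    refine mul_le_mul_of_nonneg_right ?_ hp3
    have h1 : (Finset.univ.filter fun g => Q₂ f g).card ≤
        (Finset.univ.image fun τ : Fin 3 → Fin 3 => f ∘ τ).card := by
      refine Finset.card_le_card fun g hg => ?_
      obtain ⟨τ, hτ⟩ := (hQ₂ f g).1 (Finset.mem_filter.1 hg).2
      exact Finset.mem_image.2 ⟨τ, Finset.mem_univ _, hτ⟩
    have h2 := h1.trans Finset.card_image_le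
    simp only [Finset.card_univ, Fintype.card_fun, Fintype.card_fin] at h2
    exact_mod_cast h2
  have hcount5 : ∀ f : Fin 3 → Fin n, (∑ g : Fin 3 → Fin n,
      if Q₁ f g then p ^ 5 else 0) ≤ 81 * n * p ^ 5 := by
    intro f
    rw [← Finset.sum_filter, Finset.sum_const, nsmul_eq_mul]
    refine mul_le_mul_of_nonneg_right ?_ hp5
    have h1 : (Finset.univ.filter fun g => Q₁ f g).card ≤
        (Finset.univ.image fun x : Fin 3 × Fin n × (Fin 3 → Fin 3) =>
          Function.update (f ∘ x.2.2) x.1 x.2.1).card := by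
      refine Finset.card_le_card fun g hg => ?_
      obtain ⟨x, hx⟩ := (hQ₁ f g).1 (Finset.mem_filter.1 hg).2
      exact Finset.mem_image.2 ⟨x, Finset.mem_univ _, hx⟩
    have h2 := h1.trans Finset.card_image_le
    simp only [Finset.card_univ, Fintype.card_prod, Fintype.card_fun, Fintype.card_fin] at h2
    have h3 : 3 * (n * 3 ^ 3) = 81 * n := by ring
    rw [h3] at h2
    exact_mod_cast h2
  rw [graphExp_eventCount_sq]
  calc _ ≤ ∑ f : Fin 3 → Fin n, ∑ g : Fin 3 → Fin n, (p ^ 6 +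
        (if Q₁ f g then p ^ 5 else 0) + (if Q₂ f g then p ^ 3 else 0)) :=
        Finset.sum_le_sum fun f _ => Finset.sum_le_sum fun g _ => key f g
    _ ≤ ∑ f : Fin 3 → Fin n, ((n : ℝ) ^ 3 * p ^ 6 + 81 * n * p ^ 5 + 27 * p ^ 3) := by
        refine Finset.sum_le_sum fun f _ => ?_
        rw [Finset.sum_add_distrib, Finset.sum_add_distrib]
        exact add_le_add (add_le_add (by simp) (hcount5 f)) (hcount3 f)
    _ = _ := by
        simp
        ring

end SimpleGraph

namespace SimpleGraph

/-! ### Trees and short cycles as patterns -/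

/-- A pattern graph on `Fin m`, given by a list of edges. -/
abbrev Pattern := Σ m : ℕ, List (Fin m × Fin m)

/-- The graph described by a pattern. -/
def Pattern.graph (P : Pattern) : SimpleGraph (Fin P.1) := fromRel fun i j => (i, j) ∈ P.2

instance (P : Pattern) : DecidableRel P.graph.Adj := fun i j =>
  inferInstanceAs (Decidable (i ≠ j ∧ ((i, j) ∈ P.2 ∨ (j, i) ∈ P.2)))

theorem Pattern.isCopy {P : Pattern} {V : Type*} {G : SimpleGraph V} {f : Fin P.1 → V}
    (hf : Function.Injective f) (h : P.2.Forall fun x => G.Adj (f x.1) (f x.2)) :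
    IsCopy P.graph f G := by
  rw [List.forall_iff_forall_mem] at h
  refine ⟨hf, fun i j hij => ?_⟩
  rcases hij.2 with h' | h'
  · exact h _ h'
  · exact (h _ h').symm

theorem vecCons_injective_iff {V : Type*} {m : ℕ} {a : V} {f : Fin m → V} :
    Function.Injective (Matrix.vecCons a f) ↔ (∀ i, a ≠ f i) ∧ Function.Injective f := by
  rw [Matrix.vecCons, Fin.cons_injective_iff]
  simp [eq_comm]

abbrev path1 : Pattern := ⟨1, []⟩
abbrev path2 : Pattern := ⟨2, [(0, 1)]⟩
abbrev path3 : Pattern := ⟨3, [(0, 1), (1, 2)]⟩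
abbrev path4 : Pattern := ⟨4, [(0, 1), (1, 2), (2, 3)]⟩
abbrev path5 : Pattern := ⟨5, [(0, 1), (1, 2), (2, 3), (3, 4)]⟩
abbrev path6 : Pattern := ⟨6, [(0, 1), (1, 2), (2, 3), (3, 4), (4, 5)]⟩
abbrev path7 : Pattern := ⟨7, [(0, 1), (1, 2), (2, 3), (3, 4), (4, 5), (5, 6)]⟩

/-- The tree with degree sequence `3, 2, 1, 1, 1`. -/
abbrev spider5 : Pattern := ⟨5, [(0, 1), (1, 2), (1, 3), (3, 4)]⟩

/-- A path on five vertices with a further leaf at its middle vertex. -/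
abbrev caterpillar6 : Pattern := ⟨6, [(0, 1), (1, 2), (2, 3), (3, 4), (2, 5)]⟩

abbrev cycle3 : Pattern := ⟨3, [(0, 1), (1, 2), (2, 0)]⟩
abbrev cycle4 : Pattern := ⟨4, [(0, 1), (1, 2), (2, 3), (3, 0)]⟩
abbrev cycle5 : Pattern := ⟨5, [(0, 1), (1, 2), (2, 3), (3, 4), (4, 0)]⟩
abbrev cycle6 : Pattern := ⟨6, [(0, 1), (1, 2), (2, 3), (3, 4), (4, 5), (5, 0)]⟩

/-- The trees which occur as minimal witnesses of depth-two vertex types. -/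
def witnessTrees : List Pattern :=
  [path1, path2, path3, path4, path5, path6, path7, spider5, caterpillar6]

/-- The cycles of length at most six. -/
def shortCycles : List Pattern := [cycle3, cycle4, cycle5, cycle6]

theorem card_edgeFinset_witnessTrees :
    ∀ T ∈ witnessTrees, T.graph.edgeFinset.card + 1 = T.1 := by
  decide

/-- The trees are labelled so that each vertex is attached to an earlier one, the form of
connectedness the second moment bound needs. Together with the edge count `m - 1` this gives the
threshold `m / (m - 1)`. -/
theorem exists_adj_lt_of_mem_witnessTrees :
    ∀ T ∈ witnessTrees, ∀ k : Fin T.1, (k : ℕ) ≠ 0 → ∃ j < k, T.graph.Adj j k := by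
  decide

theorem card_edgeFinset_shortCycles : ∀ C ∈ shortCycles, C.graph.edgeFinset.card = C.1 := by
  decide

variable {V W : Type*}

/-- `G` has no cycle of length at most six. -/
def ShortCycleFree (G : SimpleGraph V) : Prop :=
  ∀ C ∈ shortCycles, ¬ ∃ f : Fin C.1 → V, IsCopy C.graph f G

section ShortCycleFree

variable {G : SimpleGraph V} (hG : ShortCycleFree G)
include hG

theorem ShortCycleFree.not_cycle3 {a b c : V} (h1 : G.Adj a b) (h2 : G.Adj b c)
    (h3 : G.Adj a c) : False := by
  refine hG cycle3 (by simp [shortCycles]) ⟨![a, b, c], Pattern.isCopy ?_ ?_⟩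
  · simp [cycle3, vecCons_injective_iff, Fin.forall_fin_succ, h1.ne, h2.ne, h3.ne,
      Function.injective_of_subsingleton]
  · exact ⟨h1, h2, h3.symm⟩

theorem ShortCycleFree.not_cycle4 {a b c d : V} (h1 : G.Adj a b) (h2 : G.Adj b c)
    (h3 : G.Adj c d) (h4 : G.Adj d a) (hac : a ≠ c) (hbd : b ≠ d) : False := by
  refine hG cycle4 (by simp [shortCycles]) ⟨![a, b, c, d], Pattern.isCopy ?_ ?_⟩
  · simp [cycle4, vecCons_injective_iff, Fin.forall_fin_succ, h1.ne, h2.ne, h3.ne, h4.ne', hac, hbd,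
      Function.injective_of_subsingleton]
  · exact ⟨h1, h2, h3, h4⟩

theorem ShortCycleFree.not_cycle5 {a b c d e : V} (h1 : G.Adj a b) (h2 : G.Adj b c)
    (h3 : G.Adj c d) (h4 : G.Adj d e) (h5 : G.Adj e a) (hac : a ≠ c) (had : a ≠ d) (hbd : b ≠ d)
    (hbe : b ≠ e) (hce : c ≠ e) : False := by
  refine hG cycle5 (by simp [shortCycles]) ⟨![a, b, c, d, e], Pattern.isCopy ?_ ?_⟩
  · simp [cycle5, vecCons_injective_iff, Fin.forall_fin_succ, h1.ne, h2.ne, h3.ne, h4.ne, h5.ne',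
      hac, had, hbd, hbe, hce, Function.injective_of_subsingleton]
  · exact ⟨h1, h2, h3, h4, h5⟩

theorem ShortCycleFree.not_cycle6 {a b c d e f : V} (h1 : G.Adj a b) (h2 : G.Adj b c)
    (h3 : G.Adj c d) (h4 : G.Adj d e) (h5 : G.Adj e f) (h6 : G.Adj f a) (hac : a ≠ c)
    (had : a ≠ d) (hae : a ≠ e) (hbd : b ≠ d) (hbe : b ≠ e) (hbf : b ≠ f) (hce : c ≠ e)
    (hcf : c ≠ f) (hdf : d ≠ f) : False := by
  refine hG cycle6 (by simp [shortCycles]) ⟨![a, b, c, d, e, f], Pattern.isCopy ?_ ?_⟩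
  · simp [cycle6, vecCons_injective_iff, Fin.forall_fin_succ, h1.ne, h2.ne, h3.ne, h4.ne, h5.ne,
      h6.ne', hac, had, hae, hbd, hbe, hbf, hce, hcf, hdf, Function.injective_of_subsingleton]
  · exact ⟨h1, h2, h3, h4, h5, h6⟩

end ShortCycleFree

/-! ### Local types -/

/-- `x` has a neighbour which has a neighbour other than `x` and not adjacent to `x`. -/
def HasInnerNbr (G : SimpleGraph V) (x : V) : Prop := ∃ y, G.Adj x y ∧ G.HasPrivateNbr y x

/-- `x` has a neighbour all of whose neighbours are `x` or adjacent to `x`. -/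
def HasLeafNbr (G : SimpleGraph V) (x : V) : Prop := ∃ y, G.Adj x y ∧ ¬ G.HasPrivateNbr y x

/-- Some vertex at distance two from `x` has a neighbour not adjacent to `x`. -/
def HasInnerSecondNbr (G : SimpleGraph V) (x : V) : Prop :=
  ∃ y, y ≠ x ∧ ¬ G.Adj x y ∧ G.HasCommonNbr x y ∧ G.HasPrivateNbr y x

/-- Some vertex at distance two from `x` has only neighbours adjacent to `x`. -/
def HasLeafSecondNbr (G : SimpleGraph V) (x : V) : Prop :=
  ∃ y, y ≠ x ∧ ¬ G.Adj x y ∧ G.HasCommonNbr x y ∧ ¬ G.HasPrivateNbr y x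

/-- `x` has at least two neighbours. -/
def HasTwoNbrs (G : SimpleGraph V) (x : V) : Prop := ∃ y z, y ≠ z ∧ G.Adj x y ∧ G.Adj x z

section

variable [Fintype V] [DecidableEq V] (G : SimpleGraph V) [DecidableRel G.Adj]

/-- These instances let `decide` evaluate the local features at vertices of the explicit trees. -/
instance (x y : V) : Decidable (G.HasCommonNbr x y) :=
  inferInstanceAs (Decidable (∃ z, G.Adj x z ∧ G.Adj y z))

instance (x y : V) : Decidable (G.HasPrivateNbr x y) :=
  inferInstanceAs (Decidable (∃ z, G.Adj x z ∧ ¬ G.Adj y z ∧ z ≠ y))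

instance (x : V) : Decidable (G.HasInnerNbr x) :=
  inferInstanceAs (Decidable (∃ y, G.Adj x y ∧ G.HasPrivateNbr y x))

instance (x : V) : Decidable (G.HasLeafNbr x) :=
  inferInstanceAs (Decidable (∃ y, G.Adj x y ∧ ¬ G.HasPrivateNbr y x))

instance (x : V) : Decidable (G.HasInnerSecondNbr x) :=
  inferInstanceAs (Decidable
    (∃ y, y ≠ x ∧ ¬ G.Adj x y ∧ G.HasCommonNbr x y ∧ G.HasPrivateNbr y x))

instance (x : V) : Decidable (G.HasLeafSecondNbr x) :=
  inferInstanceAs (Decidable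
    (∃ y, y ≠ x ∧ ¬ G.Adj x y ∧ G.HasCommonNbr x y ∧ ¬ G.HasPrivateNbr y x))

instance (x : V) : Decidable (G.HasTwoNbrs x) :=
  inferInstanceAs (Decidable (∃ y z, y ≠ z ∧ G.Adj x y ∧ G.Adj x z))

end

/-- The local structure of `G` at `x` up to distance two agrees with that of `H` at `y`. -/
structure SameLocalType (G : SimpleGraph V) (x : V) (H : SimpleGraph W) (y : W) : Prop where
  innerNbr : G.HasInnerNbr x ↔ H.HasInnerNbr y
  leafNbr : G.HasLeafNbr x ↔ H.HasLeafNbr y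
  innerSecondNbr : G.HasInnerSecondNbr x ↔ H.HasInnerSecondNbr y
  leafSecondNbr : G.HasLeafSecondNbr x ↔ H.HasLeafSecondNbr y
  twoNbrs : G.HasTwoNbrs x ↔ H.HasTwoNbrs y

theorem SameLocalType.trans {U : Type*} {F : SimpleGraph U} {u : U} {G : SimpleGraph V} {x : V}
    {H : SimpleGraph W} {y : W} (h₁ : SameLocalType F u G x) (h₂ : SameLocalType G x H y) :
    SameLocalType F u H y :=
  ⟨h₁.1.trans h₂.1, h₁.2.trans h₂.2, h₁.3.trans h₂.3, h₁.4.trans h₂.4, h₁.5.trans h₂.5⟩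

theorem SameLocalType.symm {G : SimpleGraph V} {x : V} {H : SimpleGraph W} {y : W}
    (h : SameLocalType G x H y) : SameLocalType H y G x :=
  ⟨h.1.symm, h.2.symm, h.3.symm, h.4.symm, h.5.symm⟩

section IsolatedCopy

variable {U : Type*} {T : SimpleGraph U} {f : U → V} {G : SimpleGraph V}

theorem IsIsolatedCopy.adj_iff (h : IsIsolatedCopy T f G) (i j : U) :
    G.Adj (f i) (f j) ↔ T.Adj i j := by
  refine ⟨fun hij => ?_, h.1.2 i j⟩
  obtain ⟨k, hk, hjk⟩ := h.2 i _ hij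
  rwa [h.1.1 hjk]

theorem IsIsolatedCopy.exists_adj_iff (h : IsIsolatedCopy T f G) (i : U) {P : V → Prop} :
    (∃ v, G.Adj (f i) v ∧ P v) ↔ ∃ j, T.Adj i j ∧ P (f j) := by
  constructor
  · rintro ⟨v, hv, hP⟩
    obtain ⟨j, hj, rfl⟩ := h.2 i v hv
    exact ⟨j, hj, hP⟩
  · rintro ⟨j, hj, hP⟩
    exact ⟨f j, h.1.2 i j hj, hP⟩

theorem IsIsolatedCopy.hasCommonNbr_iff (h : IsIsolatedCopy T f G) (i j : U) :
    G.HasCommonNbr (f i) (f j) ↔ T.HasCommonNbr i j := by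
  simp only [HasCommonNbr, h.exists_adj_iff, h.adj_iff]

theorem IsIsolatedCopy.hasPrivateNbr_iff (h : IsIsolatedCopy T f G) (i j : U) :
    G.HasPrivateNbr (f i) (f j) ↔ T.HasPrivateNbr i j := by
  simp only [HasPrivateNbr, h.exists_adj_iff, h.adj_iff, ne_eq, h.1.1.eq_iff]

theorem IsIsolatedCopy.mem_range_of_hasCommonNbr (h : IsIsolatedCopy T f G) {i : U} {v : V}
    (hv : G.HasCommonNbr (f i) v) : ∃ j, v = f j := by
  obtain ⟨z, hz, hvz⟩ := hv
  obtain ⟨j, -, rfl⟩ := h.2 i z hz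
  obtain ⟨k, -, rfl⟩ := h.2 j v hvz.symm
  exact ⟨k, rfl⟩

/-- All vertices that the features speak of lie in the component of `f i`, hence in the image of
`f`. -/
theorem IsIsolatedCopy.sameLocalType (h : IsIsolatedCopy T f G) (i : U) :
    SameLocalType T i G (f i) := by
  have second : ∀ P : V → Prop,
      (∃ y, y ≠ f i ∧ ¬ G.Adj (f i) y ∧ G.HasCommonNbr (f i) y ∧ P y) ↔
      ∃ j, j ≠ i ∧ ¬ T.Adj i j ∧ T.HasCommonNbr i j ∧ P (f j) := by
    intro P
    constructor
    · rintro ⟨y, hy, hadj, hc, hP⟩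
      obtain ⟨j, rfl⟩ := h.mem_range_of_hasCommonNbr hc
      exact ⟨j, fun h' => hy (h' ▸ rfl), mt (h.adj_iff i j).2 hadj, (h.hasCommonNbr_iff i j).1 hc,
        hP⟩
    · rintro ⟨j, hj, hadj, hc, hP⟩
      exact ⟨f j, h.1.1.ne hj, mt (h.adj_iff i j).1 hadj, (h.hasCommonNbr_iff i j).2 hc, hP⟩
  refine ⟨?_, ?_, ?_, ?_, ?_⟩
  · simp only [HasInnerNbr, h.exists_adj_iff, h.hasPrivateNbr_iff]
  · simp only [HasLeafNbr, h.exists_adj_iff, h.hasPrivateNbr_iff]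
  · simp only [HasInnerSecondNbr, second, h.hasPrivateNbr_iff]
  · simp only [HasLeafSecondNbr, second, h.hasPrivateNbr_iff]
  · constructor
    · rintro ⟨j, k, hjk, hj, hk⟩
      exact ⟨f j, f k, h.1.1.ne hjk, h.1.2 _ _ hj, h.1.2 _ _ hk⟩
    · rintro ⟨y, z, hyz, hy, hz⟩
      obtain ⟨j, hj, rfl⟩ := h.2 i y hy
      obtain ⟨k, hk, rfl⟩ := h.2 i z hz
      exact ⟨j, k, fun h' => hyz (h' ▸ rfl), hj, hk⟩

end IsolatedCopy

end SimpleGraph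

/-! ### Typical sparse graphs: vertex types from local features -/

namespace SimpleGraph

variable {V W : Type*}

/-- The typical structure of the random graph `G(n, n ^ (-α))` for `α > 1`. -/
structure SparseTypical (α : ℝ) (G : SimpleGraph V) : Prop where
  nonempty : Nonempty V
  shortCycleFree : ShortCycleFree G
  exists_isolatedCopy : ∀ T ∈ witnessTrees, α * (T.1 - 1) < T.1 → ∀ g h : Fin T.1 → V,
    ∃ f, IsIsolatedCopy T.graph f G ∧ f ≠ g ∧ f ≠ h
  not_exists_copy : ∀ T ∈ witnessTrees, (T.1 : ℝ) < α * (T.1 - 1) →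
    ¬ ∃ f : Fin T.1 → V, IsCopy T.graph f G

section PairType

variable {G : SimpleGraph V} (hG : ShortCycleFree G)
include hG

/-- Without triangles, every neighbour of `x` other than `y` is private, so the private-neighbour
entry depends on `x` alone. -/
theorem ShortCycleFree.pairType_of_adj {x y : V} (hc : G.HasCommonNonNbr x y) (h : G.Adj x y) :
    G.pairType x y = (True, False, G.HasTwoNbrs x, G.HasPrivateNbr y x, True) := by
  simp only [pairType, Prod.mk.injEq, eq_iff_iff, iff_false, hc, h, true_and, and_true]
  refine ⟨fun ⟨z, hz, hz'⟩ => hG.not_cycle3 h hz' hz, ?_⟩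
  constructor
  · rintro ⟨z, hz, -, hne⟩
    exact ⟨z, y, hne, hz, h⟩
  · rintro ⟨u, v, huv, hu, hv⟩
    by_cases huy : u = y
    · subst huy
      exact ⟨v, hv, fun h' => hG.not_cycle3 h h' hv, huv.symm⟩
    · exact ⟨u, hu, fun h' => hG.not_cycle3 h h' hu, huy⟩

/-- Without 4-cycles the common neighbour is unique, so `x` has a private neighbour exactly when it
has a second neighbour. -/
theorem ShortCycleFree.pairType_of_hasCommonNbr {x y : V} (hc : G.HasCommonNonNbr x y)
    (hne : y ≠ x) (h : ¬ G.Adj x y) (h' : G.HasCommonNbr x y) :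
    G.pairType x y = (False, True, G.HasTwoNbrs x, G.HasPrivateNbr y x, True) := by
  simp only [pairType, Prod.mk.injEq, eq_iff_iff, hc, h, true_and, and_true,
    h']
  obtain ⟨m, hm, hm'⟩ := h'
  constructor
  · rintro ⟨z, hz, hz', -⟩
    exact ⟨z, m, fun h => hz' (h ▸ hm'), hz, hm⟩
  · rintro ⟨u, v, huv, hu, hv⟩
    have key : ∀ w, w ≠ m → G.Adj x w → G.HasPrivateNbr x y := fun w hw hxw =>
      ⟨w, hxw, fun hyw => hG.not_cycle4 hxw hyw.symm hm' hm.symm hne.symm hw,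
        fun h' => h (h' ▸ hxw)⟩
    by_cases hum : u = m
    · exact key v (fun h' => huv (hum.trans h'.symm)) hv
    · exact key u hum hu

omit hG in
theorem pairType_of_not_hasCommonNbr {x y : V} (hc : G.HasCommonNonNbr x y) (h : ¬ G.Adj x y)
    (h' : ¬ G.HasCommonNbr x y) :
    G.pairType x y = (False, False, (∃ z, G.Adj x z), (∃ z, G.Adj y z), True) := by
  simp only [pairType, Prod.mk.injEq, eq_iff_iff, hc, h, true_and, and_true,
    h']
  constructor <;> constructor
  · rintro ⟨z, hz, -⟩
    exact ⟨z, hz⟩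
  · rintro ⟨z, hz⟩
    exact ⟨z, hz, fun hz' => h' ⟨z, hz, hz'⟩, fun hzy => h (hzy ▸ hz)⟩
  · rintro ⟨z, hz, -⟩
    exact ⟨z, hz⟩
  · rintro ⟨z, hz⟩
    exact ⟨z, hz, fun hz' => h' ⟨z, hz', hz⟩, fun hzx => h (hzx ▸ hz).symm⟩

end PairType

theorem exists_adj_iff_hasNbr {G : SimpleGraph V} {x : V} :
    (∃ z, G.Adj x z) ↔ G.HasInnerNbr x ∨ G.HasLeafNbr x := by
  constructor
  · rintro ⟨z, hz⟩
    by_cases h : G.HasPrivateNbr z x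
    · exact Or.inl ⟨z, hz, h⟩
    · exact Or.inr ⟨z, hz, h⟩
  · rintro (⟨z, hz, -⟩ | ⟨z, hz, -⟩) <;> exact ⟨z, hz⟩

theorem SameLocalType.exists_adj_iff {G : SimpleGraph V} {x : V} {H : SimpleGraph W} {y : W}
    (h : SameLocalType G x H y) : (∃ z, G.Adj x z) ↔ ∃ z, H.Adj y z := by
  rw [exists_adj_iff_hasNbr, exists_adj_iff_hasNbr, h.innerNbr, h.leafNbr]

section Typical

variable {α : ℝ} {G : SimpleGraph V} {H : SimpleGraph W}

theorem SparseTypical.exists_isolated (hG : SparseTypical α G) (x y : V) :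
    ∃ z, z ≠ x ∧ z ≠ y ∧ ∀ v, ¬ G.Adj z v := by
  obtain ⟨f, hf, hx, hy⟩ := hG.exists_isolatedCopy path1 (by simp [witnessTrees])
    (by simp) (fun _ => x) (fun _ => y)
  have hf0 : ∀ i : Fin path1.1, f i = f (0 : Fin 1) := by
    intro i
    congr 1
    exact Subsingleton.elim (α := Fin 1) _ _
  refine ⟨f (0 : Fin 1), fun h => hx (funext fun i => (hf0 i).trans h),
    fun h => hy (funext fun i => (hf0 i).trans h), fun v hv => ?_⟩
  obtain ⟨j, hj, -⟩ := hf.2 _ v hv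
  exact hj.1 (Subsingleton.elim (α := Fin 1) _ _)

theorem SparseTypical.hasCommonNonNbr (hG : SparseTypical α G) (x y : V) :
    G.HasCommonNonNbr x y := by
  obtain ⟨z, hzx, hzy, hz⟩ := hG.exists_isolated x y
  exact ⟨z, fun h => hz _ h.symm, fun h => hz _ h.symm, hzx, hzy⟩

/-- Off the thresholds, a single copy of a tree certifies that α is below its threshold, and then
every typical graph has isolated copies of it. This is how types are transported between typical
graphs. -/
theorem SparseTypical.lt_of_isCopy (hG : SparseTypical α G)
    (hα : ∀ T ∈ witnessTrees, α * (T.1 - 1) ≠ T.1) {T : Pattern} (hT : T ∈ witnessTrees)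
    {f : Fin T.1 → V} (hf : IsCopy T.graph f G) : α * (T.1 - 1) < T.1 :=
  lt_of_le_of_ne (not_lt.1 fun h => hG.not_exists_copy T hT h ⟨f, hf⟩) (hα T hT)

/-- An isolated edge missing `x` is wanted. If the first one found contains `x`, another copy is
taken that differs from it and from its reversal. Such a copy lies in a different component. -/
theorem SparseTypical.exists_far_edge (hG : SparseTypical α G) (hα : α * (2 - 1) < 2) (x : V) :
    ∃ y, y ≠ x ∧ ¬ G.Adj x y ∧ ¬ G.HasCommonNbr x y ∧ ∃ z, G.Adj y z := by
  have key : ∃ f : Fin path2.1 → V, IsIsolatedCopy path2.graph f G ∧ x ∉ Set.range f := by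
    have hmem : path2 ∈ witnessTrees := by simp [witnessTrees]
    have hα' : α * ((path2.1 : ℝ) - 1) < path2.1 := by simpa [path2] using hα
    obtain ⟨f, hf, -⟩ := hG.exists_isolatedCopy path2 hmem hα' (fun _ => x) (fun _ => x)
    by_cases hx : x ∈ Set.range f
    · obtain ⟨g, hg, h1, h2⟩ := hG.exists_isolatedCopy path2 hmem hα' f (f ∘ Fin.rev)
      refine ⟨g, hg, fun ⟨j, hj⟩ => ?_⟩
      have hmeet := hf.mem_range_of_meet
        (exists_adj_lt_of_mem_witnessTrees path2 hmem) hg (hj ▸ hx)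
      obtain ⟨a, ha⟩ := hmeet (0 : Fin 2)
      obtain ⟨b, hb⟩ := hmeet (1 : Fin 2)
      have hab : a ≠ b := by
        rintro rfl
        have := hg.1.1 (ha.symm.trans hb)
        exact absurd this (by decide)
      have hcases : ∀ a b : Fin 2, a ≠ b → (a = 0 ∧ b = 1) ∨ (a = 1 ∧ b = 0) := by decide
      rcases hcases a b hab with ⟨rfl, rfl⟩ | ⟨rfl, rfl⟩
      · refine h1 (funext fun i => ?_)
        change Fin 2 at i
        fin_cases i
        · exact ha.symm
        · exact hb.symm
      · refine h2 (funext fun i => ?_)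
        change Fin 2 at i
        fin_cases i
        · exact ha.symm
        · exact hb.symm
    · exact ⟨f, hf, hx⟩
  obtain ⟨f, hf, hx⟩ := key
  refine ⟨f (0 : Fin 2), fun h => hx ⟨_, h⟩, fun h => ?_, fun h => ?_, f (1 : Fin 2),
    hf.1.2 _ _ (by decide)⟩
  · obtain ⟨j, -, hj⟩ := hf.2 _ _ h.symm
    exact hx ⟨j, hj.symm⟩
  · obtain ⟨z, hz, hz'⟩ := h
    obtain ⟨j, hj⟩ := hf.mem_range_of_hasCommonNbr ⟨z, hz', hz⟩
    exact hx ⟨j, hj.symm⟩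

/-- The cases are distance one, two, and more from `x`. In the last case the pair type only tells
which of the two vertices are isolated, and the matching vertex is taken from an isolated edge or an
isolated vertex away from `y`. -/
theorem SparseTypical.vertexType_subset (hα : ∀ T ∈ witnessTrees, α * (T.1 - 1) ≠ T.1)
    (hG : SparseTypical α G) (hH : SparseTypical α H) {x : V} {y : W}
    (h : SameLocalType G x H y) : G.vertexType x ⊆ H.vertexType y := by
  rintro t ⟨x', hx', rfl⟩
  have htwo : G.HasTwoNbrs x = H.HasTwoNbrs y := propext h.twoNbrs
  by_cases hadj : G.Adj x x'
  · rw [hG.shortCycleFree.pairType_of_adj (hG.hasCommonNonNbr _ _) hadj]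
    have : ∃ y', H.Adj y y' ∧ (H.HasPrivateNbr y' y ↔ G.HasPrivateNbr x' x) := by
      by_cases hp : G.HasPrivateNbr x' x
      · obtain ⟨y', h1, h2⟩ := h.innerNbr.1 ⟨x', hadj, hp⟩
        exact ⟨y', h1, by simp [h2, hp]⟩
      · obtain ⟨y', h1, h2⟩ := h.leafNbr.1 ⟨x', hadj, hp⟩
        exact ⟨y', h1, by simp [h2, hp]⟩
    obtain ⟨y', h1, h2⟩ := this
    refine ⟨y', h1.ne', ?_⟩
    rw [hH.shortCycleFree.pairType_of_adj (hH.hasCommonNonNbr _ _) h1, htwo, h2]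
  by_cases hcom : G.HasCommonNbr x x'
  · rw [hG.shortCycleFree.pairType_of_hasCommonNbr (hG.hasCommonNonNbr _ _) hx' hadj hcom]
    have : ∃ y', y' ≠ y ∧ ¬ H.Adj y y' ∧ H.HasCommonNbr y y' ∧
        (H.HasPrivateNbr y' y ↔ G.HasPrivateNbr x' x) := by
      by_cases hp : G.HasPrivateNbr x' x
      · obtain ⟨y', h1, h2, h3, h4⟩ := h.innerSecondNbr.1 ⟨x', hx', hadj, hcom, hp⟩
        exact ⟨y', h1, h2, h3, by simp [h4, hp]⟩
      · obtain ⟨y', h1, h2, h3, h4⟩ := h.leafSecondNbr.1 ⟨x', hx', hadj, hcom, hp⟩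
        exact ⟨y', h1, h2, h3, by simp [h4, hp]⟩
    obtain ⟨y', h1, h2, h3, h4⟩ := this
    refine ⟨y', h1, ?_⟩
    rw [hH.shortCycleFree.pairType_of_hasCommonNbr (hH.hasCommonNonNbr _ _) h1 h2 h3, htwo, h4]
  · rw [pairType_of_not_hasCommonNbr (hG.hasCommonNonNbr _ _) hadj hcom]
    have : ∃ y', y' ≠ y ∧ ¬ H.Adj y y' ∧ ¬ H.HasCommonNbr y y' ∧
        ((∃ z, H.Adj y' z) ↔ ∃ z, G.Adj x' z) := by
      by_cases hz : ∃ z, G.Adj x' z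
      · obtain ⟨z, hz⟩ := hz
        have hcopy : IsCopy path2.graph (![x', z] : Fin 2 → V) G := by
          refine Pattern.isCopy ?_ hz
          simp [vecCons_injective_iff, hz.ne, path2, Function.injective_of_subsingleton]
        have := hG.lt_of_isCopy hα (by simp [witnessTrees]) hcopy
        obtain ⟨y', h1, h2, h3, h4⟩ := hH.exists_far_edge (by simpa [path2] using this) y
        exact ⟨y', h1, h2, h3, by simp [h4]; exact ⟨z, hz⟩⟩
      · obtain ⟨y', h1, -, h2⟩ := hH.exists_isolated y y
        refine ⟨y', h1, fun h => h2 _ h.symm, fun ⟨z, _, hz⟩ => h2 _ hz, ?_⟩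
        exact iff_of_false (fun ⟨z, hz⟩ => h2 _ hz) hz
    obtain ⟨y', h1, h2, h3, h4⟩ := this
    refine ⟨y', h1, ?_⟩
    rw [pairType_of_not_hasCommonNbr (hH.hasCommonNonNbr _ _) h2 h3, propext h4,
      propext h.exists_adj_iff]

theorem SparseTypical.vertexType_eq (hα : ∀ T ∈ witnessTrees, α * (T.1 - 1) ≠ T.1)
    (hG : SparseTypical α G) (hH : SparseTypical α H) {x : V} {y : W}
    (h : SameLocalType G x H y) : G.vertexType x = H.vertexType y :=
  (hG.vertexType_subset hα hH h).antisymm (hH.vertexType_subset hα hG h.symm)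

end Typical

/-! ### Witness trees for all local types -/

section Witness

variable {G : SimpleGraph V}

theorem isCopy_path2 {a b : V} (h : G.Adj a b) : IsCopy path2.graph (![a, b] : Fin 2 → V) G := by
  refine Pattern.isCopy ?_ h
  simp [vecCons_injective_iff, h.ne, path2, Function.injective_of_subsingleton]

theorem isCopy_path3 {a b c : V} (h1 : G.Adj a b) (h2 : G.Adj b c) (hac : a ≠ c) :
    IsCopy path3.graph (![a, b, c] : Fin 3 → V) G := by
  refine Pattern.isCopy ?_ ⟨h1, h2⟩
  simp [vecCons_injective_iff, Fin.forall_fin_succ, h1.ne, h2.ne, hac, path3,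
    Function.injective_of_subsingleton]

theorem isCopy_path4 {a b c d : V} (h1 : G.Adj a b) (h2 : G.Adj b c) (h3 : G.Adj c d)
    (hac : a ≠ c) (had : a ≠ d) (hbd : b ≠ d) :
    IsCopy path4.graph (![a, b, c, d] : Fin 4 → V) G := by
  refine Pattern.isCopy ?_ ⟨h1, h2, h3⟩
  simp [vecCons_injective_iff, Fin.forall_fin_succ, h1.ne, h2.ne, h3.ne, hac, had, hbd, path4,
    Function.injective_of_subsingleton]

/-- In a graph without short cycles, walks of length six without backtracking are paths. -/
theorem ShortCycleFree.isCopy_path7 (hG : ShortCycleFree G) {a b c d e f g : V} (h1 : G.Adj a b)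
    (h2 : G.Adj b c) (h3 : G.Adj c d) (h4 : G.Adj d e) (h5 : G.Adj e f) (h6 : G.Adj f g)
    (hac : a ≠ c) (hbd : b ≠ d) (hce : c ≠ e) (hdf : d ≠ f) (heg : e ≠ g) :
    IsCopy path7.graph (![a, b, c, d, e, f, g] : Fin 7 → V) G := by
  -- Each coincidence of vertices at distance 3, 4, 5 or 6 along the walk would close a short cycle;
  -- distances 1 and 2 are covered by adjacency and the non-backtracking hypotheses.
  have step3 : ∀ {u v w x : V}, G.Adj u v → G.Adj v w → G.Adj w x → u ≠ x := by
    rintro u v w x h1 h2 h3 rfl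
    exact hG.not_cycle3 h1 h2 h3.symm
  have had := step3 h1 h2 h3
  have hbe := step3 h2 h3 h4
  have hcf := step3 h3 h4 h5
  have hdg := step3 h4 h5 h6
  have step4 : ∀ {u v w x y : V}, G.Adj u v → G.Adj v w → G.Adj w x → G.Adj x y → u ≠ w → v ≠ x →
      u ≠ y := by
    rintro u v w x y h1 h2 h3 h4 huw hvx rfl
    exact hG.not_cycle4 h1 h2 h3 h4 huw hvx
  have hae := step4 h1 h2 h3 h4 hac hbd
  have hbf := step4 h2 h3 h4 h5 hbd hce
  have hcg := step4 h3 h4 h5 h6 hce hdf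
  have haf : a ≠ f := by
    rintro rfl
    exact hG.not_cycle5 h1 h2 h3 h4 h5 hac had hbd hbe hce
  have hbg : b ≠ g := by
    rintro rfl
    exact hG.not_cycle5 h2 h3 h4 h5 h6 hbd hbe hce hcf hdf
  have hag : a ≠ g := by
    rintro rfl
    exact hG.not_cycle6 h1 h2 h3 h4 h5 h6 hac had hae hbd hbe hbf hce hcf hdf
  refine Pattern.isCopy ?_ ⟨h1, h2, h3, h4, h5, h6⟩
  simp [vecCons_injective_iff, Fin.forall_fin_succ, h1.ne, h2.ne, h3.ne, h4.ne, h5.ne, h6.ne, hac,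
    had, hae, haf, hag, hbd, hbe, hbf, hbg, hce, hcf, hcg, hdf, hdg, heg, path7,
    Function.injective_of_subsingleton]

theorem ShortCycleFree.isCopy_path6 (hG : ShortCycleFree G) {a b c d e f : V} (h1 : G.Adj a b)
    (h2 : G.Adj b c) (h3 : G.Adj c d) (h4 : G.Adj d e) (h5 : G.Adj e f)
    (hac : a ≠ c) (hbd : b ≠ d) (hce : c ≠ e) (hdf : d ≠ f) :
    IsCopy path6.graph (![a, b, c, d, e, f] : Fin 6 → V) G := by
  have step3 : ∀ {u v w x : V}, G.Adj u v → G.Adj v w → G.Adj w x → u ≠ x := by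
    rintro u v w x h1 h2 h3 rfl
    exact hG.not_cycle3 h1 h2 h3.symm
  have had := step3 h1 h2 h3
  have hbe := step3 h2 h3 h4
  have hcf := step3 h3 h4 h5
  have step4 : ∀ {u v w x y : V}, G.Adj u v → G.Adj v w → G.Adj w x → G.Adj x y → u ≠ w → v ≠ x →
      u ≠ y := by
    rintro u v w x y h1 h2 h3 h4 huw hvx rfl
    exact hG.not_cycle4 h1 h2 h3 h4 huw hvx
  have hae := step4 h1 h2 h3 h4 hac hbd
  have hbf := step4 h2 h3 h4 h5 hbd hce
  have haf : a ≠ f := by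
    rintro rfl
    exact hG.not_cycle5 h1 h2 h3 h4 h5 hac had hbd hbe hce
  refine Pattern.isCopy ?_ ⟨h1, h2, h3, h4, h5⟩
  simp [vecCons_injective_iff, Fin.forall_fin_succ, h1.ne, h2.ne, h3.ne, h4.ne, h5.ne, hac,
    had, hae, haf, hbd, hbe, hbf, hce, hcf, hdf, path6, Function.injective_of_subsingleton]

theorem ShortCycleFree.isCopy_path5 (hG : ShortCycleFree G) {a b c d e : V} (h1 : G.Adj a b)
    (h2 : G.Adj b c) (h3 : G.Adj c d) (h4 : G.Adj d e)
    (hac : a ≠ c) (hbd : b ≠ d) (hce : c ≠ e) :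
    IsCopy path5.graph (![a, b, c, d, e] : Fin 5 → V) G := by
  have step3 : ∀ {u v w x : V}, G.Adj u v → G.Adj v w → G.Adj w x → u ≠ x := by
    rintro u v w x h1 h2 h3 rfl
    exact hG.not_cycle3 h1 h2 h3.symm
  have had := step3 h1 h2 h3
  have hbe := step3 h2 h3 h4
  have hae : a ≠ e := by
    rintro rfl
    exact hG.not_cycle4 h1 h2 h3 h4 hac hbd
  refine Pattern.isCopy ?_ ⟨h1, h2, h3, h4⟩
  simp [vecCons_injective_iff, Fin.forall_fin_succ, h1.ne, h2.ne, h3.ne, h4.ne, hac,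
    had, hae, hbd, hbe, hce, path5, Function.injective_of_subsingleton]

end Witness

end SimpleGraph

/-! ### Trees forced by the local features of a vertex -/

namespace SimpleGraph

variable {V W : Type*} {G : SimpleGraph V} {x : V}

theorem HasInnerNbr.second (h : G.HasInnerNbr x) :
    G.HasInnerSecondNbr x ∨ G.HasLeafSecondNbr x := by
  obtain ⟨m, hm, z, hz, hxz, hne⟩ := h
  by_cases hp : G.HasPrivateNbr z x
  · exact Or.inl ⟨z, hne, hxz, ⟨m, hm, hz.symm⟩, hp⟩
  · exact Or.inr ⟨z, hne, hxz, ⟨m, hm, hz.symm⟩, hp⟩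

theorem HasInnerSecondNbr.innerNbr (h : G.HasInnerSecondNbr x) : G.HasInnerNbr x := by
  obtain ⟨y, hne, hxy, ⟨m, hm, hym⟩, -⟩ := h
  exact ⟨m, hm, y, hym.symm, hxy, hne⟩

theorem HasLeafSecondNbr.innerNbr (h : G.HasLeafSecondNbr x) : G.HasInnerNbr x := by
  obtain ⟨y, hne, hxy, ⟨m, hm, hym⟩, -⟩ := h
  exact ⟨m, hm, y, hym.symm, hxy, hne⟩

theorem HasInnerNbr.hasTwoNbrs (h : G.HasInnerNbr x) (h' : G.HasLeafNbr x) : G.HasTwoNbrs x := by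
  obtain ⟨y, hy, hp⟩ := h
  obtain ⟨z, hz, hp'⟩ := h'
  exact ⟨y, z, fun h => hp' (h ▸ hp), hy, hz⟩

theorem HasTwoNbrs.exists_ne (h : G.HasTwoNbrs x) (m : V) : ∃ u, u ≠ m ∧ G.Adj x u := by
  obtain ⟨y, z, hyz, hy, hz⟩ := h
  by_cases hym : y = m
  · exact ⟨z, fun h => hyz (hym.trans h.symm), hz⟩
  · exact ⟨y, hym, hy⟩

theorem HasTwoNbrs.exists_copy_path3 (h : G.HasTwoNbrs x) :
    ∃ f : Fin path3.1 → V, IsCopy path3.graph f G := by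
  obtain ⟨y, z, hyz, hy, hz⟩ := h
  exact ⟨_, isCopy_path3 hy.symm hz hyz⟩

theorem HasInnerNbr.exists_copy_path3 (h : G.HasInnerNbr x) :
    ∃ f : Fin path3.1 → V, IsCopy path3.graph f G := by
  obtain ⟨m, hm, z, hz, -, hne⟩ := h
  exact ⟨_, isCopy_path3 hm hz hne.symm⟩

theorem HasInnerSecondNbr.exists_copy_path4 (h : G.HasInnerSecondNbr x) :
    ∃ f : Fin path4.1 → V, IsCopy path4.graph f G := by
  obtain ⟨y, hne, -, ⟨m, hm, hym⟩, z, hyz, hxz, hzx⟩ := h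
  exact ⟨_, isCopy_path4 hm hym.symm hyz hne.symm hzx.symm fun h => hxz (h ▸ hm)⟩

theorem HasLeafNbr.exists_copy_path4 (h : G.HasLeafNbr x) (h' : G.HasInnerNbr x) :
    ∃ f : Fin path4.1 → V, IsCopy path4.graph f G := by
  obtain ⟨a, ha, hp⟩ := h
  obtain ⟨m, hm, z, hz, hxz, hne⟩ := h'
  exact ⟨_, isCopy_path4 ha.symm hm hz (fun h => hp (h ▸ ⟨z, hz, hxz, hne⟩))
    (fun h => hxz (h ▸ ha)) hne.symm⟩

theorem HasLeafNbr.exists_copy_path5 (hG : ShortCycleFree G) (h : G.HasLeafNbr x)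
    (h' : G.HasInnerSecondNbr x) : ∃ f : Fin path5.1 → V, IsCopy path5.graph f G := by
  obtain ⟨a, ha, hp⟩ := h
  obtain ⟨y, hne, hxy, ⟨m, hm, hym⟩, z, hyz, hxz, -⟩ := h'
  exact ⟨_, hG.isCopy_path5 ha.symm hm hym.symm hyz
    (fun h => hp (h ▸ ⟨y, hym.symm, hxy, hne⟩)) hne.symm fun h => hxz (h ▸ hm)⟩

/-- Neither of two neighbours is a leaf, so `x` is the middle of a path with two edges on each side.
The next two lemmas lengthen one or both arms to three edges. -/
theorem HasTwoNbrs.exists_copy_path5 (hG : ShortCycleFree G) (h : G.HasTwoNbrs x)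
    (h' : ¬ G.HasLeafNbr x) : ∃ f : Fin path5.1 → V, IsCopy path5.graph f G := by
  have hpriv : ∀ y, G.Adj x y → G.HasPrivateNbr y x := fun y hy => by
    by_contra hp
    exact h' ⟨y, hy, hp⟩
  obtain ⟨y, z, hyz, hy, hz⟩ := h
  obtain ⟨u, hu, -, hux⟩ := hpriv y hy
  obtain ⟨v, hv, -, hvx⟩ := hpriv z hz
  exact ⟨_, hG.isCopy_path5 hu.symm hy.symm hz hv hux hyz hvx.symm⟩

theorem HasTwoNbrs.exists_copy_path6 (hG : ShortCycleFree G) (h : G.HasTwoNbrs x)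
    (h' : ¬ G.HasLeafNbr x) (h'' : G.HasInnerSecondNbr x) :
    ∃ f : Fin path6.1 → V, IsCopy path6.graph f G := by
  have hpriv : ∀ y, G.Adj x y → G.HasPrivateNbr y x := fun y hy => by
    by_contra hp
    exact h' ⟨y, hy, hp⟩
  obtain ⟨y, hne, -, ⟨m, hm, hym⟩, w, hyw, hxw, -⟩ := h''
  obtain ⟨u, hum, hu⟩ := h.exists_ne m
  obtain ⟨z, hz, -, hzx⟩ := hpriv u hu
  exact ⟨_, hG.isCopy_path6 hz.symm hu.symm hm hym.symm hyw hzx hum hne.symm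
    fun h => hxw (h ▸ hm)⟩

theorem HasTwoNbrs.exists_copy_path7 (hG : ShortCycleFree G) (h : G.HasTwoNbrs x)
    (h' : ¬ G.HasLeafNbr x) (h'' : ¬ G.HasLeafSecondNbr x) :
    ∃ f : Fin path7.1 → V, IsCopy path7.graph f G := by
  have hpath : ∀ y, G.Adj x y → ∃ z w, G.Adj y z ∧ G.Adj z w ∧ z ≠ x ∧ y ≠ w := fun y hy => by
    obtain ⟨z, hz, hxz, hne⟩ : G.HasPrivateNbr y x := by
      by_contra hp
      exact h' ⟨y, hy, hp⟩
    obtain ⟨w, hw, hxw, -⟩ : G.HasPrivateNbr z x := by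
      by_contra hp
      exact h'' ⟨z, hne, hxz, ⟨y, hy, hz.symm⟩, hp⟩
    exact ⟨z, w, hz, hw, hne, fun h => hxw (h ▸ hy)⟩
  obtain ⟨y, y', hyy', hy, hy'⟩ := h
  obtain ⟨z, w, h1, h2, h3, h4⟩ := hpath y hy
  obtain ⟨z', w', h1', h2', h3', h4'⟩ := hpath y' hy'
  exact ⟨_, hG.isCopy_path7 h2.symm h1.symm hy.symm hy' h1' h2' h4.symm h3 hyy' h3'.symm h4'⟩

/-- As `x` has a single neighbour `m`, the inner and the leaf vertex at distance two both hang from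
`m`, which becomes the vertex of degree three. -/
theorem HasInnerSecondNbr.exists_copy_spider5 (h : G.HasInnerSecondNbr x)
    (h' : G.HasLeafSecondNbr x) (h'' : ¬ G.HasTwoNbrs x) :
    ∃ f : Fin spider5.1 → V, IsCopy spider5.graph f G := by
  obtain ⟨y, hyx, hxy, ⟨m, hm, hym⟩, z, hyz, hxz, hzx⟩ := h
  obtain ⟨l, hlx, hxl, ⟨m', hm', hlm⟩, hp⟩ := h'
  obtain rfl : m = m' := by
    by_contra hne
    exact h'' ⟨m, m', hne, hm, hm'⟩
  have hly : l ≠ y := fun h => hp (h ▸ ⟨z, hyz, hxz, hzx⟩)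
  have hlz : l ≠ z := fun h => hp ⟨y, h ▸ hyz.symm, hxy, hyx⟩
  have hmz : m ≠ z := fun h => hxz (h ▸ hm)
  refine ⟨![x, m, l, y, z], Pattern.isCopy ?_ ⟨hm, hlm.symm, hym.symm, hyz⟩⟩
  simp [vecCons_injective_iff, Fin.forall_fin_succ, hm.ne, hlm.ne', hym.ne', hyz.ne, hyx.symm,
    hzx.symm, hlx.symm, hly, hlz, hmz, Function.injective_of_subsingleton]

/-- The leaf and the inner vertex at distance two hang from the same neighbour (caterpillar) or from
different ones (path). Both trees have six vertices, so either yields the same bound on α. -/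
theorem HasLeafNbr.exists_copy_of_second (hG : ShortCycleFree G) (h : G.HasLeafNbr x)
    (h' : G.HasInnerSecondNbr x) (h'' : G.HasLeafSecondNbr x) :
    (∃ f : Fin path6.1 → V, IsCopy path6.graph f G) ∨
      ∃ f : Fin caterpillar6.1 → V, IsCopy caterpillar6.graph f G := by
  obtain ⟨a, ha, hpa⟩ := h
  obtain ⟨y, hyx, hxy, ⟨m, hm, hym⟩, z, hyz, hxz, hzx⟩ := h'
  obtain ⟨l, hlx, hxl, ⟨m', hm', hlm⟩, hp⟩ := h''
  have hmz : m ≠ z := fun h => hxz (h ▸ hm)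
  by_cases hmm : m' = m
  · subst hmm
    have hly : y ≠ l := fun h => hp (h ▸ ⟨z, hyz, hxz, hzx⟩)
    have hlz : z ≠ l := fun h => hp ⟨y, h ▸ hyz.symm, hxy, hyx⟩
    have ham : a ≠ m' := fun h => hpa (h ▸ ⟨y, hym.symm, hxy, hyx⟩)
    have hay : a ≠ y := fun h => hxy (h ▸ ha)
    have haz : a ≠ z := fun h => hxz (h ▸ ha)
    have hal : a ≠ l := fun h => hxl (h ▸ ha)
    refine Or.inr ⟨![a, x, m', y, z, l],
      Pattern.isCopy ?_ ⟨ha.symm, hm, hym.symm, hyz, hlm.symm⟩⟩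
    simp [vecCons_injective_iff, Fin.forall_fin_succ, ha.ne', hm.ne, hlm.ne', hym.ne', hyz.ne,
      hyx.symm, hzx.symm, hlx.symm, hly, hlz, hmz, ham, hay, haz, hal,
      Function.injective_of_subsingleton]
  · exact Or.inl ⟨_, hG.isCopy_path6 hlm hm'.symm hm hym.symm hyz hlx hmm hyx.symm hmz⟩

/-- The tree `T'` found in `G` and the tree `T` that realises the local type may differ: only the
number of vertices enters the threshold. -/
theorem SparseTypical.exists_vertexType_eq_of_copy {α : ℝ} {H : SimpleGraph W}
    (hα : ∀ T ∈ witnessTrees, α * (T.1 - 1) ≠ T.1) (hG : SparseTypical α G)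
    (hH : SparseTypical α H) {T T' : Pattern} (hT : T ∈ witnessTrees) (hT' : T' ∈ witnessTrees)
    (hTT' : T'.1 = T.1) (h : ∃ f : Fin T'.1 → V, IsCopy T'.graph f G) (i : Fin T.1)
    (hi : SameLocalType G x T.graph i) : ∃ y, G.vertexType x = H.vertexType y := by
  obtain ⟨f, hf⟩ := h
  have hlt := hG.lt_of_isCopy hα hT' hf
  rw [hTT'] at hlt
  obtain ⟨y⟩ := hH.nonempty
  obtain ⟨g, hg, -⟩ := hH.exists_isolatedCopy T hT hlt (fun _ => y) (fun _ => y)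
  exact ⟨g i, hG.vertexType_eq hα hH (hi.trans (hg.sameLocalType i))⟩

/-- The implications between the five features leave twelve combinations. Each one forces a copy of
some witness tree in `G`, and it is realised at a chosen vertex of a witness tree of the same order.
The largest is the path on seven vertices, seen from its middle. -/
theorem SparseTypical.exists_vertexType_eq {α : ℝ} {H : SimpleGraph W}
    (hα : ∀ T ∈ witnessTrees, α * (T.1 - 1) ≠ T.1) (hG : SparseTypical α G)
    (hH : SparseTypical α H) (x : V) : ∃ y, G.vertexType x = H.vertexType y := by
  have hfree := hG.shortCycleFree
  by_cases hI : G.HasInnerNbr x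
  · have hsec := hI.second
    by_cases hL : G.HasLeafNbr x
    · have htwo := hI.hasTwoNbrs hL
      by_cases hSI : G.HasInnerSecondNbr x
      · by_cases hSL : G.HasLeafSecondNbr x
        · have hi : SameLocalType G x caterpillar6.graph 1 :=
            ⟨iff_of_true hI (by decide), iff_of_true hL (by decide), iff_of_true hSI (by decide),
              iff_of_true hSL (by decide), iff_of_true htwo (by decide)⟩
          rcases hL.exists_copy_of_second hfree hSI hSL with h | h
          · exact hG.exists_vertexType_eq_of_copy (T := caterpillar6) (T' := path6) hα hH
              (by simp [witnessTrees]) (by simp [witnessTrees]) rfl h 1 hi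
          · exact hG.exists_vertexType_eq_of_copy (T := caterpillar6) hα hH
              (by simp [witnessTrees]) (by simp [witnessTrees]) rfl h 1 hi
        · exact hG.exists_vertexType_eq_of_copy hα hH (by simp [witnessTrees])
            (by simp [witnessTrees]) rfl (hL.exists_copy_path5 hfree hSI) 1
            ⟨iff_of_true hI (by decide), iff_of_true hL (by decide), iff_of_true hSI (by decide),
              iff_of_false hSL (by decide), iff_of_true htwo (by decide)⟩
      · have hSL := hsec.resolve_left hSI
        exact hG.exists_vertexType_eq_of_copy hα hH (by simp [witnessTrees])
          (by simp [witnessTrees]) rfl (hL.exists_copy_path4 hI) 1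
          ⟨iff_of_true hI (by decide), iff_of_true hL (by decide), iff_of_false hSI (by decide),
            iff_of_true hSL (by decide), iff_of_true htwo (by decide)⟩
    · by_cases htwo : G.HasTwoNbrs x
      · by_cases hSI : G.HasInnerSecondNbr x
        · by_cases hSL : G.HasLeafSecondNbr x
          · exact hG.exists_vertexType_eq_of_copy hα hH (by simp [witnessTrees])
              (by simp [witnessTrees]) rfl (htwo.exists_copy_path6 hfree hL hSI) 2
              ⟨iff_of_true hI (by decide), iff_of_false hL (by decide),
                iff_of_true hSI (by decide), iff_of_true hSL (by decide),
                iff_of_true htwo (by decide)⟩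
          · exact hG.exists_vertexType_eq_of_copy hα hH (by simp [witnessTrees])
              (by simp [witnessTrees]) rfl (htwo.exists_copy_path7 hfree hL hSL) 3
              ⟨iff_of_true hI (by decide), iff_of_false hL (by decide),
                iff_of_true hSI (by decide), iff_of_false hSL (by decide),
                iff_of_true htwo (by decide)⟩
        · have hSL := hsec.resolve_left hSI
          exact hG.exists_vertexType_eq_of_copy hα hH (by simp [witnessTrees])
            (by simp [witnessTrees]) rfl (htwo.exists_copy_path5 hfree hL) 2
            ⟨iff_of_true hI (by decide), iff_of_false hL (by decide),
              iff_of_false hSI (by decide), iff_of_true hSL (by decide),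
              iff_of_true htwo (by decide)⟩
      · by_cases hSI : G.HasInnerSecondNbr x
        · by_cases hSL : G.HasLeafSecondNbr x
          · exact hG.exists_vertexType_eq_of_copy hα hH (by simp [witnessTrees])
              (by simp [witnessTrees]) rfl (hSI.exists_copy_spider5 hSL htwo) 0
              ⟨iff_of_true hI (by decide), iff_of_false hL (by decide),
                iff_of_true hSI (by decide), iff_of_true hSL (by decide),
                iff_of_false htwo (by decide)⟩
          · exact hG.exists_vertexType_eq_of_copy hα hH (by simp [witnessTrees])
              (by simp [witnessTrees]) rfl hSI.exists_copy_path4 0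
              ⟨iff_of_true hI (by decide), iff_of_false hL (by decide),
                iff_of_true hSI (by decide), iff_of_false hSL (by decide),
                iff_of_false htwo (by decide)⟩
        · have hSL := hsec.resolve_left hSI
          exact hG.exists_vertexType_eq_of_copy hα hH (by simp [witnessTrees])
            (by simp [witnessTrees]) rfl hI.exists_copy_path3 0
            ⟨iff_of_true hI (by decide), iff_of_false hL (by decide),
              iff_of_false hSI (by decide), iff_of_true hSL (by decide),
              iff_of_false htwo (by decide)⟩
  · have hSI : ¬ G.HasInnerSecondNbr x := fun h => hI h.innerNbr
    have hSL : ¬ G.HasLeafSecondNbr x := fun h => hI h.innerNbr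
    by_cases hL : G.HasLeafNbr x
    · by_cases htwo : G.HasTwoNbrs x
      · exact hG.exists_vertexType_eq_of_copy hα hH (by simp [witnessTrees])
          (by simp [witnessTrees]) rfl htwo.exists_copy_path3 1
          ⟨iff_of_false hI (by decide), iff_of_true hL (by decide), iff_of_false hSI (by decide),
            iff_of_false hSL (by decide), iff_of_true htwo (by decide)⟩
      · have h2 : ∃ f : Fin path2.1 → V, IsCopy path2.graph f G := by
          obtain ⟨y, hy, -⟩ := hL
          exact ⟨_, isCopy_path2 hy⟩
        exact hG.exists_vertexType_eq_of_copy hα hH (by simp [witnessTrees])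
          (by simp [witnessTrees]) rfl h2 0
          ⟨iff_of_false hI (by decide), iff_of_true hL (by decide), iff_of_false hSI (by decide),
            iff_of_false hSL (by decide), iff_of_false htwo (by decide)⟩
    · have htwo : ¬ G.HasTwoNbrs x := fun ⟨y, _, _, hy, _⟩ =>
        (exists_adj_iff_hasNbr.1 ⟨y, hy⟩).elim hI hL
      have h1 : ∃ f : Fin path1.1 → V, IsCopy path1.graph f G :=
        ⟨fun _ => x, Function.injective_of_subsingleton (α := Fin 1) _,
          fun i j hij => absurd (Subsingleton.elim (α := Fin 1) i j) hij.1⟩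
      exact hG.exists_vertexType_eq_of_copy hα hH (by simp [witnessTrees])
        (by simp [witnessTrees]) rfl h1 0
        ⟨iff_of_false hI (by decide), iff_of_false hL (by decide), iff_of_false hSI (by decide),
          iff_of_false hSL (by decide), iff_of_false htwo (by decide)⟩

theorem SparseTypical.graphType_eq {α : ℝ} {H : SimpleGraph W}
    (hα : ∀ T ∈ witnessTrees, α * (T.1 - 1) ≠ T.1) (hG : SparseTypical α G)
    (hH : SparseTypical α H) : G.graphType = H.graphType := by
  refine Set.Subset.antisymm ?_ ?_
  · rintro _ ⟨x, rfl⟩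
    obtain ⟨y, hy⟩ := hG.exists_vertexType_eq hα hH x
    exact ⟨y, hy.symm⟩
  · rintro _ ⟨y, rfl⟩
    obtain ⟨x, hx⟩ := hH.exists_vertexType_eq hα hG y
    exact ⟨x, hx.symm⟩

end SimpleGraph

/-! ### Asymptotically almost sure events and criteria for the zero-one law -/

namespace SimpleGraph

/-- The event `A` holds asymptotically almost surely in `G(n, p n)`. -/
def AAS (p : ℕ → unitInterval) (A : ∀ n, SimpleGraph (Fin n) → Prop) : Prop :=
  Tendsto (fun n => graphProb (p n : ℝ) (fun G => ¬ A n G)) atTop (𝓝 0)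

variable {p : ℕ → unitInterval} {A B : ∀ n, SimpleGraph (Fin n) → Prop}

theorem AAS.of_le {b : ℕ → ℝ} (h : ∀ᶠ n in atTop, graphProb (p n : ℝ) (fun G => ¬ A n G) ≤ b n)
    (hb : Tendsto b atTop (𝓝 0)) : AAS p A :=
  tendsto_of_tendsto_of_tendsto_of_le_of_le' tendsto_const_nhds hb
    (Eventually.of_forall fun n => graphProb_nonneg (p n).2 _) h

theorem AAS.mono (h : AAS p A) (hAB : ∀ᶠ n in atTop, ∀ G, A n G → B n G) : AAS p B :=
  AAS.of_le (hAB.mono fun n hn => graphProb_mono (p n).2 fun G => mt (hn G)) h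

theorem AAS.and (hA : AAS p A) (hB : AAS p B) : AAS p fun n G => A n G ∧ B n G := by
  refine AAS.of_le (b := fun n => graphProb (p n : ℝ) (fun G => ¬ A n G) +
    graphProb (p n : ℝ) (fun G => ¬ B n G)) (Eventually.of_forall fun n => ?_) ?_
  · rw [graphProb_congr (B := fun G => ¬ A n G ∨ ¬ B n G) fun G => not_and_or]
    exact graphProb_or_le (p n).2 _ _
  · simpa using Tendsto.add hA hB

theorem AAS.true : AAS p fun _ _ => True := by
  simp only [AAS, not_true_eq_false, graphProb_false]
  exact tendsto_const_nhds

theorem AAS.forall_mem_list {κ : Type*} {L : List κ} {C : κ → ∀ n, SimpleGraph (Fin n) → Prop}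
    (h : ∀ k ∈ L, AAS p (C k)) : AAS p fun n G => ∀ k ∈ L, C k n G := by
  induction L with
  | nil => exact AAS.true.mono (by simp)
  | cons k L ih =>
    refine ((h k (by simp)).and (ih fun k' hk' => h k' (by simp [hk']))).mono ?_
    exact Eventually.of_forall fun n G hG => by simpa using hG

theorem AAS.tendsto_one (h : AAS p A) :
    Tendsto (fun n => graphProb (p n : ℝ) (A n)) atTop (𝓝 1) := by
  have : Tendsto (fun n => 1 - graphProb (p n : ℝ) (fun G => ¬ A n G)) atTop (𝓝 (1 - 0)) :=
    tendsto_const_nhds.sub h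
  simpa [graphProb_not] using this

theorem probSatisfiesFO_eq (n : ℕ) (q : unitInterval) (φ : Language.graph.Sentence) :
    probSatisfiesFO n q φ = graphProb (q : ℝ) (fun G : SimpleGraph (Fin n) => G.SatisfiesFO φ) :=
  (graphProb_eq_measure q _).symm

/-- If asymptotically almost surely the depth-three type of `G(n, p n)` is a fixed one, then
`G(n, p n)` obeys the zero-one `3`-law. -/
theorem obeysFOZeroOneLaw_of_aas (hA : AAS p A)
    (h : ∀ n m G H, A n G → A m H → G.graphType = H.graphType) : ObeysFOZeroOneLaw p 3 := by
  intro φ hφ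
  simp only [probSatisfiesFO_eq]
  by_cases hex : ∃ n G, A n G ∧ G.SatisfiesFO φ
  · obtain ⟨m, H, hH, hHφ⟩ := hex
    exact Or.inl (AAS.tendsto_one (hA.mono (B := fun n G => G.SatisfiesFO φ)
      (Eventually.of_forall fun n G hG =>
        (satisfiesFO_iff_of_graphType_eq (h _ _ _ _ hG hH) hφ).2 hHφ)))
  · right
    have := hA.mono (B := fun n G => ¬ G.SatisfiesFO φ)
      (Eventually.of_forall fun n G hG hGφ => hex ⟨n, G, hG, hGφ⟩)
    simpa [AAS] using this

theorem not_obeysFOZeroOneLaw_of_bounds {k : ℕ} {φ : Language.graph.Sentence}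
    (hφ : φ.quantifierDepth ≤ k) {c : ℝ} (hc : 0 < c)
    (h1 : ∀ᶠ n in atTop, c ≤ graphProb (p n : ℝ) (fun G : SimpleGraph (Fin n) => G.SatisfiesFO φ))
    (h2 : ∀ᶠ n in atTop,
      graphProb (p n : ℝ) (fun G : SimpleGraph (Fin n) => G.SatisfiesFO φ) ≤ 3 / 4) :
    ¬ ObeysFOZeroOneLaw p k := by
  intro h
  simp only [← probSatisfiesFO_eq] at h1 h2
  rcases h φ hφ with h | h
  · have := le_of_tendsto h h2
    norm_num at this
  · exact absurd (ge_of_tendsto h h1) (not_le.2 hc)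

/-! ### Asymptotics of powers -/

theorem natCast_pow_mul_rpow_pow {α : ℝ} (m e : ℕ) {n : ℕ} (hn : 0 < n) :
    (n : ℝ) ^ m * ((n : ℝ) ^ (-α)) ^ e = (n : ℝ) ^ (m - α * e) := by
  have hn' : (0 : ℝ) < n := by exact_mod_cast hn
  rw [← Real.rpow_natCast, ← Real.rpow_mul_natCast hn'.le, ← Real.rpow_add hn']
  congr 1
  ring

theorem tendsto_natCast_pow_mul_rpow_pow_zero {α : ℝ} {m e : ℕ} (h : m < α * e) :
    Tendsto (fun n : ℕ => (n : ℝ) ^ m * ((n : ℝ) ^ (-α)) ^ e) atTop (𝓝 0) := by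
  have h1 : Tendsto (fun n : ℕ => (n : ℝ) ^ (-(α * e - m))) atTop (𝓝 0) :=
    (tendsto_rpow_neg_atTop (sub_pos.2 h)).comp tendsto_natCast_atTop_atTop
  refine h1.congr' ?_
  filter_upwards [eventually_gt_atTop 0] with n hn
  rw [natCast_pow_mul_rpow_pow m e hn, neg_sub]

theorem tendsto_natCast_pow_mul_rpow_pow_atTop {α : ℝ} {m e : ℕ} (h : α * e < m) :
    Tendsto (fun n : ℕ => (n : ℝ) ^ m * ((n : ℝ) ^ (-α)) ^ e) atTop atTop := by
  have h1 : Tendsto (fun n : ℕ => (n : ℝ) ^ (m - α * e)) atTop atTop :=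
    (tendsto_rpow_atTop (sub_pos.2 h)).comp tendsto_natCast_atTop_atTop
  refine h1.congr' ?_
  filter_upwards [eventually_gt_atTop 0] with n hn
  rw [natCast_pow_mul_rpow_pow m e hn]

theorem natCast_pow_mul_rpow_pow_eq_one {α : ℝ} {m e : ℕ} (h : α * e = m) {n : ℕ} (hn : 0 < n) :
    (n : ℝ) ^ m * ((n : ℝ) ^ (-α)) ^ e = 1 := by
  rw [natCast_pow_mul_rpow_pow m e hn, h, sub_self, Real.rpow_zero]

/-- Almost all maps `Fin m → Fin n` are injective; the ratio lies between `(1 - m / n) ^ m` and 1.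
-/
theorem tendsto_descFactorial_div_pow (m : ℕ) :
    Tendsto (fun n : ℕ => (n.descFactorial m : ℝ) / (n : ℝ) ^ m) atTop (𝓝 1) := by
  have h1 : Tendsto (fun n : ℕ => (1 - (m : ℝ) / n) ^ m) atTop (𝓝 1) := by
    have : Tendsto (fun n : ℕ => (1 - (m : ℝ) / n) ^ m) atTop (𝓝 ((1 - 0) ^ m)) :=
      (tendsto_const_nhds.sub (tendsto_const_div_atTop_nhds_zero_nat _)).pow m
    simpa using this
  refine tendsto_of_tendsto_of_tendsto_of_le_of_le' h1 tendsto_const_nhds ?_ ?_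
  · filter_upwards [eventually_ge_atTop (m + 1)] with n hn
    have hn' : (0 : ℝ) < n := by exact_mod_cast (by omega : 0 < n)
    rw [le_div_iff₀ (by positivity), ← mul_pow]
    have h2 : (1 - (m : ℝ) / n) * n = ((n - m : ℕ) : ℝ) := by
      rw [Nat.cast_sub (by omega)]
      field_simp
    rw [h2]
    have h3 := Nat.pow_sub_le_descFactorial n m
    have h4 : (n - m) ^ m ≤ (n + 1 - m) ^ m := Nat.pow_le_pow_left (by omega) m
    exact_mod_cast h4.trans h3
  · filter_upwards [eventually_gt_atTop 0] with n hn
    have hn' : (0 : ℝ) < n := by exact_mod_cast hn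
    rw [div_le_one (by positivity)]
    exact_mod_cast Nat.descFactorial_le_pow n m

/-- Bernoulli's inequality bounds the power below by `1 - m n ^ (1 - α)`. This is where isolation of
small components needs α > 1. -/
theorem tendsto_one_sub_rpow_pow {α : ℝ} (hα : 1 < α) (m : ℕ) :
    Tendsto (fun n : ℕ => (1 - (n : ℝ) ^ (-α)) ^ (m * n)) atTop (𝓝 1) := by
  have h0 := tendsto_natCast_pow_mul_rpow_pow_zero (α := α) (m := 1) (e := 1) (by simpa using hα)
  have h1 : Tendsto (fun n : ℕ => 1 + -(m * ((n : ℝ) ^ 1 * ((n : ℝ) ^ (-α)) ^ 1))) atTop (𝓝 1) := by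
    simpa using (tendsto_const_nhds (x := (1 : ℝ))).add ((h0.const_mul (m : ℝ)).neg)
  refine tendsto_of_tendsto_of_tendsto_of_le_of_le' h1 tendsto_const_nhds ?_ ?_
  · refine Eventually.of_forall fun n => ?_
    have hp := (powEdgeProb α (by linarith) n).2
    have : -2 ≤ -((n : ℝ) ^ (-α)) := by
      have : (n : ℝ) ^ (-α) ≤ 1 := hp.2
      linarith
    have := one_add_mul_le_pow this (m * n)
    push_cast at this
    calc 1 + -(m * ((n : ℝ) ^ 1 * ((n : ℝ) ^ (-α)) ^ 1))
        = 1 + (m * n) * -(n : ℝ) ^ (-α) := by ring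
      _ ≤ _ := this
      _ = _ := by rw [← sub_eq_add_neg]
  · refine Eventually.of_forall fun n => ?_
    have hp := (powEdgeProb α (by linarith) n).2
    have h2 : (n : ℝ) ^ (-α) ≤ 1 := hp.2
    have h3 : 0 ≤ (n : ℝ) ^ (-α) := hp.1
    exact pow_le_one₀ (by linarith) (by linarith)

theorem coe_powEdgeProb {α : ℝ} (hα : 0 < α) (n : ℕ) :
    ((powEdgeProb α hα n : unitInterval) : ℝ) = (n : ℝ) ^ (-α) := rfl

/-! ### The random graph for `α > 1` -/

section Sparse

variable {α : ℝ} (hα : 0 < α)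

theorem aas_not_exists_isCopy {m : ℕ} (H : SimpleGraph (Fin m)) [DecidableRel H.Adj]
    (h : m < α * H.edgeFinset.card) :
    AAS (powEdgeProb α hα) fun n G => ¬ ∃ f : Fin m → Fin n, IsCopy H f G := by
  refine AAS.of_le (Eventually.of_forall fun n => ?_) (tendsto_natCast_pow_mul_rpow_pow_zero h)
  rw [graphProb_congr fun G => not_not]
  exact graphProb_exists_isCopy_le (powEdgeProb α hα n).2

/-- A cycle has as many edges as vertices, so for α > 1 the expected number of copies tends to 0. -/
theorem aas_shortCycleFree (h1 : 1 < α) :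
    AAS (powEdgeProb α hα) fun _ G => ShortCycleFree G := by
  refine AAS.forall_mem_list fun C hC => aas_not_exists_isCopy hα _ ?_
  rw [card_edgeFinset_shortCycles C hC]
  have : (0 : ℝ) < C.1 := by
    have : ∀ C ∈ shortCycles, 0 < C.1 := by decide
    exact_mod_cast this C hC
  nlinarith

/-- The ratio of the number of injections and the number of maps, times a lower bound for the
probability that a set of `m` vertices is not joined to the rest. -/
theorem tendsto_isolated_factor (h1 : 1 < α) (m : ℕ) :
    Tendsto (fun n : ℕ => (n.descFactorial m : ℝ) / (n : ℝ) ^ m * (1 - (n : ℝ) ^ (-α)) ^ (m * n))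
      atTop (𝓝 1) := by
  simpa using (tendsto_descFactorial_div_pow m).mul (tendsto_one_sub_rpow_pow h1 m)

theorem le_graphExp_eventCount_isIsolatedCopy (hα : 0 < α) {m : ℕ} (H : SimpleGraph (Fin m))
    [DecidableRel H.Adj] {n : ℕ} (hn : 0 < n) :
    (n.descFactorial m : ℝ) / (n : ℝ) ^ m * (1 - (n : ℝ) ^ (-α)) ^ (m * n) *
      ((n : ℝ) ^ m * ((n : ℝ) ^ (-α)) ^ H.edgeFinset.card) ≤
      graphExp ((n : ℝ) ^ (-α)) (eventCount fun f : Fin m → Fin n => IsIsolatedCopy H f) := by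
  have hn' : (0 : ℝ) < n := by exact_mod_cast hn
  refine le_trans (le_of_eq ?_) (le_graphExp_eventCount_of_injective (powEdgeProb α hα n).2
    fun f hf => le_graphProb_isIsolatedCopy (powEdgeProb α hα n).2 hf)
  rw [coe_powEdgeProb]
  field_simp

theorem exists_event_ne_ne {V κ : Type*} [Fintype κ] {A : κ → SimpleGraph V → Prop}
    {G : SimpleGraph V} (h : 3 ≤ eventCount A G) (k l : κ) : ∃ j, A j G ∧ j ≠ k ∧ j ≠ l := by
  classical
  by_contra! hcon
  rw [eventCount_eq_card, Nat.card_eq_fintype_card, Fintype.card_subtype] at h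
  have hsub : (Finset.univ.filter fun j => A j G) ⊆ {k, l} := by
    intro j hj
    by_cases hjk : j = k
    · simp [hjk]
    · simp [hcon j (Finset.mem_filter.1 hj).2 hjk]
  have h1 := (Finset.card_le_card hsub).trans Finset.card_le_two
  have h2 : 3 ≤ (Finset.univ.filter fun j => A j G).card := by exact_mod_cast h
  omega

theorem aas_three_le_eventCount_isIsolatedCopy (h1 : 1 < α) {m : ℕ} (H : SimpleGraph (Fin m))
    [DecidableRel H.Adj] (hH : ∀ k : Fin m, (k : ℕ) ≠ 0 → ∃ j < k, H.Adj j k)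
    (h : α * H.edgeFinset.card < m) :
    AAS (powEdgeProb α hα) fun n G =>
      3 ≤ eventCount (fun f : Fin m → Fin n => IsIsolatedCopy H f) G := by
  set M : ℕ → ℝ := fun n => (n : ℝ) ^ m * ((n : ℝ) ^ (-α)) ^ H.edgeFinset.card with hM
  set r : ℕ → ℝ := fun n =>
    (n.descFactorial m : ℝ) / (n : ℝ) ^ m * (1 - (n : ℝ) ^ (-α)) ^ (m * n) with hr
  have hMtop : Tendsto M atTop atTop := tendsto_natCast_pow_mul_rpow_pow_atTop h
  have hr1 : Tendsto r atTop (𝓝 1) := tendsto_isolated_factor h1 m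
  refine AAS.of_le (b := fun n => 4 * ((m : ℝ) ^ m / M n + 2 * (1 - r n))) ?_ ?_
  -- Once `M ≥ 6`, fewer than three copies means falling short of `M` by at least `M / 2`.
  · filter_upwards [hMtop.eventually_ge_atTop 6, eventually_gt_atTop 0] with n hMn hn
    refine graphProb_le_of_second_moment (M := M n) (powEdgeProb α hα n).2 (by linarith)
      (le_graphExp_eventCount_isIsolatedCopy hα H hn)
      ((graphExp_eventCount_isIsolatedCopy_sq_le (powEdgeProb α hα n).2 hH).trans
        (le_of_eq ?_)) ?_
    · change M n ^ 2 + m ^ m * M n = _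
      have : M n ≠ 0 := by linarith
      field_simp
    · intro G hG
      rw [abs_sub_comm]
      refine le_trans ?_ (le_abs_self _)
      linarith [not_le.1 hG]
  · have h2 := hMtop.const_div_atTop ((m : ℝ) ^ m)
    have h3 := (h2.add ((tendsto_const_nhds (x := (1 : ℝ))).sub hr1 |>.const_mul 2)).const_mul 4
    simpa using h3

/-- At the threshold, isolated copies of a tree exist with probability bounded away from zero. -/
theorem eventually_le_graphProb_exists_isIsolatedCopy (h1 : 1 < α) {m : ℕ}
    (H : SimpleGraph (Fin m)) [DecidableRel H.Adj]
    (hH : ∀ k : Fin m, (k : ℕ) ≠ 0 → ∃ j < k, H.Adj j k) (h : α * H.edgeFinset.card = m) :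
    ∃ c > 0, ∀ᶠ n in atTop, c ≤ graphProb (powEdgeProb α hα n : ℝ)
      (fun G => ∃ f : Fin m → Fin n, IsIsolatedCopy H f G) := by
  have hr1 := tendsto_isolated_factor h1 m
  -- At the threshold `M = 1` and `δ = m ^ m`; eventually `r ≥ 3 / 4`, so that `2 r - 1 ≥ 1 / 2`.
  refine ⟨1 / 2 / (1 + (m : ℝ) ^ m), by positivity, ?_⟩
  filter_upwards [hr1.eventually (eventually_ge_nhds (by norm_num : (3 / 4 : ℝ) < 1)),
    eventually_gt_atTop 0] with n hrn hn
  have hM := natCast_pow_mul_rpow_pow_eq_one h hn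
  have h2 := le_graphExp_eventCount_isIsolatedCopy hα H hn
  have h3 := graphExp_eventCount_isIsolatedCopy_sq_le (n := n) (powEdgeProb α hα n).2 hH
  rw [coe_powEdgeProb] at h3
  rw [hM] at h2 h3
  have := le_graphProb_of_second_moment (M := 1) (δ := (m : ℝ) ^ m) (powEdgeProb α hα n).2
    one_pos (by positivity) h2 (h3.trans (le_of_eq (by ring)))
    (A := fun G => ∃ f : Fin m → Fin n, IsIsolatedCopy H f G) fun G hG => eventCount_eq_zero hG
  refine le_trans ?_ this
  gcongr
  linarith

theorem aas_sparseTypical (h1 : 1 < α) :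
    AAS (powEdgeProb α hα) fun _ G => SparseTypical α G := by
  have hcard : ∀ T ∈ witnessTrees, (T.graph.edgeFinset.card : ℝ) = T.1 - 1 := fun T hT => by
    have := card_edgeFinset_witnessTrees T hT
    rw [eq_sub_iff_add_eq]
    exact_mod_cast this
  have hmany : AAS (powEdgeProb α hα) fun n G => ∀ T ∈ witnessTrees, α * (T.1 - 1) < T.1 →
      ∀ g h : Fin T.1 → Fin n, ∃ f, IsIsolatedCopy T.graph f G ∧ f ≠ g ∧ f ≠ h := by
    refine AAS.forall_mem_list fun T hT => ?_
    by_cases hT1 : α * (T.1 - 1) < T.1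
    · refine (aas_three_le_eventCount_isIsolatedCopy hα h1 T.graph
        (exists_adj_lt_of_mem_witnessTrees T hT) (by rwa [hcard T hT])).mono ?_
      exact Eventually.of_forall fun n G hG _ g h => exists_event_ne_ne hG g h
    · exact AAS.true.mono (Eventually.of_forall fun n G _ h => absurd h hT1)
  have hnone : AAS (powEdgeProb α hα) fun n G => ∀ T ∈ witnessTrees, (T.1 : ℝ) < α * (T.1 - 1) →
      ¬ ∃ f : Fin T.1 → Fin n, IsCopy T.graph f G := by
    refine AAS.forall_mem_list fun T hT => ?_
    by_cases hT1 : (T.1 : ℝ) < α * (T.1 - 1)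
    · refine (aas_not_exists_isCopy hα T.graph (by rwa [hcard T hT])).mono ?_
      exact Eventually.of_forall fun n G hG _ => hG
    · exact AAS.true.mono (Eventually.of_forall fun n G _ h => absurd h hT1)
  refine ((aas_shortCycleFree hα h1).and (hmany.and hnone)).mono ?_
  filter_upwards [eventually_gt_atTop 0] with n hn G hG
  exact ⟨⟨⟨0, hn⟩⟩, hG.1, hG.2.1, hG.2.2⟩

theorem obeysFOZeroOneLaw_of_one_lt (h1 : 1 < α)
    (h : ∀ T ∈ witnessTrees, α * (T.1 - 1) ≠ T.1) :
    ObeysFOZeroOneLaw (powEdgeProb α hα) 3 :=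
  obeysFOZeroOneLaw_of_aas (aas_sparseTypical hα h1) fun _ _ _ _ hG hH => hG.graphType_eq h hH

end Sparse

end SimpleGraph

namespace SimpleGraph

/-! ### First-order formulas for local types -/

section Formulas

open Language

variable {k : ℕ}

/-- The formula `φ` of the language of graphs holds in `G` for the vertices `a`. -/
def Sat {V : Type*} (G : SimpleGraph V) (φ : Language.graph.BoundedFormula Empty k)
    (a : Fin k → V) : Prop :=
  @BoundedFormula.Realize _ V G.structure _ _ φ default a

def adjFormula (i j : Fin k) : Language.graph.BoundedFormula Empty k :=
  adj.boundedFormula₂ (Term.var (Sum.inr i)) (Term.var (Sum.inr j))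

def eqFormula (i j : Fin k) : Language.graph.BoundedFormula Empty k :=
  BoundedFormula.equal (Term.var (Sum.inr i)) (Term.var (Sum.inr j))

section Sat

variable {V : Type*} (G : SimpleGraph V) (a : Fin k → V)

@[simp] theorem sat_adjFormula (i j : Fin k) : G.Sat (adjFormula i j) a ↔ G.Adj (a i) (a j) := by
  let := G.structure
  exact BoundedFormula.realize_rel₂

@[simp] theorem sat_eqFormula (i j : Fin k) : G.Sat (eqFormula i j) a ↔ a i = a j := Iff.rfl

@[simp] theorem sat_not (φ : Language.graph.BoundedFormula Empty k) :
    G.Sat φ.not a ↔ ¬ G.Sat φ a := Iff.rfl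

@[simp] theorem sat_inf (φ ψ : Language.graph.BoundedFormula Empty k) :
    G.Sat (φ ⊓ ψ) a ↔ G.Sat φ a ∧ G.Sat ψ a := by
  let := G.structure
  exact BoundedFormula.realize_inf

@[simp] theorem sat_ex (φ : Language.graph.BoundedFormula Empty (k + 1)) :
    G.Sat φ.ex a ↔ ∃ x, G.Sat φ (Fin.snoc a x) := by
  let := G.structure
  exact BoundedFormula.realize_ex

end Sat

@[simp] theorem quantifierDepth_not (φ : Language.graph.BoundedFormula Empty k) :
    φ.not.quantifierDepth = φ.quantifierDepth := Nat.max_zero _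

@[simp] theorem quantifierDepth_inf (φ ψ : Language.graph.BoundedFormula Empty k) :
    (φ ⊓ ψ).quantifierDepth = max φ.quantifierDepth ψ.quantifierDepth := by
  change max (max φ.quantifierDepth (max ψ.quantifierDepth 0)) 0 = _
  simp

@[simp] theorem quantifierDepth_ex (φ : Language.graph.BoundedFormula Empty (k + 1)) :
    φ.ex.quantifierDepth = φ.quantifierDepth + 1 := by
  change max (max φ.quantifierDepth 0 + 1) 0 = _
  simp

@[simp] theorem quantifierDepth_adjFormula (i j : Fin k) :
    (adjFormula i j).quantifierDepth = 0 := rfl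

@[simp] theorem quantifierDepth_eqFormula (i j : Fin k) :
    (eqFormula i j).quantifierDepth = 0 := rfl

/-- The quantified vertex has index `Fin.last k`, and `castSucc` carries the free indices under the
quantifier. The features of a single vertex below have depth at most two, leaving one quantifier for
the vertex itself. -/
def privateNbrFormula (i j : Fin k) : Language.graph.BoundedFormula Empty k :=
  (adjFormula i.castSucc (Fin.last k) ⊓ ((adjFormula j.castSucc (Fin.last k)).not ⊓
    (eqFormula (Fin.last k) j.castSucc).not)).ex

def commonNbrFormula (i j : Fin k) : Language.graph.BoundedFormula Empty k :=
  (adjFormula i.castSucc (Fin.last k) ⊓ adjFormula j.castSucc (Fin.last k)).ex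

def leafNbrFormula (i : Fin k) : Language.graph.BoundedFormula Empty k :=
  (adjFormula i.castSucc (Fin.last k) ⊓ (privateNbrFormula (Fin.last k) i.castSucc).not).ex

def innerSecondNbrFormula (i : Fin k) : Language.graph.BoundedFormula Empty k :=
  ((eqFormula (Fin.last k) i.castSucc).not ⊓ ((adjFormula i.castSucc (Fin.last k)).not ⊓
    (commonNbrFormula i.castSucc (Fin.last k) ⊓
      privateNbrFormula (Fin.last k) i.castSucc))).ex

def leafSecondNbrFormula (i : Fin k) : Language.graph.BoundedFormula Empty k :=
  ((eqFormula (Fin.last k) i.castSucc).not ⊓ ((adjFormula i.castSucc (Fin.last k)).not ⊓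
    (commonNbrFormula i.castSucc (Fin.last k) ⊓
      (privateNbrFormula (Fin.last k) i.castSucc).not))).ex

def twoNbrsFormula (i : Fin k) : Language.graph.BoundedFormula Empty k :=
  ((eqFormula (Fin.last k).castSucc (Fin.last (k + 1))).not ⊓
    (adjFormula i.castSucc.castSucc (Fin.last k).castSucc ⊓
      adjFormula i.castSucc.castSucc (Fin.last (k + 1)))).ex.ex

section Sat

variable {V : Type*} (G : SimpleGraph V) (a : Fin k → V)

@[simp] theorem sat_privateNbrFormula (i j : Fin k) :
    G.Sat (privateNbrFormula i j) a ↔ G.HasPrivateNbr (a i) (a j) := by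
  simp [privateNbrFormula, HasPrivateNbr]

@[simp] theorem sat_commonNbrFormula (i j : Fin k) :
    G.Sat (commonNbrFormula i j) a ↔ G.HasCommonNbr (a i) (a j) := by
  simp [commonNbrFormula, HasCommonNbr]

@[simp] theorem sat_leafNbrFormula (i : Fin k) :
    G.Sat (leafNbrFormula i) a ↔ G.HasLeafNbr (a i) := by
  simp [leafNbrFormula, HasLeafNbr]

@[simp] theorem sat_innerSecondNbrFormula (i : Fin k) :
    G.Sat (innerSecondNbrFormula i) a ↔ G.HasInnerSecondNbr (a i) := by
  simp [innerSecondNbrFormula, HasInnerSecondNbr]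

@[simp] theorem sat_leafSecondNbrFormula (i : Fin k) :
    G.Sat (leafSecondNbrFormula i) a ↔ G.HasLeafSecondNbr (a i) := by
  simp [leafSecondNbrFormula, HasLeafSecondNbr]

@[simp] theorem sat_twoNbrsFormula (i : Fin k) :
    G.Sat (twoNbrsFormula i) a ↔ G.HasTwoNbrs (a i) := by
  simp [twoNbrsFormula, HasTwoNbrs]

theorem satisfiesFO_ex_iff (φ : Language.graph.BoundedFormula Empty 1) :
    G.SatisfiesFO φ.ex ↔ ∃ x, G.Sat φ (Fin.snoc default x) := sat_ex G default φ

end Sat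

theorem snoc_default_zero {V : Type*} (x : V) :
    (Fin.snoc (default : Fin 0 → V) x : Fin 1 → V) 0 = x := Fin.snoc_last (α := fun _ => V) _ _

end Formulas

/-! ### Failure of the zero-one law at the thresholds -/

section Threshold

variable {α : ℝ} (hα : 0 < α)

theorem eventually_graphProb_exists_isCopy_le_half {m : ℕ} (H : SimpleGraph (Fin m))
    [DecidableRel H.Adj] (h : α * H.edgeFinset.card = m) {i₀ : Fin m} (hi₀ : Fin.rev i₀ ≠ i₀)
    (hrev : ∀ i j, H.Adj i j → H.Adj i.rev j.rev) :
    ∀ᶠ n in atTop, graphProb (powEdgeProb α hα n : ℝ)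
      (fun G => ∃ f : Fin m → Fin n, IsCopy H f G) ≤ 1 / 2 := by
  filter_upwards [eventually_gt_atTop 0] with n hn
  have h1 := two_mul_graphProb_exists_isCopy_le (n := n) (powEdgeProb α hα n).2
    Fin.rev_injective hrev hi₀
  have h2 := natCast_pow_mul_rpow_pow_eq_one h hn
  rw [coe_powEdgeProb] at h1 ⊢
  rw [h2] at h1
  linarith

/-- Isolated copies give the lower bound, because `φ` may contain negated features that a larger
component could spoil. Plain copies give the upper bound 1/2 by the reversal symmetry, with 1/4 to
spare for graphs containing a short cycle. -/
theorem not_obeysFOZeroOneLaw_of_path (h1 : 1 < α) {T : Pattern} (hT : T ∈ witnessTrees)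
    (h : α * (T.1 - 1) = T.1) {i₀ : Fin T.1} (hi₀ : Fin.rev i₀ ≠ i₀)
    (hrev : ∀ i j, T.graph.Adj i j → T.graph.Adj i.rev j.rev)
    {φ : Language.graph.Sentence} (hφ : φ.quantifierDepth ≤ 3)
    (hlow : ∀ (n : ℕ) (G : SimpleGraph (Fin n)) (f : Fin T.1 → Fin n),
      IsIsolatedCopy T.graph f G → G.SatisfiesFO φ)
    (hup : ∀ (n : ℕ) (G : SimpleGraph (Fin n)), ShortCycleFree G → G.SatisfiesFO φ →
      ∃ f : Fin T.1 → Fin n, IsCopy T.graph f G) :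
    ¬ ObeysFOZeroOneLaw (powEdgeProb α hα) 3 := by
  have hcard : (T.graph.edgeFinset.card : ℝ) = T.1 - 1 := by
    have := card_edgeFinset_witnessTrees T hT
    rw [eq_sub_iff_add_eq]
    exact_mod_cast this
  rw [← hcard] at h
  obtain ⟨c, hc, hcn⟩ := eventually_le_graphProb_exists_isIsolatedCopy hα h1 T.graph
    (exists_adj_lt_of_mem_witnessTrees T hT) h
  refine not_obeysFOZeroOneLaw_of_bounds hφ hc (hcn.mono fun n hn =>
    hn.trans (graphProb_mono (powEdgeProb α hα n).2 fun G ⟨f, hf⟩ => hlow n G f hf)) ?_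
  filter_upwards [eventually_graphProb_exists_isCopy_le_half hα T.graph h hi₀ hrev,
    (aas_shortCycleFree hα h1).eventually (eventually_le_nhds (by norm_num : (0 : ℝ) < 1 / 4))]
    with n hn1 hn2
  have h2 := graphProb_or_le (powEdgeProb α hα n).2
    (fun G => ∃ f : Fin T.1 → Fin n, IsCopy T.graph f G) (fun G => ¬ ShortCycleFree G)
  have h3 := graphProb_mono (powEdgeProb α hα n).2 (A := fun G => G.SatisfiesFO φ)
    (B := fun G => (∃ f : Fin T.1 → Fin n, IsCopy T.graph f G) ∨ ¬ ShortCycleFree G)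
    fun G hG => by
      by_cases hfree : ShortCycleFree G
      · exact Or.inl (hup n G hfree hG)
      · exact Or.inr hfree
  linarith

theorem not_obeysFOZeroOneLaw_two : ¬ ObeysFOZeroOneLaw (powEdgeProb 2 two_pos) 3 := by
  have hsat : ∀ (n : ℕ) (G : SimpleGraph (Fin n)),
      G.SatisfiesFO (adjFormula (0 : Fin 2) 1).ex.ex ↔ ∃ x y, G.Adj x y := by
    intro n G
    rw [satisfiesFO_ex_iff]
    simp only [sat_ex, sat_adjFormula]
    exact Iff.rfl
  refine not_obeysFOZeroOneLaw_of_path two_pos (T := path2) (by norm_num)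
    (by simp [witnessTrees]) (by norm_num) (i₀ := (0 : Fin 2)) (by decide) (by decide)
    (φ := (adjFormula (0 : Fin 2) 1).ex.ex) (by simp) (fun n G f hf => ?_) (fun n G _ h => ?_)
  · exact (hsat n G).2 ⟨f (0 : Fin 2), f (1 : Fin 2), hf.1.2 _ _ (by decide)⟩
  · obtain ⟨x, y, hxy⟩ := (hsat n G).1 h
    exact ⟨_, isCopy_path2 hxy⟩

theorem not_obeysFOZeroOneLaw_three_halves (hα : (0 : ℝ) < 3 / 2) :
    ¬ ObeysFOZeroOneLaw (powEdgeProb (3 / 2) hα) 3 := by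
  have hsat : ∀ (n : ℕ) (G : SimpleGraph (Fin n)),
      G.SatisfiesFO (twoNbrsFormula (0 : Fin 1)).ex ↔ ∃ x, G.HasTwoNbrs x := by
    intro n G
    simp [satisfiesFO_ex_iff, snoc_default_zero]
  refine not_obeysFOZeroOneLaw_of_path hα (T := path3) (by norm_num)
    (by simp [witnessTrees]) (by norm_num) (i₀ := (0 : Fin 3)) (by decide) (by decide)
    (φ := (twoNbrsFormula (0 : Fin 1)).ex) (by simp [twoNbrsFormula]) (fun n G f hf => ?_)
    (fun n G _ h => ?_)
  · exact (hsat n G).2 ⟨f (1 : Fin 3), (hf.sameLocalType _).twoNbrs.1 (by decide)⟩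
  · obtain ⟨x, hx⟩ := (hsat n G).1 h
    exact hx.exists_copy_path3

theorem not_obeysFOZeroOneLaw_four_thirds (hα : (0 : ℝ) < 4 / 3) :
    ¬ ObeysFOZeroOneLaw (powEdgeProb (4 / 3) hα) 3 := by
  have hsat : ∀ (n : ℕ) (G : SimpleGraph (Fin n)),
      G.SatisfiesFO (innerSecondNbrFormula (0 : Fin 1)).ex ↔ ∃ x, G.HasInnerSecondNbr x := by
    intro n G
    simp [satisfiesFO_ex_iff, snoc_default_zero]
  refine not_obeysFOZeroOneLaw_of_path hα (T := path4) (by norm_num)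
    (by simp [witnessTrees]) (by norm_num) (i₀ := (0 : Fin 4)) (by decide) (by decide)
    (φ := (innerSecondNbrFormula (0 : Fin 1)).ex)
    (by simp [innerSecondNbrFormula, commonNbrFormula, privateNbrFormula]) (fun n G f hf => ?_)
    (fun n G _ h => ?_)
  · exact (hsat n G).2 ⟨f (0 : Fin 4), (hf.sameLocalType _).innerSecondNbr.1 (by decide)⟩
  · obtain ⟨x, hx⟩ := (hsat n G).1 h
    exact hx.exists_copy_path4

theorem not_obeysFOZeroOneLaw_five_fourths (hα : (0 : ℝ) < 5 / 4) :
    ¬ ObeysFOZeroOneLaw (powEdgeProb (5 / 4) hα) 3 := by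
  have hsat : ∀ (n : ℕ) (G : SimpleGraph (Fin n)),
      G.SatisfiesFO (twoNbrsFormula (0 : Fin 1) ⊓ (leafNbrFormula (0 : Fin 1)).not).ex ↔
        ∃ x, G.HasTwoNbrs x ∧ ¬ G.HasLeafNbr x := by
    intro n G
    simp [satisfiesFO_ex_iff, snoc_default_zero]
  refine not_obeysFOZeroOneLaw_of_path hα (T := path5) (by norm_num)
    (by simp [witnessTrees]) (by norm_num) (i₀ := (0 : Fin 5)) (by decide) (by decide)
    (φ := (twoNbrsFormula (0 : Fin 1) ⊓ (leafNbrFormula (0 : Fin 1)).not).ex)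
    (by simp [twoNbrsFormula, leafNbrFormula, privateNbrFormula]) (fun n G f hf => ?_)
    (fun n G hG h => ?_)
  · have hloc := hf.sameLocalType (2 : Fin 5)
    exact (hsat n G).2 ⟨_, hloc.twoNbrs.1 (by decide), mt hloc.leafNbr.2 (by decide)⟩
  · obtain ⟨x, hx, hx'⟩ := (hsat n G).1 h
    exact hx.exists_copy_path5 hG hx'

theorem not_obeysFOZeroOneLaw_six_fifths (hα : (0 : ℝ) < 6 / 5) :
    ¬ ObeysFOZeroOneLaw (powEdgeProb (6 / 5) hα) 3 := by
  have hsat : ∀ (n : ℕ) (G : SimpleGraph (Fin n)),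
      G.SatisfiesFO (twoNbrsFormula (0 : Fin 1) ⊓ ((leafNbrFormula (0 : Fin 1)).not ⊓
        innerSecondNbrFormula (0 : Fin 1))).ex ↔
        ∃ x, G.HasTwoNbrs x ∧ ¬ G.HasLeafNbr x ∧ G.HasInnerSecondNbr x := by
    intro n G
    simp [satisfiesFO_ex_iff, snoc_default_zero]
  refine not_obeysFOZeroOneLaw_of_path hα (T := path6) (by norm_num)
    (by simp [witnessTrees]) (by norm_num) (i₀ := (0 : Fin 6)) (by decide) (by decide)
    (φ := (twoNbrsFormula (0 : Fin 1) ⊓ ((leafNbrFormula (0 : Fin 1)).not ⊓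
        innerSecondNbrFormula (0 : Fin 1))).ex)
    (by simp [twoNbrsFormula, leafNbrFormula, privateNbrFormula, innerSecondNbrFormula,
      commonNbrFormula]) (fun n G f hf => ?_) (fun n G hG h => ?_)
  · have hloc := hf.sameLocalType (2 : Fin 6)
    exact (hsat n G).2 ⟨_, hloc.twoNbrs.1 (by decide), mt hloc.leafNbr.2 (by decide),
      hloc.innerSecondNbr.1 (by decide)⟩
  · obtain ⟨x, hx, hx', hx''⟩ := (hsat n G).1 h
    exact hx.exists_copy_path6 hG hx' hx''

theorem not_obeysFOZeroOneLaw_seven_sixths (hα : (0 : ℝ) < 7 / 6) :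
    ¬ ObeysFOZeroOneLaw (powEdgeProb (7 / 6) hα) 3 := by
  have hsat : ∀ (n : ℕ) (G : SimpleGraph (Fin n)),
      G.SatisfiesFO (twoNbrsFormula (0 : Fin 1) ⊓ ((leafNbrFormula (0 : Fin 1)).not ⊓
        (leafSecondNbrFormula (0 : Fin 1)).not)).ex ↔
        ∃ x, G.HasTwoNbrs x ∧ ¬ G.HasLeafNbr x ∧ ¬ G.HasLeafSecondNbr x := by
    intro n G
    simp [satisfiesFO_ex_iff, snoc_default_zero]
  refine not_obeysFOZeroOneLaw_of_path hα (T := path7) (by norm_num)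
    (by simp [witnessTrees]) (by norm_num) (i₀ := (0 : Fin 7)) (by decide) (by decide)
    (φ := (twoNbrsFormula (0 : Fin 1) ⊓ ((leafNbrFormula (0 : Fin 1)).not ⊓
        (leafSecondNbrFormula (0 : Fin 1)).not)).ex)
    (by simp [twoNbrsFormula, leafNbrFormula, privateNbrFormula, leafSecondNbrFormula,
      commonNbrFormula]) (fun n G f hf => ?_) (fun n G hG h => ?_)
  · have hloc := hf.sameLocalType (3 : Fin 7)
    exact (hsat n G).2 ⟨_, hloc.twoNbrs.1 (by decide), mt hloc.leafNbr.2 (by decide),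
      mt hloc.leafSecondNbr.2 (by decide)⟩
  · obtain ⟨x, hx, hx', hx''⟩ := (hsat n G).1 h
    exact hx.exists_copy_path7 hG hx' hx''

/-! ### Triangles -/

theorem le_graphExp_eventCount_triangle {n : ℕ} (hn : 0 < n) :
    (n.descFactorial 3 : ℝ) / (n : ℝ) ^ 3 * ((n : ℝ) ^ 3 * ((n : ℝ) ^ (-α)) ^ 3) ≤
      graphExp (powEdgeProb α hα n : ℝ)
        (eventCount fun f : Fin 3 → Fin n => IsCopy (⊤ : SimpleGraph (Fin 3)) f) := by
  have hn' : (0 : ℝ) < n := by exact_mod_cast hn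
  refine le_trans (le_of_eq ?_) (le_graphExp_eventCount_of_injective (powEdgeProb α hα n).2
    fun f hf => (graphProb_isCopy hf).ge)
  rw [coe_powEdgeProb, card_edgeFinset_top_three]
  field_simp

theorem isCopy_top_three {V : Type*} {G : SimpleGraph V} {x y z : V} (hxy : G.Adj x y)
    (hxz : G.Adj x z) (hyz : G.Adj y z) : IsCopy (⊤ : SimpleGraph (Fin 3)) ![x, y, z] G := by
  have h : ∀ i j : Fin 3, i ≠ j → G.Adj (![x, y, z] i) (![x, y, z] j) := by
    intro i j hij
    fin_cases i <;> fin_cases j <;> simp_all [adj_comm]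
  exact ⟨fun i j hij => by_contra fun hne => (h i j hne).ne hij, fun i j => h i j⟩

theorem exists_isCopy_top_three_iff {V : Type*} {G : SimpleGraph V} :
    (∃ f : Fin 3 → V, IsCopy (⊤ : SimpleGraph (Fin 3)) f G) ↔
      ∃ x y, G.Adj x y ∧ G.HasCommonNbr x y := by
  constructor
  · rintro ⟨f, hf⟩
    exact ⟨f 0, f 1, hf.2 _ _ (by decide), f 2, hf.2 _ _ (by decide), hf.2 _ _ (by decide)⟩
  · rintro ⟨x, y, hxy, z, hxz, hyz⟩
    exact ⟨![x, y, z], isCopy_top_three hxy hxz hyz⟩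

/-- For `p = 1 / n` the expected number of labelled triangles tends to 1. The sentence is positive
and says just that a triangle exists, so isolation is not needed. -/
theorem not_obeysFOZeroOneLaw_one : ¬ ObeysFOZeroOneLaw (powEdgeProb 1 one_pos) 3 := by
  have hsat : ∀ (n : ℕ) (G : SimpleGraph (Fin n)),
      G.SatisfiesFO (adjFormula (0 : Fin 2) 1 ⊓ commonNbrFormula (0 : Fin 2) 1).ex.ex ↔
        ∃ f : Fin 3 → Fin n, IsCopy (⊤ : SimpleGraph (Fin 3)) f G := by
    intro n G
    rw [satisfiesFO_ex_iff, exists_isCopy_top_three_iff]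
    simp only [sat_ex, sat_inf, sat_adjFormula, sat_commonNbrFormula]
    exact Iff.rfl
  have hcard := card_edgeFinset_top_three
  refine not_obeysFOZeroOneLaw_of_bounds
    (φ := (adjFormula (0 : Fin 2) 1 ⊓ commonNbrFormula (0 : Fin 2) 1).ex.ex)
    -- `108 = 81 + 27` from the second moment of the triangle count, with `n ^ 3 p ^ 3 = 1` and `n ^
    -- 4 p ^ 5 ≤ 1`.
    (by simp [commonNbrFormula]) (c := 1 / 2 / (1 + 108)) (by norm_num) ?_ ?_
  · filter_upwards [(tendsto_descFactorial_div_pow 3).eventually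
      (eventually_ge_nhds (by norm_num : (3 / 4 : ℝ) < 1)), eventually_gt_atTop 0] with n hrn hn
    have hn' : (1 : ℝ) ≤ n := by exact_mod_cast hn
    have hM := natCast_pow_mul_rpow_pow_eq_one (α := 1) (m := 3) (e := 3) (by norm_num) hn
    have h2 := le_graphExp_eventCount_triangle one_pos hn
    have h3 := graphExp_eventCount_triangle_sq_le (n := n) (powEdgeProb 1 one_pos n).2
    have h4 : (n : ℝ) ^ 4 * ((n : ℝ) ^ (-1 : ℝ)) ^ 5 ≤ 1 := by
      rw [natCast_pow_mul_rpow_pow 4 5 hn]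
      exact Real.rpow_le_one_of_one_le_of_nonpos hn' (by norm_num)
    rw [coe_powEdgeProb] at h3
    rw [hM] at h2 h3
    have := le_graphProb_of_second_moment (M := 1) (δ := 108) (powEdgeProb 1 one_pos n).2
      one_pos (by norm_num) h2 (h3.trans (by linarith))
      (A := fun G => ∃ f : Fin 3 → Fin n, IsCopy (⊤ : SimpleGraph (Fin 3)) f G)
      fun G hG => eventCount_eq_zero hG
    rw [graphProb_congr (hsat n)]
    refine le_trans ?_ this
    gcongr
    linarith
  · filter_upwards [eventually_graphProb_exists_isCopy_le_half one_pos (⊤ : SimpleGraph (Fin 3))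
      (by rw [hcard]; norm_num) (i₀ := 0) (by decide) (by decide)] with n hn
    rw [graphProb_congr (hsat n)]
    linarith

end Threshold

end SimpleGraph

namespace SimpleGraph

/-! ### Graphs in which all extensions to a vertex with few neighbours exist -/

section Rich

variable {V W : Type*}

/-- For distinct `x`, `y`, there is a vertex adjacent to `x` but not to `y`, and a vertex adjacent
to neither of them. -/
structure Rich (G : SimpleGraph V) : Prop where
  nontrivial : Nontrivial V
  hasPrivateNbr : ∀ x y, x ≠ y → G.HasPrivateNbr x y
  hasCommonNonNbr : ∀ x y, x ≠ y → G.HasCommonNonNbr x y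

variable {G : SimpleGraph V} {H : SimpleGraph W}

theorem Rich.pairType_eq (hG : Rich G) {x y : V} (h : y ≠ x) :
    G.pairType x y = (G.Adj x y, G.HasCommonNbr x y, True, True, True) := by
  simp [pairType, hG.hasPrivateNbr x y h.symm, hG.hasPrivateNbr y x h,
    hG.hasCommonNonNbr x y h.symm]

theorem Rich.exists_adj (hG : Rich G) (x : V) : ∃ y, G.Adj x y := by
  have := hG.nontrivial
  obtain ⟨y, hy⟩ := exists_ne x
  obtain ⟨z, hz, -⟩ := hG.hasPrivateNbr x y hy.symm
  exact ⟨z, hz⟩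

theorem Rich.exists_not_adj_hasCommonNbr (hG : Rich G) (x : V) :
    ∃ y, y ≠ x ∧ ¬ G.Adj x y ∧ G.HasCommonNbr x y := by
  obtain ⟨m, hm⟩ := hG.exists_adj x
  obtain ⟨z, hz, hxz, hzx⟩ := hG.hasPrivateNbr m x hm.ne'
  exact ⟨z, hzx, hxz, m, hm, hz.symm⟩

/-- Of the four combinations of adjacency and common neighbour, "not adjacent, with a common
neighbour" occurs at every vertex of a rich graph; only the other three need hypotheses. -/
theorem Rich.vertexType_subset (hG : Rich G) (hH : Rich H) {x : V} {y : W}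
    (h1 : (∃ z, z ≠ x ∧ G.Adj x z ∧ G.HasCommonNbr x z) →
      ∃ z, z ≠ y ∧ H.Adj y z ∧ H.HasCommonNbr y z)
    (h2 : (∃ z, z ≠ x ∧ G.Adj x z ∧ ¬ G.HasCommonNbr x z) →
      ∃ z, z ≠ y ∧ H.Adj y z ∧ ¬ H.HasCommonNbr y z)
    (h3 : (∃ z, z ≠ x ∧ ¬ G.Adj x z ∧ ¬ G.HasCommonNbr x z) →
      ∃ z, z ≠ y ∧ ¬ H.Adj y z ∧ ¬ H.HasCommonNbr y z) : G.vertexType x ⊆ H.vertexType y := by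
  rintro _ ⟨z, hz, rfl⟩
  rw [hG.pairType_eq hz]
  by_cases hadj : G.Adj x z <;> by_cases hcom : G.HasCommonNbr x z
  · obtain ⟨w, hw, ha, hc⟩ := h1 ⟨z, hz, hadj, hcom⟩
    exact ⟨w, hw, by rw [hH.pairType_eq hw]; simp [hadj, hcom, ha, hc]⟩
  · obtain ⟨w, hw, ha, hc⟩ := h2 ⟨z, hz, hadj, hcom⟩
    exact ⟨w, hw, by rw [hH.pairType_eq hw]; simp [hadj, hcom, ha, hc]⟩
  · obtain ⟨w, hw, ha, hc⟩ := hH.exists_not_adj_hasCommonNbr y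
    exact ⟨w, hw, by rw [hH.pairType_eq hw]; simp [hadj, hcom, ha, hc]⟩
  · obtain ⟨w, hw, ha, hc⟩ := h3 ⟨z, hz, hadj, hcom⟩
    exact ⟨w, hw, by rw [hH.pairType_eq hw]; simp [hadj, hcom, ha, hc]⟩

theorem Rich.vertexType_eq (hG : Rich G) (hH : Rich H) {x : V} {y : W}
    (h1 : (∃ z, z ≠ x ∧ G.Adj x z ∧ G.HasCommonNbr x z) ↔
      ∃ z, z ≠ y ∧ H.Adj y z ∧ H.HasCommonNbr y z)
    (h2 : (∃ z, z ≠ x ∧ G.Adj x z ∧ ¬ G.HasCommonNbr x z) ↔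
      ∃ z, z ≠ y ∧ H.Adj y z ∧ ¬ H.HasCommonNbr y z)
    (h3 : (∃ z, z ≠ x ∧ ¬ G.Adj x z ∧ ¬ G.HasCommonNbr x z) ↔
      ∃ z, z ≠ y ∧ ¬ H.Adj y z ∧ ¬ H.HasCommonNbr y z) : G.vertexType x = H.vertexType y :=
  (hG.vertexType_subset hH h1.1 h2.1 h3.1).antisymm (hH.vertexType_subset hG h1.2 h2.2 h3.2)

theorem graphType_eq_of_forall_vertexType_eq (hG : Nonempty V) (hH : Nonempty W)
    (h : ∀ x y, G.vertexType x = H.vertexType y) : G.graphType = H.graphType := by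
  obtain ⟨x₀⟩ := hG
  obtain ⟨y₀⟩ := hH
  refine Set.Subset.antisymm ?_ ?_
  · rintro _ ⟨x, rfl⟩
    exact ⟨y₀, (h x y₀).symm⟩
  · rintro _ ⟨y, rfl⟩
    exact ⟨x₀, h x₀ y⟩

theorem Rich.graphType_eq_of_forall_hasCommonNbr (hG : Rich G) (hH : Rich H)
    (hG' : ∀ x y, x ≠ y → G.HasCommonNbr x y) (hH' : ∀ x y, x ≠ y → H.HasCommonNbr x y) :
    G.graphType = H.graphType := by
  have := hG.nontrivial
  have := hH.nontrivial
  refine graphType_eq_of_forall_vertexType_eq inferInstance inferInstance fun x y => ?_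
  refine hG.vertexType_eq hH (iff_of_true ?_ ?_) (iff_of_false ?_ ?_) (iff_of_false ?_ ?_)
  · obtain ⟨z, hz⟩ := hG.exists_adj x
    exact ⟨z, hz.ne', hz, hG' _ _ hz.ne⟩
  · obtain ⟨z, hz⟩ := hH.exists_adj y
    exact ⟨z, hz.ne', hz, hH' _ _ hz.ne⟩
  · exact fun ⟨z, hz, _, h⟩ => h (hG' _ _ hz.symm)
  · exact fun ⟨z, hz, _, h⟩ => h (hH' _ _ hz.symm)
  · exact fun ⟨z, hz, _, h⟩ => h (hG' _ _ hz.symm)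
  · exact fun ⟨z, hz, _, h⟩ => h (hH' _ _ hz.symm)

/-- `x` lies on an edge in no triangle, and has a vertex at distance at least three. -/
def HasSparsePairs (G : SimpleGraph V) (x : V) : Prop :=
  (∃ z, z ≠ x ∧ G.Adj x z ∧ ¬ G.HasCommonNbr x z) ∧
    ∃ z, z ≠ x ∧ ¬ G.Adj x z ∧ ¬ G.HasCommonNbr x z

/-- `x` lies in a triangle. -/
def InTriangle (G : SimpleGraph V) (x : V) : Prop := ∃ z, z ≠ x ∧ G.Adj x z ∧ G.HasCommonNbr x z

theorem Rich.vertexType_eq_of_inTriangle_iff (hG : Rich G) (hH : Rich H) {x : V} {y : W}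
    (hx : G.HasSparsePairs x) (hy : H.HasSparsePairs y) (h : G.InTriangle x ↔ H.InTriangle y) :
    G.vertexType x = H.vertexType y :=
  hG.vertexType_eq hH h (iff_of_true hx.1 hy.1) (iff_of_true hx.2 hy.2)

theorem Rich.graphType_eq_of_forall_inTriangle (hG : Rich G) (hH : Rich H)
    (hG' : ∀ x, G.HasSparsePairs x) (hH' : ∀ y, H.HasSparsePairs y)
    (hGt : ∀ x, G.InTriangle x) (hHt : ∀ y, H.InTriangle y) : G.graphType = H.graphType := by
  have := hG.nontrivial
  have := hH.nontrivial
  exact graphType_eq_of_forall_vertexType_eq inferInstance inferInstance fun x y =>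
    hG.vertexType_eq_of_inTriangle_iff hH (hG' x) (hH' y) (iff_of_true (hGt x) (hHt y))

theorem Rich.graphType_subset (hG : Rich G) (hH : Rich H)
    (hG' : ∀ x, G.HasSparsePairs x) (hH' : ∀ y, H.HasSparsePairs y)
    (hHt : (∃ x, H.InTriangle x) ∧ ∃ x, ¬ H.InTriangle x) : G.graphType ⊆ H.graphType := by
  obtain ⟨⟨y, hy⟩, y', hy'⟩ := hHt
  rintro _ ⟨x, rfl⟩
  by_cases hx : G.InTriangle x
  · exact ⟨y, (hG.vertexType_eq_of_inTriangle_iff hH (hG' x) (hH' y) (iff_of_true hx hy)).symm⟩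
  · exact ⟨y', (hG.vertexType_eq_of_inTriangle_iff hH (hG' x) (hH' y')
      (iff_of_false hx hy')).symm⟩

theorem Rich.graphType_eq_of_exists_inTriangle (hG : Rich G) (hH : Rich H)
    (hG' : ∀ x, G.HasSparsePairs x) (hH' : ∀ y, H.HasSparsePairs y)
    (hGt : (∃ x, G.InTriangle x) ∧ ∃ x, ¬ G.InTriangle x)
    (hHt : (∃ x, H.InTriangle x) ∧ ∃ x, ¬ H.InTriangle x) : G.graphType = H.graphType :=
  (hG.graphType_subset hH hG' hH' hHt).antisymm (hH.graphType_subset hG hH' hG' hGt)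

end Rich

/-! ### Extensions of pairs of vertices in the random graph -/

section Star

variable {n : ℕ} {p : ℝ}

/-- The pairs `{xz, yz}` are disjoint for different `z`, so the `n - 2` events are independent. -/
theorem graphProb_forall_not_of_star {x y : Fin n} (hxy : x ≠ y)
    {A : Fin n → SimpleGraph (Fin n) → Prop} {q : ℝ}
    (hA : ∀ z, z ≠ x → z ≠ y → DependsOnEdges (A z) {s(x, z), s(y, z)})
    (hq : ∀ z, z ≠ x → z ≠ y → graphProb p (A z) = q) :
    graphProb p (fun G => ∀ z, z ≠ x → z ≠ y → ¬ A z G) = (1 - q) ^ (n - 2) := by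
  classical
  set J : Finset (Fin n) := Finset.univ \ {x, y} with hJ
  have hmem : ∀ z, z ∈ J ↔ z ≠ x ∧ z ≠ y := by simp [hJ]
  have hcard : J.card = n - 2 := by
    rw [hJ, Finset.card_sdiff_of_subset (Finset.subset_univ _), Finset.card_pair hxy,
      Finset.card_univ, Fintype.card_fin]
  have h1 := graphProb_forall_mem_not p (J := J) (A := A) (D := fun z => {s(x, z), s(y, z)})
    (fun z hz => hA z ((hmem z).1 hz).1 ((hmem z).1 hz).2) ?_
  · rw [Finset.prod_congr rfl fun z hz => by
      rw [hq z ((hmem z).1 hz).1 ((hmem z).1 hz).2], Finset.prod_const, hcard] at h1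
    rw [← h1]
    exact graphProb_congr fun G => by simp only [hmem, and_imp]
  · intro z hz w hw hzw
    have hz' := (hmem z).1 hz
    have hw' := (hmem w).1 hw
    rw [Function.onFun, Set.disjoint_left]
    rintro e (rfl | rfl) (h | h)
    · exact hzw (Sym2.congr_right.1 h)
    · rcases Sym2.eq_iff.1 h with ⟨h, -⟩ | ⟨h, -⟩
      · exact hxy h
      · exact hw'.1 h.symm
    · rcases Sym2.eq_iff.1 h with ⟨h, -⟩ | ⟨h, -⟩
      · exact hxy h.symm
      · exact hw'.2 h.symm
    · exact hzw (Sym2.congr_right.1 h)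

theorem dependsOnEdges_star {V : Type*} (x y z : V) (F : Prop → Prop → Prop) :
    DependsOnEdges (fun G => F (G.Adj x z) (G.Adj y z)) {s(x, z), s(y, z)} := by
  intro G H h
  have h1 : G.Adj x z = H.Adj x z := propext (h s(x, z) (by simp))
  have h2 : G.Adj y z = H.Adj y z := propext (h s(y, z) (by simp))
  simp only [h1, h2]

theorem star_edges_ne {x y z : Fin n} (hxy : x ≠ y) (hz : z ≠ x) : s(x, z) ≠ s(y, z) := by
  intro h
  rcases Sym2.eq_iff.1 h with ⟨h, -⟩ | ⟨h, -⟩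
  · exact hxy h
  · exact hz h.symm

theorem graphProb_not_hasPrivateNbr_le (hp : p ∈ Set.Icc (0 : ℝ) 1) {x y : Fin n} (hxy : x ≠ y) :
    graphProb p (fun G => ¬ G.HasPrivateNbr x y) ≤ (1 - p * (1 - p)) ^ (n - 2) := by
  rw [← graphProb_forall_not_of_star (p := p) hxy
    (A := fun z G => G.Adj x z ∧ ¬ G.Adj y z)
    (fun z _ _ => dependsOnEdges_star x y z fun a b => a ∧ ¬ b) fun z hzx hzy => ?_]
  · exact graphProb_mono hp fun G hG z hzx hzy h => hG ⟨z, h.1, h.2, hzy⟩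
  · have := graphProb_edges p (F₁ := {s(x, z)}) (F₂ := {s(y, z)}) (by simpa using hzx.symm)
      (by simpa using hzy.symm) (by simpa using star_edges_ne hxy hzx)
    simpa using this

theorem graphProb_not_hasCommonNonNbr_le (hp : p ∈ Set.Icc (0 : ℝ) 1) {x y : Fin n}
    (hxy : x ≠ y) :
    graphProb p (fun G => ¬ G.HasCommonNonNbr x y) ≤ (1 - (1 - p) ^ 2) ^ (n - 2) := by
  rw [← graphProb_forall_not_of_star (p := p) hxy
    (A := fun z G => ¬ G.Adj x z ∧ ¬ G.Adj y z)
    (fun z _ _ => dependsOnEdges_star x y z fun a b => ¬ a ∧ ¬ b) fun z hzx hzy => ?_]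
  · exact graphProb_mono hp fun G hG z hzx hzy h => hG ⟨z, h.1, h.2, hzx, hzy⟩
  · have := graphProb_edges p (F₁ := ∅) (F₂ := {s(x, z), s(y, z)}) (by simp)
      (by simpa using ⟨hzx.symm, hzy.symm⟩) (by simp)
    rw [Finset.card_pair (star_edges_ne hxy hzx)] at this
    simpa using this

theorem graphProb_not_hasCommonNbr_le (hp : p ∈ Set.Icc (0 : ℝ) 1) {x y : Fin n}
    (hxy : x ≠ y) :
    graphProb p (fun G => ¬ G.HasCommonNbr x y) ≤ (1 - p ^ 2) ^ (n - 2) := by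
  rw [← graphProb_forall_not_of_star (p := p) hxy
    (A := fun z G => G.Adj x z ∧ G.Adj y z)
    (fun z _ _ => dependsOnEdges_star x y z fun a b => a ∧ b) fun z hzx hzy => ?_]
  · exact graphProb_mono hp fun G hG z hzx hzy h => hG ⟨z, h.1, h.2⟩
  · have := graphProb_edges p (F₁ := {s(x, z), s(y, z)}) (F₂ := ∅)
      (by simpa using ⟨hzx.symm, hzy.symm⟩) (by simp) (by simp)
    rw [Finset.card_pair (star_edges_ne hxy hzx)] at this
    simpa using this

theorem one_sub_pow_le_exp {q : ℝ} (hq : q ≤ 1) (k : ℕ) : (1 - q) ^ k ≤ Real.exp (-(q * k)) := by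
  have h1 : 1 - q ≤ Real.exp (-q) := by
    have := Real.add_one_le_exp (-q)
    linarith
  calc (1 - q) ^ k ≤ Real.exp (-q) ^ k := pow_le_pow_left₀ (by linarith) h1 k
    _ = _ := by rw [← Real.exp_nat_mul]; congr 1; ring

theorem one_sub_pow_sub_two_le_exp {q c : ℝ} (hq : q ≤ 1) (hc : c ≤ q) (hc0 : 0 ≤ c)
    (hn : 4 ≤ n) : (1 - q) ^ (n - 2) ≤ Real.exp (-(c / 2 * n)) := by
  refine (one_sub_pow_le_exp hq _).trans (Real.exp_le_exp.2 (neg_le_neg ?_))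
  have h1 : (n : ℝ) / 2 ≤ ((n - 2 : ℕ) : ℝ) := by
    rw [Nat.cast_sub (by omega)]
    have : (4 : ℝ) ≤ n := by exact_mod_cast hn
    push_cast
    linarith
  calc c / 2 * n = c * (n / 2) := by ring
    _ ≤ q * ((n - 2 : ℕ) : ℝ) := mul_le_mul hc h1 (by positivity) (hc0.trans hc)

end Star

theorem tendsto_natCast_pow_mul_exp_neg {β c : ℝ} (hβ : 0 < β) (hc : 0 < c) (k : ℕ) :
    Tendsto (fun n : ℕ => (n : ℝ) ^ k * Real.exp (-(c * (n : ℝ) ^ β))) atTop (𝓝 0) := by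
  have h1 := (tendsto_rpow_mul_exp_neg_mul_atTop_nhds_zero (k / β) c hc).comp
    ((tendsto_rpow_atTop hβ).comp tendsto_natCast_atTop_atTop)
  refine h1.congr fun n => ?_
  simp only [Function.comp_apply]
  rw [← Real.rpow_mul n.cast_nonneg, mul_div_cancel₀ _ hβ.ne', Real.rpow_natCast, neg_mul]

section Asymptotics

theorem tendsto_powEdgeProb {α : ℝ} (hα : 0 < α) :
    Tendsto (fun n : ℕ => (n : ℝ) ^ (-α)) atTop (𝓝 0) :=
  (tendsto_rpow_neg_atTop hα).comp tendsto_natCast_atTop_atTop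

variable {α : ℝ} (hα : 0 < α)

theorem natCast_mul_rpow_eq {n : ℕ} (hn : 0 < n) :
    (n : ℝ) * (n : ℝ) ^ (-α) = (n : ℝ) ^ (1 - α) := by
  have hn' : (0 : ℝ) < n := by exact_mod_cast hn
  rw [sub_eq_add_neg, Real.rpow_add hn', Real.rpow_one]

/-- A union bound over `n ^ 2` pairs, beaten by the stretched exponential. -/
theorem aas_forall_ne {A : ∀ n, Fin n → Fin n → SimpleGraph (Fin n) → Prop} {β c : ℝ} (hβ : 0 < β)
    (hc : 0 < c) (h : ∀ᶠ n : ℕ in atTop, ∀ x y : Fin n, x ≠ y →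
      graphProb (powEdgeProb α hα n : ℝ) (fun G => ¬ A n x y G) ≤
        Real.exp (-(c * (n : ℝ) ^ β))) :
    AAS (powEdgeProb α hα) fun n G => ∀ x y, x ≠ y → A n x y G := by
  refine AAS.of_le (h.mono fun n hn => ?_) (tendsto_natCast_pow_mul_exp_neg hβ hc 2)
  have h1 := graphProb_exists_le (p := (powEdgeProb α hα n : ℝ)) (powEdgeProb α hα n).2
    (fun (x : Fin n × Fin n) G => x.1 ≠ x.2 ∧ ¬ A n x.1 x.2 G)
    (b := Real.exp (-(c * (n : ℝ) ^ β))) fun x => by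
      by_cases hx : x.1 = x.2
      · simp only [hx, ne_eq, not_true_eq_false, false_and, graphProb_false]
        positivity
      · exact (graphProb_mono (powEdgeProb α hα n).2 fun G hG => hG.2).trans (hn _ _ hx)
  refine (graphProb_mono (powEdgeProb α hα n).2 fun G hG => ?_).trans (h1.trans (le_of_eq ?_))
  · push Not at hG
    obtain ⟨x, y, hxy, hA⟩ := hG
    exact ⟨(x, y), hxy, hA⟩
  · simp only [Fintype.card_prod, Fintype.card_fin]
    push_cast
    ring

theorem aas_rich (h1 : α < 1) : AAS (powEdgeProb α hα) fun _ G => Rich G := by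
  have hsmall : ∀ᶠ n : ℕ in atTop, (n : ℝ) ^ (-α) ≤ 1 / 2 :=
    (tendsto_powEdgeProb hα).eventually (eventually_le_nhds (by norm_num))
  -- For `p ≤ 1 / 2` both `p (1 - p)` and `(1 - p) ^ 2` are at least `p / 2`, so one exponent serves
  -- for both kinds of extension.
  have hexp : ∀ n : ℕ, 0 < n → (n : ℝ) ^ (-α) / 2 / 2 * n = 1 / 4 * (n : ℝ) ^ (1 - α) := by
    intro n hn
    rw [← natCast_mul_rpow_eq hn]
    ring
  have hpriv : AAS (powEdgeProb α hα) fun _ G => ∀ x y, x ≠ y → G.HasPrivateNbr x y := by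
    refine aas_forall_ne hα (β := 1 - α) (c := 1 / 4) (by linarith) (by norm_num) ?_
    filter_upwards [hsmall, eventually_ge_atTop 4] with n hn hn4 x y hxy
    refine (graphProb_not_hasPrivateNbr_le (powEdgeProb α hα n).2 hxy).trans ?_
    have h0 : 0 ≤ (n : ℝ) ^ (-α) := (powEdgeProb α hα n).2.1
    rw [coe_powEdgeProb, ← hexp n (by omega)]
    exact one_sub_pow_sub_two_le_exp (by nlinarith) (by nlinarith) (by positivity) hn4
  have hnon : AAS (powEdgeProb α hα) fun _ G => ∀ x y, x ≠ y → G.HasCommonNonNbr x y := by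
    refine aas_forall_ne hα (β := 1 - α) (c := 1 / 4) (by linarith) (by norm_num) ?_
    filter_upwards [hsmall, eventually_ge_atTop 4] with n hn hn4 x y hxy
    refine (graphProb_not_hasCommonNonNbr_le (powEdgeProb α hα n).2 hxy).trans ?_
    have h0 : 0 ≤ (n : ℝ) ^ (-α) := (powEdgeProb α hα n).2.1
    rw [coe_powEdgeProb, ← hexp n (by omega)]
    exact one_sub_pow_sub_two_le_exp (by nlinarith) (by nlinarith) (by positivity) hn4
  refine (hpriv.and hnon).mono ?_
  filter_upwards [eventually_ge_atTop 2] with n hn G hG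
  exact ⟨Fin.nontrivial_iff_two_le.2 hn, hG.1, hG.2⟩

theorem obeysFOZeroOneLaw_of_lt_half (h1 : α < 1 / 2) : ObeysFOZeroOneLaw (powEdgeProb α hα) 3 := by
  have hcom : AAS (powEdgeProb α hα) fun _ G => ∀ x y, x ≠ y → G.HasCommonNbr x y := by
    refine aas_forall_ne hα (β := 1 - 2 * α) (c := 1 / 2) (by linarith) (by norm_num) ?_
    filter_upwards [eventually_ge_atTop 4] with n hn4 x y hxy
    refine (graphProb_not_hasCommonNbr_le (powEdgeProb α hα n).2 hxy).trans ?_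
    have h0 : 0 ≤ (n : ℝ) ^ (-α) := (powEdgeProb α hα n).2.1
    have h2 : (n : ℝ) ^ (-α) ≤ 1 := (powEdgeProb α hα n).2.2
    have h3 := natCast_pow_mul_rpow_pow (α := α) 1 2 (n := n) (by omega)
    have h4 : (n : ℝ) ^ (1 - 2 * α) = (n : ℝ) ^ 1 * ((n : ℝ) ^ (-α)) ^ 2 := by
      rw [h3]
      congr 1
      push_cast
      ring
    rw [coe_powEdgeProb, h4, show 1 / 2 * ((n : ℝ) ^ 1 * ((n : ℝ) ^ (-α)) ^ 2) =
      ((n : ℝ) ^ (-α)) ^ 2 / 2 * n by ring]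
    exact one_sub_pow_sub_two_le_exp (by nlinarith) le_rfl (by positivity) hn4
  exact obeysFOZeroOneLaw_of_aas ((aas_rich hα (by linarith)).and hcom) fun _ _ _ _ hG hH =>
    hG.1.graphType_eq_of_forall_hasCommonNbr hH.1 hG.2 hH.2

end Asymptotics

end SimpleGraph

namespace SimpleGraph

/-! ### Conditioning on the neighbourhood of a vertex -/

section Neighbours

variable {n : ℕ} {p : ℝ}

open Classical in
/-- The neighbourhood of a vertex, as a finite set. -/
noncomputable def nbrs (G : SimpleGraph (Fin n)) (x : Fin n) : Finset (Fin n) :=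
  Finset.univ.filter (G.Adj x)

theorem mem_nbrs {G : SimpleGraph (Fin n)} {x y : Fin n} : y ∈ G.nbrs x ↔ G.Adj x y := by
  simp [nbrs]

theorem notMem_nbrs_self (G : SimpleGraph (Fin n)) (x : Fin n) : x ∉ G.nbrs x := by
  simp [mem_nbrs]

theorem dependsOnEdges_nbrs_eq (x : Fin n) (S : Finset (Fin n)) :
    DependsOnEdges (fun G => G.nbrs x = S) {e | x ∈ e} := by
  intro G H h
  have : G.nbrs x = H.nbrs x := by
    ext y
    rw [mem_nbrs, mem_nbrs]
    exact h s(x, y) (by simp)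
  simp only [this]

/-- The law of total probability over the neighbourhood `S` of `x`. That the neighbourhood equals
`S` depends on the edges at `x` only and `B S` on the other edges, so the two are independent. -/
theorem graphProb_nbrs_le (hp : p ∈ Set.Icc (0 : ℝ) 1) (x : Fin n) {R : Finset (Fin n) → Prop}
    {B : Finset (Fin n) → SimpleGraph (Fin n) → Prop} {β : ℝ} (hβ : 0 ≤ β)
    (hdep : ∀ S, x ∉ S → DependsOnEdges (B S) {e | x ∉ e})
    (hB : ∀ S, x ∉ S → R S → graphProb p (B S) ≤ β) :
    graphProb p (fun G => R (G.nbrs x) ∧ B (G.nbrs x) G) ≤ β := by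
  classical
  set J : Finset (Finset (Fin n)) := Finset.univ.filter fun S => x ∉ S ∧ R S with hJ
  have h1 : graphProb p (fun G => R (G.nbrs x) ∧ B (G.nbrs x) G) ≤
      ∑ S ∈ J, graphProb p (fun G => G.nbrs x = S ∧ B S G) :=
    (graphProb_mono hp fun G hG =>
      ⟨G.nbrs x, by simp [hJ, notMem_nbrs_self, hG.1], rfl, hG.2⟩).trans
      (graphProb_exists_mem_le hp J _)
  have h2 : ∑ S ∈ J, graphProb p (fun G => G.nbrs x = S) ≤ 1 := by
    unfold graphProb
    rw [← graphExp_sum]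
    refine (graphExp_mono hp (g := fun _ => 1) fun G => ?_).trans_eq (graphExp_const p 1)
    calc ∑ S ∈ J, @ite ℝ (G.nbrs x = S) (Classical.propDecidable _) 1 0
        = ∑ S ∈ J, if G.nbrs x = S then 1 else 0 := Finset.sum_congr rfl fun S _ => by congr
      _ ≤ 1 := by
        rw [Finset.sum_ite_eq]
        split_ifs <;> norm_num
  calc _ ≤ ∑ S ∈ J, graphProb p (fun G => G.nbrs x = S ∧ B S G) := h1
    _ ≤ ∑ S ∈ J, graphProb p (fun G => G.nbrs x = S) * β := by
      refine Finset.sum_le_sum fun S hS => ?_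
      have hS' : x ∉ S ∧ R S := by simpa [hJ] using hS
      rw [graphProb_and_of_disjoint p (dependsOnEdges_nbrs_eq x S) (hdep S hS'.1)
        (Set.disjoint_left.2 fun e he he' => he' he)]
      exact mul_le_mul_of_nonneg_left (hB S hS'.1 hS'.2) (graphProb_nonneg hp _)
    _ ≤ 1 * β := by
      rw [← Finset.sum_mul]
      exact mul_le_mul_of_nonneg_right h2 hβ
    _ = β := one_mul β

/-- The generating function of the degree, a sum of `n - 1` independent indicators; it feeds the
Chernoff bounds below. -/
theorem graphExp_pow_card_nbrs (p a : ℝ) (x : Fin n) :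
    graphExp p (fun G => a ^ (G.nbrs x).card) = (1 + p * (a - 1)) ^ (n - 1) := by
  classical
  obtain ⟨F, hF⟩ : ∃ F : Prop → ℝ, ∀ P, F P = if P then a else 1 := ⟨_, fun _ => rfl⟩
  have h1 : ∀ G : SimpleGraph (Fin n), a ^ (G.nbrs x).card =
      ∏ v ∈ Finset.univ.erase x, F (s(x, v) ∈ G.edgeSet) := by
    intro G
    simp only [hF, mem_edgeSet]
    rw [Finset.prod_ite, Finset.prod_const, Finset.prod_const_one, mul_one]
    congr 2
    ext v
    simp only [mem_nbrs, Finset.mem_filter, Finset.mem_erase, Finset.mem_univ, and_true]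
    exact ⟨fun h => ⟨h.ne', h⟩, fun h => h.2⟩
  simp only [h1]
  rw [graphExp_prod_of_pairwiseDisjoint p (f := fun v G => F (s(x, v) ∈ G.edgeSet))
    (D := fun v => {s(x, v)}) (fun v _ => dependsOnEdges_singleton _ F)]
  · rw [Finset.prod_congr rfl (g := fun _ => 1 + p * (a - 1)), Finset.prod_const,
      Finset.card_erase_of_mem (Finset.mem_univ _), Finset.card_univ, Fintype.card_fin]
    intro v hv
    rw [graphExp_edge p (by simpa using (Finset.ne_of_mem_erase hv).symm), hF, hF]
    simp only [if_true, if_false]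
    ring
  · intro v _ w _ hvw
    rw [Function.onFun, Set.disjoint_singleton]
    exact fun h => hvw (Sym2.congr_right.1 h)

theorem graphExp_exp_card_nbrs_le (hp : p ∈ Set.Icc (0 : ℝ) 1) (θ : ℝ) (x : Fin n) :
    graphExp p (fun G => Real.exp (θ * (G.nbrs x).card)) ≤
      Real.exp (p * (Real.exp θ - 1) * ((n - 1 : ℕ) : ℝ)) := by
  have h1 := graphExp_pow_card_nbrs p (Real.exp θ) x
  simp only [← Real.exp_nat_mul, mul_comm _ θ] at h1
  rw [h1]
  have h2 := one_sub_pow_le_exp (q := -(p * (Real.exp θ - 1)))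
    (by nlinarith [hp.1, hp.2, Real.exp_pos θ]) (n - 1)
  simpa using h2

theorem graphProb_lt_card_nbrs_le (hp : p ∈ Set.Icc (0 : ℝ) 1) (x : Fin n) :
    graphProb p (fun G => 3 * (n * p) < ((G.nbrs x).card : ℝ)) ≤ Real.exp (-(1 / 8 * (n * p))) := by
  have h1 := mul_graphProb_le_graphExp hp (A := fun G => 3 * (n * p) < ((G.nbrs x).card : ℝ))
    (f := fun G => Real.exp (1 * (G.nbrs x).card)) (c := Real.exp (3 * (n * p)))
    (fun G => (Real.exp_pos _).le) fun G hG => Real.exp_le_exp.2 (by linarith)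
  have h2 := h1.trans (graphExp_exp_card_nbrs_le hp 1 x)
  rw [← le_div_iff₀' (Real.exp_pos _), ← Real.exp_sub] at h2
  refine h2.trans (Real.exp_le_exp.2 ?_)
  -- Since `e - 1 < 2`, the exponent is at most `2 n p - 3 n p`.
  have h3 := Real.exp_one_lt_d9
  have h4 : ((n - 1 : ℕ) : ℝ) ≤ n := by exact_mod_cast Nat.sub_le n 1
  have h5 : p * (Real.exp 1 - 1) * ((n - 1 : ℕ) : ℝ) ≤ p * 2 * n :=
    mul_le_mul (mul_le_mul_of_nonneg_left (by linarith) hp.1) h4 (by positivity)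
      (by linarith [hp.1])
  have h6 : 0 ≤ (n : ℝ) * p := mul_nonneg n.cast_nonneg hp.1
  linarith

theorem graphProb_card_nbrs_lt_le (hp : p ∈ Set.Icc (0 : ℝ) 1) (hn : 4 ≤ n) (x : Fin n) :
    graphProb p (fun G => ((G.nbrs x).card : ℝ) < n * p / 4) ≤ Real.exp (-(1 / 8 * (n * p))) := by
  have h1 := mul_graphProb_le_graphExp hp (A := fun G => ((G.nbrs x).card : ℝ) < n * p / 4)
    (f := fun G => Real.exp (-1 * (G.nbrs x).card)) (c := Real.exp (-(n * p / 4)))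
    (fun G => (Real.exp_pos _).le) fun G hG => Real.exp_le_exp.2 (by linarith)
  have h2 := h1.trans (graphExp_exp_card_nbrs_le hp (-1) x)
  rw [← le_div_iff₀' (Real.exp_pos _), ← Real.exp_sub] at h2
  refine h2.trans (Real.exp_le_exp.2 ?_)
  -- With `1 - 1 / e ≥ 3 / 5` and `n - 1 ≥ 3 n / 4` the exponent is at most `n p / 4 - 9 n p / 20`.
  have h3 : Real.exp (-1) ≤ 2 / 5 := by
    rw [Real.exp_neg, inv_le_comm₀ (Real.exp_pos _) (by norm_num)]
    linarith [Real.exp_one_gt_d9]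
  have hn' : (4 : ℝ) ≤ n := by exact_mod_cast hn
  have h4 : 3 / 4 * (n : ℝ) ≤ ((n - 1 : ℕ) : ℝ) := by
    rw [Nat.cast_sub (by omega)]
    push_cast
    linarith
  have h5 : p * (3 / 5) * (3 / 4 * n) ≤ p * (1 - Real.exp (-1)) * ((n - 1 : ℕ) : ℝ) :=
    mul_le_mul (mul_le_mul_of_nonneg_left (by linarith) hp.1) h4 (by positivity)
      (mul_nonneg hp.1 (by linarith))
  have h6 : 0 ≤ (n : ℝ) * p := mul_nonneg n.cast_nonneg hp.1
  nlinarith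

end Neighbours

/-! ### Adjacencies between two disjoint sets of vertices, and within a set -/

section Bipartite

variable {n : ℕ} {p : ℝ}

theorem graphProb_forall_not_adj (p : ℝ) {y : Fin n} {S : Finset (Fin n)} (hy : y ∉ S) :
    graphProb p (fun G => ∀ z ∈ S, ¬ G.Adj y z) = (1 - p) ^ S.card := by
  have h1 := graphProb_edges p (F₁ := ∅) (F₂ := S.image fun z => s(y, z)) (by simp)
    (by simpa using fun h => hy h) (by simp)
  rw [Finset.card_image_of_injective _ fun a b h => Sym2.congr_right.1 h] at h1
  simpa using h1

theorem dependsOnEdges_adj_finset {β : Type*} (y : Fin n) (S : Finset (Fin n)) (F : Prop → β) :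
    DependsOnEdges (fun G => F (∀ z ∈ S, ¬ G.Adj y z)) {e | ∃ z ∈ S, e = s(y, z)} := by
  intro G H h
  have : (∀ z ∈ S, ¬ G.Adj y z) = ∀ z ∈ S, ¬ H.Adj y z :=
    propext (forall₂_congr fun z hz => not_congr (h s(y, z) ⟨z, hz, rfl⟩))
  simp only [this]

theorem pairwiseDisjoint_edges {T S : Finset (Fin n)} (hTS : Disjoint T S) :
    (T : Set (Fin n)).PairwiseDisjoint fun y => {e | ∃ z ∈ S, e = s(y, z)} := by
  intro y hy y' hy' hne
  rw [Function.onFun, Set.disjoint_left]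
  rintro _ ⟨z, hz, rfl⟩ ⟨z', hz', h⟩
  rcases Sym2.eq_iff.1 h with ⟨h, -⟩ | ⟨h, -⟩
  · exact hne h
  · exact Finset.disjoint_left.1 hTS hy (h ▸ hz')

theorem graphProb_forall_exists_adj (p : ℝ) {T S : Finset (Fin n)} (hTS : Disjoint T S) :
    graphProb p (fun G => ∀ y ∈ T, ∃ z ∈ S, G.Adj y z) = (1 - (1 - p) ^ S.card) ^ T.card := by
  have h1 := graphProb_forall_mem_not p (J := T) (A := fun y G => ∀ z ∈ S, ¬ G.Adj y z)
    (fun y _ => dependsOnEdges_adj_finset y S id) (pairwiseDisjoint_edges hTS)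
  rw [Finset.prod_congr rfl fun y hy => by
    rw [graphProb_forall_not_adj p (Finset.disjoint_left.1 hTS hy)], Finset.prod_const] at h1
  rw [← h1]
  exact graphProb_congr fun G => by push Not; rfl

/-- The pairs of distinct elements of `S`. -/
def pairs (S : Finset (Fin n)) : Finset (Sym2 (Fin n)) := S.sym2.filter fun e => ¬ e.IsDiag

theorem mk_mem_pairs {S : Finset (Fin n)} {y z : Fin n} :
    s(y, z) ∈ pairs S ↔ (y ∈ S ∧ z ∈ S) ∧ y ≠ z := by
  simp [pairs]

theorem card_pairs (S : Finset (Fin n)) : (pairs S).card = S.card.choose 2 := by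
  rw [← Sym2.card_image_offDiag]
  congr 1
  ext e
  induction e with | _ y z => ?_
  rw [mk_mem_pairs]
  simp only [Finset.mem_image, Finset.mem_offDiag, Prod.exists, Function.uncurry]
  constructor
  · rintro ⟨⟨h1, h2⟩, h3⟩
    exact ⟨y, z, ⟨h1, h2, h3⟩, rfl⟩
  · rintro ⟨a, b, ⟨h1, h2, h3⟩, h⟩
    rcases Sym2.eq_iff.1 h with ⟨rfl, rfl⟩ | ⟨rfl, rfl⟩
    · exact ⟨⟨h1, h2⟩, h3⟩
    · exact ⟨⟨h2, h1⟩, h3.symm⟩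

theorem graphProb_pairs_notMem (p : ℝ) (S : Finset (Fin n)) :
    graphProb p (fun G => ∀ e ∈ pairs S, e ∉ G.edgeSet) = (1 - p) ^ S.card.choose 2 := by
  have h1 := graphProb_edges p (F₁ := ∅) (F₂ := pairs S) (by simp)
    (fun e he => (Finset.mem_filter.1 he).2) (by simp)
  rw [card_pairs] at h1
  simpa using h1

/-- A bound for the probability that every vertex of `T` has a neighbour in `T ∪ R`. The proof
compares the event with the expectation of a weight with independent factors. -/
theorem graphProb_forall_exists_adj_union_le (hp : p ∈ Set.Icc (0 : ℝ) 1) {T R : Finset (Fin n)}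
    (hTR : Disjoint T R) :
    graphProb p (fun G => ∀ y ∈ T, ∃ z, (z ∈ T ∨ z ∈ R) ∧ G.Adj y z) ≤
      (1 - (1 - p) ^ R.card / 2) ^ T.card * (1 + 3 * p) ^ T.card.choose 2 := by
  classical
  -- The weight has a factor 1/2 for each vertex of `T` without neighbour in `R` and a factor 4 for
  -- each edge inside `T`. On the event, every vertex of the first kind is an end of such an edge,
  -- so the weight is at least 1.
  obtain ⟨f, hf⟩ : ∃ f : Prop → ℝ, ∀ P, f P = if P then 1 / 2 else 1 := ⟨_, fun _ => rfl⟩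
  obtain ⟨g, hg⟩ : ∃ g : Prop → ℝ, ∀ P, g P = if P then 4 else 1 := ⟨_, fun _ => rfl⟩
  have hf1 : graphExp p (fun G => ∏ y ∈ T, f (∀ z ∈ R, ¬ G.Adj y z)) =
      (1 - (1 - p) ^ R.card / 2) ^ T.card := by
    rw [graphExp_prod_of_pairwiseDisjoint p (fun y _ => dependsOnEdges_adj_finset y R f)
      (pairwiseDisjoint_edges hTR)]
    refine Finset.prod_eq_pow_card fun y hy => ?_
    rw [← graphProb_forall_not_adj p (Finset.disjoint_left.1 hTR hy)]
    have h1 : ∀ G : SimpleGraph (Fin n), f (∀ z ∈ R, ¬ G.Adj y z) =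
        1 - 1 / 2 * @ite ℝ (∀ z ∈ R, ¬ G.Adj y z) (Classical.propDecidable _) 1 0 := by
      intro G
      rw [hf]
      split_ifs <;> norm_num
    simp only [h1]
    rw [graphExp_sub, graphExp_const, graphExp_mul_left, graphProb]
    ring
  have hg1 : graphExp p (fun G => ∏ e ∈ pairs T, g (e ∈ G.edgeSet)) =
      (1 + 3 * p) ^ T.card.choose 2 := by
    rw [graphExp_prod_of_pairwiseDisjoint p (f := fun e G => g (e ∈ G.edgeSet))
      (D := fun e => {e}) (fun e _ => dependsOnEdges_singleton e g) (by
        intro a _ b _ hab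
        simpa using hab), ← card_pairs]
    refine Finset.prod_eq_pow_card fun e he => ?_
    rw [graphExp_edge p (Finset.mem_filter.1 he).2, hg, hg]
    simp only [if_true, if_false]
    ring
  rw [← hf1, ← hg1, ← graphExp_mul_of_disjoint p
    (DependsOnEdges.prod fun y _ => dependsOnEdges_adj_finset y R f)
    (DependsOnEdges.prod (f := fun e G => g (e ∈ G.edgeSet)) (D := fun e => {e})
      fun e _ => dependsOnEdges_singleton e g), ← one_mul (graphProb p _)]
  · refine mul_graphProb_le_graphExp hp (fun G => ?_) fun G hG => ?_
    · refine mul_nonneg (Finset.prod_nonneg fun y _ => ?_) (Finset.prod_nonneg fun y _ => ?_)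
      · rw [hf]; split_ifs <;> norm_num
      · rw [hg]; split_ifs <;> norm_num
    · have hf2 : ∏ y ∈ T, f (∀ z ∈ R, ¬ G.Adj y z) =
          ∏ y ∈ T, if ∀ z ∈ R, ¬ G.Adj y z then 1 / 2 else 1 :=
        Finset.prod_congr rfl fun y _ => by rw [hf]; congr
      have hg2 : ∏ e ∈ pairs T, g (e ∈ G.edgeSet) = ∏ e ∈ pairs T, if e ∈ G.edgeSet then 4 else 1 :=
        Finset.prod_congr rfl fun y _ => by rw [hg]; congr
      rw [hf2, hg2, Finset.prod_ite, Finset.prod_ite, Finset.prod_const, Finset.prod_const,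
        Finset.prod_const_one, Finset.prod_const, one_pow, mul_one, mul_one]
      set Q := T.filter fun y => ∀ z ∈ R, ¬ G.Adj y z with hQ
      set E := (pairs T).filter fun e => e ∈ G.edgeSet with hE
      have h1 : Q.card ≤ E.card * 2 := by
        refine (Finset.card_le_card (t := E.biUnion Sym2.toFinset) fun y hy => ?_).trans
          (Finset.card_biUnion_le_card_mul _ _ _ fun e he => ?_)
        · obtain ⟨hyT, hyR⟩ := Finset.mem_filter.1 hy
          obtain ⟨z, hz | hz, hyz⟩ := hG y hyT
          · refine Finset.mem_biUnion.2 ⟨s(y, z), ?_, by simp⟩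
            simp [hE, mk_mem_pairs, hyT, hz, hyz, hyz.ne]
          · exact absurd hyz (hyR z hz)
        · rw [Sym2.card_toFinset]
          split_ifs <;> norm_num
      calc (1 : ℝ) = (1 / 2) ^ (E.card * 2) * 4 ^ E.card := by
            rw [mul_comm E.card, pow_mul, ← mul_pow]; norm_num
        _ ≤ (1 / 2) ^ Q.card * 4 ^ E.card :=
          mul_le_mul_of_nonneg_right
            (pow_le_pow_of_le_one (by norm_num) (by norm_num) h1) (by positivity)
  · simp only [Set.disjoint_iUnion_right, Set.disjoint_iUnion_left]
    intro e he y hy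
    rw [Set.disjoint_singleton_right]
    rintro ⟨z, hz, rfl⟩
    exact Finset.disjoint_left.1 hTR (mk_mem_pairs.1 he).1.2 hz

end Bipartite

end SimpleGraph

namespace SimpleGraph

/-! ### Non-extensions of a vertex -/

section Bounds

variable {n : ℕ} {p : ℝ}

theorem exp_neg_two_mul_le_one_sub (h0 : 0 ≤ p) (h : p ≤ 1 / 2) : Real.exp (-(2 * p)) ≤ 1 - p := by
  have h1 := Real.add_one_le_exp (2 * p)
  rw [Real.exp_neg, inv_le_comm₀ (Real.exp_pos _) (by linarith)]
  refine le_trans ?_ h1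
  rw [inv_le_iff_one_le_mul₀ (by linarith)]
  nlinarith

theorem exp_neg_six_le_one_sub_pow (h0 : 0 ≤ p) (h : p ≤ 1 / 2) {s : ℕ} (hs : (s : ℝ) * p ≤ 3) :
    Real.exp (-6) ≤ (1 - p) ^ s := by
  -- `1 - p ≥ exp (-2 p)` and `s p ≤ 3` give the exponent 6.
  refine le_trans ?_ (pow_le_pow_left₀ (Real.exp_pos _).le (exp_neg_two_mul_le_one_sub h0 h) s)
  rw [← Real.exp_nat_mul]
  exact Real.exp_le_exp.2 (by nlinarith)

theorem graphProb_forall_exists_adj_le (hp : p ∈ Set.Icc (0 : ℝ) 1) (hp2 : p ≤ 1 / 2)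
    {T S : Finset (Fin n)} (hTS : Disjoint T S) (hS : (S.card : ℝ) * p ≤ 3) :
    graphProb p (fun G => ∀ y ∈ T, ∃ z ∈ S, G.Adj y z) ≤ Real.exp (-(Real.exp (-6) * T.card)) := by
  rw [graphProb_forall_exists_adj p hTS]
  have h1 := exp_neg_six_le_one_sub_pow hp.1 hp2 hS
  have h2 : (1 - p) ^ S.card ≤ 1 := pow_le_one₀ (by linarith [hp.2]) (by linarith [hp.1])
  refine (one_sub_pow_le_exp h2 _).trans (Real.exp_le_exp.2 (neg_le_neg ?_))
  exact mul_le_mul_of_nonneg_right h1 (Nat.cast_nonneg _)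

/-- Only the vertices of a subset `T` of size `t` are examined, with `R = S \ T`. The first factor
contributes at most `exp (-(e⁻⁶ t / 2))`. The edges inside `T` cost at most `exp (3 p t² / 2)`, and
`t p ≤ e⁻⁶ / 6` makes this at most `exp (e⁻⁶ t / 4)`. -/
theorem graphProb_forall_exists_adj_self_le (hp : p ∈ Set.Icc (0 : ℝ) 1) (hp2 : p ≤ 1 / 2)
    {S : Finset (Fin n)} (hS : (S.card : ℝ) * p ≤ 3) {t : ℕ} (htS : t ≤ S.card)
    (ht : (t : ℝ) * p ≤ Real.exp (-6) / 6) :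
    graphProb p (fun G => ∀ y ∈ S, ∃ z ∈ S, G.Adj y z) ≤
      Real.exp (-(Real.exp (-6) / 4 * t)) := by
  classical
  obtain ⟨T, hTS, rfl⟩ := Finset.exists_subset_card_eq htS
  have h0 := graphProb_forall_exists_adj_union_le hp (T := T) (R := S \ T) Finset.disjoint_sdiff
  have h1 : graphProb p (fun G => ∀ y ∈ S, ∃ z ∈ S, G.Adj y z) ≤
      graphProb p (fun G => ∀ y ∈ T, ∃ z, (z ∈ T ∨ z ∈ S \ T) ∧ G.Adj y z) := by
    refine graphProb_mono hp fun G hG y hy => ?_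
    obtain ⟨z, hz, hyz⟩ := hG y (hTS hy)
    exact ⟨z, by by_cases h : z ∈ T <;> simp [h, hz], hyz⟩
  refine (h1.trans h0).trans ?_
  have hR : ((S \ T).card : ℝ) * p ≤ 3 :=
    (mul_le_mul_of_nonneg_right (by exact_mod_cast Finset.card_le_card Finset.sdiff_subset)
      hp.1).trans hS
  have h2 := exp_neg_six_le_one_sub_pow hp.1 hp2 hR
  have h3 : (1 - p) ^ (S \ T).card ≤ 1 := pow_le_one₀ (by linarith [hp.2]) (by linarith [hp.1])
  have h4 := one_sub_pow_le_exp (q := (1 - p) ^ (S \ T).card / 2) (by linarith) T.card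
  have h5 := one_sub_pow_le_exp (q := -(3 * p)) (by linarith [hp.1]) (T.card.choose 2)
  rw [sub_neg_eq_add] at h5
  refine (mul_le_mul h4 h5 (by have := hp.1; positivity) (Real.exp_pos _).le).trans ?_
  rw [← Real.exp_add]
  refine Real.exp_le_exp.2 ?_
  have h6 : ((T.card.choose 2 : ℕ) : ℝ) ≤ T.card * T.card / 2 := by
    rw [Nat.cast_choose_two]
    nlinarith [(Nat.cast_nonneg T.card : (0 : ℝ) ≤ T.card)]
  have h7 : 3 * p * ((T.card.choose 2 : ℕ) : ℝ) ≤ 3 * p * (T.card * T.card / 2) :=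
    mul_le_mul_of_nonneg_left h6 (by linarith [hp.1])
  have h8 : (T.card : ℝ) * (T.card * p) ≤ T.card * (Real.exp (-6) / 6) :=
    mul_le_mul_of_nonneg_left ht (Nat.cast_nonneg _)
  have h9 : Real.exp (-6) * T.card ≤ (1 - p) ^ (S \ T).card * T.card :=
    mul_le_mul_of_nonneg_right h2 (Nat.cast_nonneg _)
  linarith

theorem graphProb_forall_not_adj_self_le (hp : p ∈ Set.Icc (0 : ℝ) 1) {S : Finset (Fin n)}
    (hS2 : 2 ≤ S.card) :
    graphProb p (fun G => ∀ y ∈ S, ∀ z ∈ S, ¬ G.Adj y z) ≤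
      Real.exp (-(p * ((S.card : ℝ) ^ 2 / 4))) := by
  have h1 : graphProb p (fun G => ∀ y ∈ S, ∀ z ∈ S, ¬ G.Adj y z) ≤
      graphProb p (fun G => ∀ e ∈ pairs S, e ∉ G.edgeSet) := by
    refine graphProb_mono hp fun G hG e he => ?_
    induction e with | _ y z => ?_
    have := mk_mem_pairs.1 he
    exact hG y this.1.1 z this.1.2
  rw [graphProb_pairs_notMem] at h1
  refine (h1.trans (one_sub_pow_le_exp hp.2 _)).trans (Real.exp_le_exp.2 (neg_le_neg ?_))
  refine mul_le_mul_of_nonneg_left ?_ hp.1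
  rw [Nat.cast_choose_two]
  have : (2 : ℝ) ≤ S.card := by exact_mod_cast hS2
  nlinarith

theorem dependsOnEdges_notMem {x : Fin n} {B : SimpleGraph (Fin n) → Prop}
    (h : ∀ G H : SimpleGraph (Fin n), (∀ y z, y ≠ x → z ≠ x → (G.Adj y z ↔ H.Adj y z)) →
      (B G → B H)) : DependsOnEdges B {e | x ∉ e} := by
  intro G H hGH
  have h1 : ∀ y z, y ≠ x → z ≠ x → (G.Adj y z ↔ H.Adj y z) := fun y z hy hz =>
    hGH s(y, z) (by simpa using ⟨hy.symm, hz.symm⟩)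
  exact propext ⟨h G H h1, h H G fun y z hy hz => (h1 y z hy hz).symm⟩

/-- The degree of a vertex is close to its expected value, up to constant factors. -/
def IsTypicalDegree (n : ℕ) (p : ℝ) (S : Finset (Fin n)) : Prop :=
  n * p / 4 ≤ (S.card : ℝ) ∧ (S.card : ℝ) ≤ 3 * (n * p)

theorem graphProb_not_isTypicalDegree_le (hp : p ∈ Set.Icc (0 : ℝ) 1) (hn : 4 ≤ n) (x : Fin n) :
    graphProb p (fun G => ¬ IsTypicalDegree n p (G.nbrs x)) ≤
      2 * Real.exp (-(1 / 8 * (n * p))) := by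
  have h1 := graphProb_or_le hp (fun G => ((G.nbrs x).card : ℝ) < n * p / 4)
    (fun G => 3 * (n * p) < ((G.nbrs x).card : ℝ))
  rw [graphProb_congr (B := fun G => ((G.nbrs x).card : ℝ) < n * p / 4 ∨
    3 * (n * p) < ((G.nbrs x).card : ℝ)) fun G => by
      rw [IsTypicalDegree, not_and_or]; push Not; rfl]
  linarith [graphProb_card_nbrs_lt_le hp hn x, graphProb_lt_card_nbrs_le hp x]

/-- Given the neighbourhood `S` of `x`, failure means that all vertices outside `S` other than `x`,
or all vertices of `S`, have a neighbour in `S`. As `n p² ≤ 1`, a set of typical size has `|S| p ≤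
3`, so each vertex misses `S` with probability bounded below. -/
theorem graphProb_not_hasSparsePairs_le (hp : p ∈ Set.Icc (0 : ℝ) 1) (hn : 4 ≤ n)
    (hp12 : p ≤ 1 / 12) (hnp2 : n * p ^ 2 ≤ 1) (hnp : 2 ≤ Real.exp (-6) / 6 * (n * p))
    (x : Fin n) :
    graphProb p (fun G => ¬ G.HasSparsePairs x) ≤
      4 * Real.exp (-(Real.exp (-6) ^ 2 / 48 * (n * p))) := by
  set c := Real.exp (-6) with hc
  have hc0 : 0 < c := Real.exp_pos _
  have hc1 : c ≤ 1 := Real.exp_le_one_iff.2 (by norm_num)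
  have hn' : (4 : ℝ) ≤ n := by exact_mod_cast hn
  have hp0 := hp.1
  have hnp0 : 0 ≤ (n : ℝ) * p := by positivity
  have hnpn : (n : ℝ) * p ≤ n / 12 := by nlinarith
  have hSp : ∀ S : Finset (Fin n), IsTypicalDegree n p S → (S.card : ℝ) * p ≤ 3 := fun S hS => by
    have := mul_le_mul_of_nonneg_right hS.2 hp0
    nlinarith
  have h1 : graphProb p (fun G => IsTypicalDegree n p (G.nbrs x) ∧
      ∀ y ∈ Finset.univ \ insert x (G.nbrs x), ∃ z ∈ G.nbrs x, G.Adj y z) ≤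
      Real.exp (-(c ^ 2 / 48 * (n * p))) := by
    refine graphProb_nbrs_le hp x (B := fun S G =>
      ∀ y ∈ Finset.univ \ insert x S, ∃ z ∈ S, G.Adj y z) (Real.exp_pos _).le
      (fun S hxS => dependsOnEdges_notMem fun G H hGH hG y hy => ?_) fun S hxS hS => ?_
    · obtain ⟨z, hz, hyz⟩ := hG y hy
      simp only [Finset.mem_sdiff, Finset.mem_univ, Finset.mem_insert, not_or, true_and] at hy
      exact ⟨z, hz, (hGH y z hy.1 (ne_of_mem_of_not_mem hz hxS)).1 hyz⟩
    · refine (graphProb_forall_exists_adj_le hp (by linarith) ?_ (hSp S hS)).trans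
        (Real.exp_le_exp.2 (neg_le_neg ?_))
      · exact Finset.disjoint_left.2 fun y hy hyS => by simp [hyS] at hy
      · rw [Finset.card_sdiff_of_subset (Finset.subset_univ _), Finset.card_insert_of_notMem hxS,
          Finset.card_univ, Fintype.card_fin]
        have h2 : ((n : ℝ) - (S.card + 1 : ℕ)) ≤ ((n - (S.card + 1) : ℕ) : ℝ) := by
          rw [sub_le_iff_le_add]
          exact_mod_cast le_tsub_add
        push_cast at h2
        have h3 : (n : ℝ) / 48 ≤ ((n - (S.card + 1) : ℕ) : ℝ) := by linarith [hS.2]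
        have h4 : c ^ 2 * (n * p) ≤ c * n := by
          have : c * p ≤ 1 := by nlinarith
          nlinarith [mul_nonneg hc0.le (n.cast_nonneg : (0 : ℝ) ≤ n)]
        nlinarith
  have h2 : graphProb p (fun G => IsTypicalDegree n p (G.nbrs x) ∧
      ∀ y ∈ G.nbrs x, ∃ z ∈ G.nbrs x, G.Adj y z) ≤ Real.exp (-(c ^ 2 / 48 * (n * p))) := by
    refine graphProb_nbrs_le hp x (B := fun S G => ∀ y ∈ S, ∃ z ∈ S, G.Adj y z) (Real.exp_pos _).le
      (fun S hxS => dependsOnEdges_notMem fun G H hGH hG y hy => ?_) fun S hxS hS => ?_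
    · obtain ⟨z, hz, hyz⟩ := hG y hy
      exact ⟨z, hz, (hGH y z (ne_of_mem_of_not_mem hy hxS) (ne_of_mem_of_not_mem hz hxS)).1 hyz⟩
    -- This size for the examined subset makes `t p ≤ c / 6` by `n p² ≤ 1`. By `hnp`, rounding down
    -- loses at most half, which yields the constant `c² / 48`.
    · have ht1 : ((⌊c / 6 * (n * p)⌋₊ : ℕ) : ℝ) ≤ c / 6 * (n * p) := Nat.floor_le (by positivity)
      have ht2 : c / 6 * (n * p) < (⌊c / 6 * (n * p)⌋₊ : ℕ) + 1 := Nat.lt_floor_add_one _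
      refine (graphProb_forall_exists_adj_self_le hp (by linarith) (hSp S hS)
        (t := ⌊c / 6 * (n * p)⌋₊) ?_ ?_).trans (Real.exp_le_exp.2 (neg_le_neg ?_))
      · have h3 : ((⌊c / 6 * (n * p)⌋₊ : ℕ) : ℝ) ≤ S.card := by
          have := hS.1
          nlinarith
        exact_mod_cast h3
      · calc _ ≤ c / 6 * (n * p) * p := mul_le_mul_of_nonneg_right ht1 hp0
          _ = c / 6 * (n * p ^ 2) := by ring
          _ ≤ c / 6 * 1 := mul_le_mul_of_nonneg_left hnp2 (by positivity)
          _ = c / 6 := mul_one _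
      · have h3 : c / 6 * (n * p) / 2 ≤ (⌊c / 6 * (n * p)⌋₊ : ℕ) := by linarith
        calc c ^ 2 / 48 * (n * p) = c / 4 * (c / 6 * (n * p) / 2) := by ring
          _ ≤ _ := mul_le_mul_of_nonneg_left h3 (by positivity)
  have h3 : Real.exp (-(1 / 8 * (n * p))) ≤ Real.exp (-(c ^ 2 / 48 * (n * p))) := by
    refine Real.exp_le_exp.2 (neg_le_neg (mul_le_mul_of_nonneg_right ?_ hnp0))
    nlinarith
  have h4 : graphProb p (fun G => ¬ G.HasSparsePairs x) ≤ graphProb p (fun G =>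
      ¬ IsTypicalDegree n p (G.nbrs x) ∨ ((IsTypicalDegree n p (G.nbrs x) ∧
        ∀ y ∈ Finset.univ \ insert x (G.nbrs x), ∃ z ∈ G.nbrs x, G.Adj y z) ∨
      (IsTypicalDegree n p (G.nbrs x) ∧ ∀ y ∈ G.nbrs x, ∃ z ∈ G.nbrs x, G.Adj y z))) := by
    refine graphProb_mono hp fun G hG => ?_
    by_cases hS : IsTypicalDegree n p (G.nbrs x)
    · refine Or.inr ((not_and_or.1 hG).symm.imp (fun h => ⟨hS, fun y hy => ?_⟩)
        fun h => ⟨hS, fun y hy => ?_⟩)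
      · simp only [Finset.mem_sdiff, Finset.mem_univ, Finset.mem_insert, not_or, true_and,
          mem_nbrs] at hy
        by_contra hcon
        exact h ⟨y, hy.1, hy.2, fun ⟨z, hz, hyz⟩ => hcon ⟨z, mem_nbrs.2 hz, hyz⟩⟩
      · rw [mem_nbrs] at hy
        by_contra hcon
        exact h ⟨y, hy.ne', hy, fun ⟨z, hz, hyz⟩ => hcon ⟨z, mem_nbrs.2 hz, hyz⟩⟩
    · exact Or.inl hS
  have h5 := graphProb_or_le hp (fun G => ¬ IsTypicalDegree n p (G.nbrs x)) (fun G =>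
    (IsTypicalDegree n p (G.nbrs x) ∧
        ∀ y ∈ Finset.univ \ insert x (G.nbrs x), ∃ z ∈ G.nbrs x, G.Adj y z) ∨
      (IsTypicalDegree n p (G.nbrs x) ∧ ∀ y ∈ G.nbrs x, ∃ z ∈ G.nbrs x, G.Adj y z))
  have h6 := graphProb_or_le hp (fun G => IsTypicalDegree n p (G.nbrs x) ∧
        ∀ y ∈ Finset.univ \ insert x (G.nbrs x), ∃ z ∈ G.nbrs x, G.Adj y z)
    (fun G => IsTypicalDegree n p (G.nbrs x) ∧ ∀ y ∈ G.nbrs x, ∃ z ∈ G.nbrs x, G.Adj y z)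
  linarith [graphProb_not_isTypicalDegree_le hp hn x]

/-- Otherwise the neighbourhood is an independent set. It has at least `n p / 4` vertices unless the
degree is atypical, and this size gives the exponent `p (n p / 4)² / 4`. -/
theorem graphProb_not_inTriangle_le (hp : p ∈ Set.Icc (0 : ℝ) 1) (hn : 4 ≤ n)
    (hnp : 8 ≤ n * p) (x : Fin n) :
    graphProb p (fun G => ¬ G.InTriangle x) ≤
      2 * Real.exp (-(1 / 8 * (n * p))) + Real.exp (-(1 / 64 * (n ^ 2 * p ^ 3))) := by
  have hp0 := hp.1
  have h1 : graphProb p (fun G => IsTypicalDegree n p (G.nbrs x) ∧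
      ∀ y ∈ G.nbrs x, ∀ z ∈ G.nbrs x, ¬ G.Adj y z) ≤ Real.exp (-(1 / 64 * (n ^ 2 * p ^ 3))) := by
    refine graphProb_nbrs_le hp x (B := fun S G => ∀ y ∈ S, ∀ z ∈ S, ¬ G.Adj y z)
      (Real.exp_pos _).le
      (fun S hxS => dependsOnEdges_notMem fun G H hGH hG y hy z hz => ?_) fun S hxS hS => ?_
    · rw [← hGH y z (ne_of_mem_of_not_mem hy hxS) (ne_of_mem_of_not_mem hz hxS)]
      exact hG y hy z hz
    · have h2 : (2 : ℝ) ≤ S.card := by linarith [hS.1]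
      refine (graphProb_forall_not_adj_self_le hp (by exact_mod_cast h2)).trans
        (Real.exp_le_exp.2 (neg_le_neg ?_))
      have h3 : (n * p / 4) ^ 2 ≤ (S.card : ℝ) ^ 2 := pow_le_pow_left₀ (by positivity) hS.1 2
      calc (1 : ℝ) / 64 * (n ^ 2 * p ^ 3) = p * ((n * p / 4) ^ 2 / 4) := by ring
        _ ≤ p * ((S.card : ℝ) ^ 2 / 4) := by gcongr
  have h2 : graphProb p (fun G => ¬ G.InTriangle x) ≤ graphProb p (fun G =>
      ¬ IsTypicalDegree n p (G.nbrs x) ∨ (IsTypicalDegree n p (G.nbrs x) ∧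
      ∀ y ∈ G.nbrs x, ∀ z ∈ G.nbrs x, ¬ G.Adj y z)) := by
    refine graphProb_mono hp fun G hG => ?_
    by_cases hS : IsTypicalDegree n p (G.nbrs x)
    · refine Or.inr ⟨hS, fun y hy z hz hyz => hG ?_⟩
      rw [mem_nbrs] at hy hz
      exact ⟨y, hy.ne', hy, z, hz, hyz⟩
    · exact Or.inl hS
  have h3 := graphProb_or_le hp (fun G => ¬ IsTypicalDegree n p (G.nbrs x)) (fun G =>
    IsTypicalDegree n p (G.nbrs x) ∧ ∀ y ∈ G.nbrs x, ∀ z ∈ G.nbrs x, ¬ G.Adj y z)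
  linarith [graphProb_not_isTypicalDegree_le hp hn x]

end Bounds

end SimpleGraph

namespace SimpleGraph

/-! ### Triangles -/

section Triangles

theorem exists_inTriangle_of_isCopy {V : Type*} {G : SimpleGraph V} {f : Fin 3 → V}
    (hf : IsCopy (⊤ : SimpleGraph (Fin 3)) f G) : ∃ x, G.InTriangle x :=
  ⟨f 0, f 1, (hf.2 0 1 (by decide)).ne', hf.2 0 1 (by decide), f 2, hf.2 0 2 (by decide),
    hf.2 1 2 (by decide)⟩

/-- Each vertex starts at least two labelled triangles, in opposite orientations. -/
theorem two_mul_le_eventCount_triangle {n : ℕ} {G : SimpleGraph (Fin n)}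
    (hG : ∀ x, G.InTriangle x) : 2 * (n : ℝ) ≤
      eventCount (fun f : Fin 3 → Fin n => IsCopy (⊤ : SimpleGraph (Fin 3)) f) G := by
  choose y _ hxy z hxz hyz using hG
  rw [eventCount_eq_card]
  have h1 : Nat.card (Fin n × Bool) ≤
      Nat.card {f : Fin 3 → Fin n // IsCopy (⊤ : SimpleGraph (Fin 3)) f G} := by
    refine Nat.card_le_card_of_injective (fun x => match x with
      | (x, true) => ⟨![x, y x, z x], isCopy_top_three (hxy x) (hxz x) (hyz x)⟩
      | (x, false) => ⟨![x, z x, y x], isCopy_top_three (hxz x) (hxy x) (hyz x).symm⟩) ?_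
    rintro ⟨a, b⟩ ⟨a', b'⟩ h
    cases b <;> cases b' <;> simp only [Subtype.mk.injEq] at h <;>
      obtain rfl : a = a' := congrFun h 0
    · rfl
    · exact absurd (congrFun h 1) (hyz a).ne'
    · exact absurd (congrFun h 1) (hyz a).ne
    · rfl
  rw [Nat.card_prod, Nat.card_eq_fintype_card, Fintype.card_fin, Nat.card_eq_fintype_card,
    Fintype.card_bool] at h1
  calc 2 * (n : ℝ) = ((n * 2 : ℕ) : ℝ) := by push_cast; ring
    _ ≤ _ := by exact_mod_cast h1

variable {α : ℝ} (hα : 0 < α)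

/-- The triangle count concentrates around `M = n ^ 3 p ^ 3`, which tends to infinity but is at most
`n`. A count of 0 deviates by `M`. If all vertices lay in triangles, the count would be at least `2
n ≥ 2 M`, again a deviation of at least `M`. -/
theorem aas_exists_inTriangle_and_exists_not (h1 : 2 / 3 ≤ α) (h2 : α < 1) :
    AAS (powEdgeProb α hα) fun _ G => (∃ x, G.InTriangle x) ∧ ∃ x, ¬ G.InTriangle x := by
  have hM : Tendsto (fun n : ℕ => (n : ℝ) ^ 3 * ((n : ℝ) ^ (-α)) ^ 3) atTop atTop :=
    tendsto_natCast_pow_mul_rpow_pow_atTop (by push_cast; linarith)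
  have hm : Tendsto (fun n : ℕ => (n : ℝ) ^ 2 * ((n : ℝ) ^ (-α)) ^ 1) atTop atTop :=
    tendsto_natCast_pow_mul_rpow_pow_atTop (by push_cast; linarith)
  have hb : Tendsto (fun n : ℕ => 4 * ((81 / ((n : ℝ) ^ 2 * ((n : ℝ) ^ (-α)) ^ 1) +
      27 / ((n : ℝ) ^ 3 * ((n : ℝ) ^ (-α)) ^ 3)) +
      2 * (1 - (n.descFactorial 3 : ℝ) / (n : ℝ) ^ 3))) atTop (𝓝 0) := by
    have := (((tendsto_const_nhds (x := (81 : ℝ))).div_atTop hm).add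
      ((tendsto_const_nhds (x := (27 : ℝ))).div_atTop hM)).add
      (((tendsto_const_nhds (x := (1 : ℝ))).sub (tendsto_descFactorial_div_pow 3)).const_mul 2)
    simpa using this.const_mul 4
  refine AAS.of_le ?_ hb
  filter_upwards [eventually_gt_atTop 0] with n hn
  have hn' : (0 : ℝ) < n := by exact_mod_cast hn
  have hq : 0 < (n : ℝ) ^ (-α) := Real.rpow_pos_of_pos hn' _
  have hMn : (n : ℝ) ^ 3 * ((n : ℝ) ^ (-α)) ^ 3 ≤ n := by
    rw [natCast_pow_mul_rpow_pow 3 3 hn]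
    have h1n : (1 : ℝ) ≤ n := by exact_mod_cast hn
    refine (Real.rpow_le_rpow_of_exponent_le h1n ?_).trans_eq (Real.rpow_one _)
    push_cast
    linarith
  refine graphProb_le_of_second_moment (powEdgeProb α hα n).2 (by positivity)
    (le_graphExp_eventCount_triangle hα hn)
    ((graphExp_eventCount_triangle_sq_le (powEdgeProb α hα n).2).trans_eq ?_) fun G hG => ?_
  -- Dividing by `M²` turns `81 n ^ 4 p ^ 5` into `81 / (n ^ 2 p)` and `27 M` into `27 / M`.
  · rw [coe_powEdgeProb]
    field_simp
    ring
  · rw [not_and_or] at hG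
    rcases hG with hG | hG
    · rw [eventCount_eq_zero fun ⟨f, hf⟩ => hG (exists_inTriangle_of_isCopy hf), zero_sub, abs_neg,
        abs_of_pos (by positivity)]
      have : 0 < (n : ℝ) ^ 3 * ((n : ℝ) ^ (-α)) ^ 3 := by positivity
      linarith
    · push Not at hG
      have := two_mul_le_eventCount_triangle hG
      refine le_trans ?_ (le_abs_self _)
      have : 0 < (n : ℝ) ^ 3 * ((n : ℝ) ^ (-α)) ^ 3 := by positivity
      linarith

end Triangles

/-! ### The random graph for `1 / 2 ≤ α < 1` -/

section Middle

variable {α : ℝ} (hα : 0 < α)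

theorem aas_forall {A : ∀ n, Fin n → SimpleGraph (Fin n) → Prop} {β c C : ℝ} (hβ : 0 < β)
    (hc : 0 < c) (h : ∀ᶠ n : ℕ in atTop, ∀ x : Fin n,
      graphProb (powEdgeProb α hα n : ℝ) (fun G => ¬ A n x G) ≤
        C * Real.exp (-(c * (n : ℝ) ^ β))) :
    AAS (powEdgeProb α hα) fun n G => ∀ x, A n x G := by
  have h0 := (tendsto_natCast_pow_mul_exp_neg hβ hc 1).const_mul C
  rw [mul_zero] at h0
  refine AAS.of_le (h.mono fun n hn => ?_) h0
  rw [graphProb_congr (B := fun G => ∃ x, ¬ A n x G) fun G => not_forall]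
  refine (graphProb_exists_le (powEdgeProb α hα n).2 (fun x G => ¬ A n x G) hn).trans_eq ?_
  rw [Fintype.card_fin]
  ring

theorem tendsto_natCast_mul_rpow_atTop (h : α < 1) :
    Tendsto (fun n : ℕ => (n : ℝ) * (n : ℝ) ^ (-α)) atTop atTop := by
  simpa using tendsto_natCast_pow_mul_rpow_pow_atTop (α := α) (m := 1) (e := 1) (by simpa using h)

theorem aas_forall_hasSparsePairs (h1 : 1 / 2 ≤ α) (h2 : α < 1) :
    AAS (powEdgeProb α hα) fun _ G => ∀ x, G.HasSparsePairs x := by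
  refine aas_forall hα (β := 1 - α) (c := Real.exp (-6) ^ 2 / 48) (C := 4) (by linarith)
    (by positivity) ?_
  filter_upwards [eventually_ge_atTop 4,
    (tendsto_powEdgeProb hα).eventually (eventually_le_nhds (by norm_num : (0 : ℝ) < 1 / 12)),
    ((tendsto_natCast_mul_rpow_atTop h2).const_mul_atTop
      (by positivity : 0 < Real.exp (-6) / 6)).eventually_ge_atTop 2] with n hn hsmall hlarge x
  have hn0 : 0 < n := by omega
  have := graphProb_not_hasSparsePairs_le (powEdgeProb α hα n).2 hn hsmall ?_ hlarge x
  · rwa [coe_powEdgeProb, natCast_mul_rpow_eq hn0] at this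
  · have h3 := natCast_pow_mul_rpow_pow (α := α) 1 2 hn0
    rw [pow_one] at h3
    rw [coe_powEdgeProb, h3]
    refine Real.rpow_le_one_of_one_le_of_nonpos (by exact_mod_cast hn0) ?_
    push_cast
    linarith

theorem aas_forall_inTriangle (h1 : 1 / 2 ≤ α) (h2 : α < 2 / 3) :
    AAS (powEdgeProb α hα) fun _ G => ∀ x, G.InTriangle x := by
  refine aas_forall hα (β := 2 - 3 * α) (c := 1 / 64) (C := 3) (by linarith) (by norm_num) ?_
  filter_upwards [eventually_ge_atTop 4,
    (tendsto_natCast_mul_rpow_atTop (by linarith : α < 1)).eventually_ge_atTop 8]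
    with n hn hlarge x
  have hn0 : 0 < n := by omega
  have h3 := graphProb_not_inTriangle_le (powEdgeProb α hα n).2 hn hlarge x
  have h4 := natCast_pow_mul_rpow_pow (α := α) 2 3 hn0
  have h5 : ((2 : ℕ) : ℝ) - α * (3 : ℕ) = 2 - 3 * α := by push_cast; ring
  rw [h5] at h4
  rw [coe_powEdgeProb, h4, natCast_mul_rpow_eq hn0] at h3
  -- `2 - 3 α ≤ 1 - α` because `α ≥ 1 / 2`; the degree error is absorbed into the triangle error,
  -- whence `C = 3`.
  have h6 : (n : ℝ) ^ (2 - 3 * α) ≤ (n : ℝ) ^ (1 - α) :=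
    Real.rpow_le_rpow_of_exponent_le (by exact_mod_cast hn0) (by linarith)
  have h7 : 0 ≤ (n : ℝ) ^ (1 - α) := by positivity
  have h8 : Real.exp (-(1 / 8 * (n : ℝ) ^ (1 - α))) ≤
      Real.exp (-(1 / 64 * (n : ℝ) ^ (2 - 3 * α))) :=
    Real.exp_le_exp.2 (by linarith)
  rw [coe_powEdgeProb]
  linarith

/-- The limiting type changes at 2/3, but at 2/3 itself there are a.a.s. vertices of both kinds, so
the law survives there. -/
theorem obeysFOZeroOneLaw_of_half_le (h1 : 1 / 2 ≤ α) (h2 : α < 1) :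
    ObeysFOZeroOneLaw (powEdgeProb α hα) 3 := by
  have h3 := (aas_rich hα h2).and (aas_forall_hasSparsePairs hα h1 h2)
  rcases lt_or_ge α (2 / 3) with h | h
  · exact obeysFOZeroOneLaw_of_aas (h3.and (aas_forall_inTriangle hα h1 h))
      fun _ _ _ _ hG hH => hG.1.1.graphType_eq_of_forall_inTriangle hH.1.1 hG.1.2 hH.1.2 hG.2 hH.2
  · exact obeysFOZeroOneLaw_of_aas (h3.and (aas_exists_inTriangle_and_exists_not hα h h2))
      fun _ _ _ _ hG hH => hG.1.1.graphType_eq_of_exists_inTriangle hH.1.1 hG.1.2 hH.1.2 hG.2 hH.2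

end Middle

end SimpleGraph

/-! ### Assembly of the theorem -/

open SimpleGraph

/-- For `α > 0`, the random graph `G(n, n ^ (-α))` does not obey the FO zero-one 3-law iff
`α ∈ {1, 7/6, 6/5, 5/4, 4/3, 3/2, 2}`. -/
theorem theorem5 (α : ℝ) (hα : 0 < α) :
    ¬ ObeysFOZeroOneLaw (powEdgeProb α hα) 3 ↔
      α ∈ ({1, 7 / 6, 6 / 5, 5 / 4, 4 / 3, 3 / 2, 2} : Set ℝ) := by
  simp only [Set.mem_insert_iff, Set.mem_singleton_iff]
  constructor
  · intro h
    by_contra hne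
    push Not at hne
    obtain ⟨h1, h7, h6, h5, h4, h3, h2⟩ := hne
    refine h ?_
    rcases lt_or_ge α (1 / 2) with hlt | hge
    · exact obeysFOZeroOneLaw_of_lt_half hα hlt
    rcases lt_or_gt_of_ne h1 with hlt | hgt
    · exact obeysFOZeroOneLaw_of_half_le hα hge hlt
    -- For `2 ≤ m ≤ 7` the equation means `α = m / (m - 1)`, an excluded value; `m = 1` is
    -- impossible, and `m = 0` would give `α = 0`.
    · have hne : ∀ m : ℕ, m ≤ 7 → α * (m - 1) ≠ m := by
        intro m hm heq
        interval_cases m <;> norm_num at heq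
        · linarith
        · exact h2 heq
        · exact h3 (by linarith)
        · exact h4 (by linarith)
        · exact h5 (by linarith)
        · exact h6 (by linarith)
        · exact h7 (by linarith)
      have hle : ∀ T ∈ witnessTrees, T.1 ≤ 7 := by decide
      exact obeysFOZeroOneLaw_of_one_lt hα hgt fun T hT => hne T.1 (hle T hT)
  · rintro (rfl | rfl | rfl | rfl | rfl | rfl | rfl)
    · exact not_obeysFOZeroOneLaw_one
    · exact not_obeysFOZeroOneLaw_seven_sixths hα
    · exact not_obeysFOZeroOneLaw_six_fifths hα
    · exact not_obeysFOZeroOneLaw_five_fourths hα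
    · exact not_obeysFOZeroOneLaw_four_thirds hα
    · exact not_obeysFOZeroOneLaw_three_halves hα
    · exact not_obeysFOZeroOneLaw_two
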